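/- Let $n\ge 1$, $\alpha\in(0,2n)$ and $1<p_1,p_2,p_3<\infty$, and write $p'=p/(p-1)$. There is a constant $C=C(n,\alpha,p_1,p_2,p_3)<\infty$ such that for all locally finite Borel measures $\sigma_1,\sigma_2,\sigma_3$ on $\mathbb R^n$, and for either of the two localizations below, any two of the three quantities $$ N:=\|\mathcal I_\alpha(\cdot\,\sigma_1,\cdot\,\sigma_2)\|_{L^{p_1}(\sigma_1)\times L^{p_2}(\sigma_2)\to L^{p_3'}(\sigma_3)},\qquad \sum_{t\in\{0,1/3\}^n}\ \sum_{(i,j,k)\in S_3}\mathfrak W^{\mathcal D^t}_{(i,j,k)},\qquad \sum_{t\in\{0,1/3\}^n}\ \sum_{(i,j,k)\in S_3}\mathfrak T^{\mathcal D^t}_{(i,j,k)} $$ in $[0,\infty]$ are each at most $C$ times the other. Here $S_3$ is the set of permutations of $(1,2,3)$, and the notation is as follows. **Operators.** For nonnegative measurable $f_1,f_2$, $$\mathcal I_\alpha(f_1\sigma_1,f_2\sigma_2)(x)=\int_{\mathbb R^n}\int_{\mathbb R^n}\frac{f_1(y_1)f_2(y_2)}{(|x-y_1|+|x-y_2|)^{2n-\alpha}}\,d\sigma_2(y_2)\,d\sigma_1(y_1)\in[0,\infty],$$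 where the kernel is $\infty$ for $x=y_1=y_2$, and $N\in[0,\infty]$ is the least constant in $\|\mathcal I_\alpha(f_1\sigma_1,f_2\sigma_2)\|_{L^{p_3'}(\sigma_3)}\le N\|f_1\|_{L^{p_1}(\sigma_1)}\|f_2\|_{L^{p_2}(\sigma_2)}$ for all such $f_1,f_2$. For $(i,j,k)\in S_3$, $\mathcal I_\alpha(\cdot\,\sigma_j,\cdot\,\sigma_k)$ denotes $\mathcal I_\alpha$ itself if $i=3$, and otherwise its partial adjoint, i.e. the integral operator with $\int \mathcal I_\alpha(f_j\sigma_j,f_k\sigma_k)f_i\,d\sigma_i=\int \mathcal I_\alpha(f_1\sigma_1,f_2\sigma_2)f_3\,d\sigma_3$, whose kernel is $(|x_3-x_1|+|x_3-x_2|)^{-(2n-\alpha)}$, with $x_i$ the output variable and $x_j,x_k$ the integration variables. For a cube $Q$, $\mathcal I_{\alpha,Q}(\sigma_j,\sigma_k)$ denotes either (for all cubes and permutations) $\mathcal I_\alpha(1_Q\sigma_j,1_Q\sigma_k)$ or (for all cubes and permutations) $1_Q\,\mathcal I_\alpha(1_Q\sigma_j,1_Q\sigma_k)$. **Grids and sparse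 families.** For $t\in\{0,1/3\}^n$, $\mathcal D^t=\{2^{-k}([0,1)^n+m+(-1)^kt):k\in\mathbb Z,\ m\in\mathbb Z^n\}$. A family $\mathcal F\subseteq\mathcal D^t$ is $\sigma$-sparse if there are pairwise disjoint measurable sets $E(F)\subseteq F$, $F\in\mathcal F$, with $\sigma(E(F))\ge\frac12\sigma(F)$. **Exponents.** $\frac1{r_k}=\bigl(1-\frac1{p_i}-\frac1{p_j}\bigr)_+$ and $\frac1r=\bigl(1-\frac1{p_1}-\frac1{p_2}-\frac1{p_3}\bigr)_+$, so $r_k,r\in(1,\infty]$. In all quotients below, $0/0=0$. **Sequential testing constants.** With the supremum over all $\sigma_j$-sparse $\mathcal F_j\subseteq\mathcal D^t$ and all $\sigma_k$-sparse $\mathcal F_k\subseteq\mathcal D^t$, $$\mathfrak T^{\mathcal D^t}_{(i,j,k)}=\sup_{\mathcal F_j,\mathcal F_k}\Bigl\|\Bigl\{\Bigl\|\Bigl\{\frac{\|\mathcal I_{\alpha,F_j}(\sigma_j,\sigma_k)\|_{L^{p_i'}(\sigma_i)}}{\sigma_j(F_j)^{1/p_j}\sigma_k(F_k)^{1/p_k}}\Bigr\}_{F_j\in\mathcal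 F_j:\,F_j\subseteq F_k}\Bigr\|_{\ell^{r_k}}\Bigr\}_{F_k\in\mathcal F_k}\Bigr\|_{\ell^r}.$$ **Abstract Wolff constants.** If $\frac1{p_i}+\frac1{p_j}\ge1$, $$\mathfrak W^{\mathcal D^t}_{(i,j,k)}=\sup_{Q\in\mathcal D^t}\frac{\|\mathcal I_{\alpha,Q}(\sigma_j,\sigma_k)\|_{L^{p_i'}(\sigma_i)}}{\sigma_j(Q)^{1/p_j}\sigma_k(Q)^{1/p_k}}.$$ If $\frac1{p_i}+\frac1{p_j}<1$, put $W_Q=\sup_{Q'\in\mathcal D^t,\,Q'\subseteq Q}\frac{1_{Q'}}{\sigma_j(Q')}\|\mathcal I_{\alpha,Q'}(\sigma_j,\sigma_k)\|_{L^{p_i'}(\sigma_i)}^{p_i'}$. If in addition $\frac1{p_1}+\frac1{p_2}+\frac1{p_3}\ge1$, $$\mathfrak W^{\mathcal D^t}_{(i,j,k)}=\sup_{Q\in\mathcal D^t}\frac{\|W_Q^{1/p_i'}\|_{L^{r_k}(\sigma_j)}}{\sigma_k(Q)^{1/p_k}},$$ while if $\frac1{p_1}+\frac1{p_2}+\frac1{p_3}<1$,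 $$\mathfrak W^{\mathcal D^t}_{(i,j,k)}=\|W^{1/r_k}\|_{L^r(\sigma_k)},\qquad W=\sup_{Q\in\mathcal D^t}\frac{1_Q}{\sigma_k(Q)}\|W_Q^{1/p_i'}\|_{L^{r_k}(\sigma_j)}^{r_k}.$$ -/

import Mathlib

open MeasureTheory
open scoped ENNReal NNReal

noncomputable section

namespace BilinearFractional

/-- `ℝⁿ` with the Euclidean norm. -/
abbrev Rn (n : ℕ) : Type := EuclideanSpace ℝ (Fin n)

/-! ### The operator and its norm -/

/-- The kernel `(|x - y₁| + |x - y₂|)^{-(2n - α)}`; it equals `∞` when `x = y₁ = y₂`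
(for `α < 2n`). -/
def kernel {n : ℕ} (α : ℝ) (x y₁ y₂ : Rn n) : ℝ≥0∞ :=
  ((edist x y₁ + edist x y₂) ^ (2 * (n : ℝ) - α))⁻¹

/-- The bilinear fractional integral
`𝓘_α(f₁σ₁, f₂σ₂)(x) = ∫∫ f₁(y₁) f₂(y₂) (|x - y₁| + |x - y₂|)^{-(2n-α)} dσ₁(y₁) dσ₂(y₂)`
of nonnegative functions. -/
def fracInt {n : ℕ} (α : ℝ) (σ₁ σ₂ : Measure (Rn n)) (f₁ f₂ : Rn n → ℝ≥0∞) (x : Rn n) : ℝ≥0∞ :=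
  ∫⁻ y₁, ∫⁻ y₂, f₁ y₁ * f₂ y₂ * kernel α x y₁ y₂ ∂σ₂ ∂σ₁

/-- The norm of `𝓘_α(· σ₁, · σ₂) : L^{p₁}(σ₁) × L^{p₂}(σ₂) → L^{p₃'}(σ₃)`, i.e. the least
`C ∈ [0, ∞]` with `‖𝓘_α(f₁σ₁, f₂σ₂)‖ ≤ C ‖f₁‖ ‖f₂‖` for all `f₁, f₂`. The kernel being positive,
it is enough to let `f₁, f₂` be nonnegative. The indices `1, 2, 3` are `0, 1, 2 : Fin 3`. -/
def opNorm {n : ℕ} (α : ℝ) (p : Fin 3 → ℝ) (σ : Fin 3 → Measure (Rn n)) : ℝ≥0∞ :=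
  sInf {C : ℝ≥0∞ | ∀ f₁ f₂ : Rn n → ℝ≥0∞, Measurable f₁ → Measurable f₂ →
    eLpNorm (fracInt α (σ 0) (σ 1) f₁ f₂) (ENNReal.ofReal (p 2).conjExponent) (σ 2) ≤
      C * (eLpNorm f₁ (ENNReal.ofReal (p 0)) (σ 0) * eLpNorm f₂ (ENNReal.ofReal (p 1)) (σ 1))}

/-- For a permutation `(i, j, k) = (e 0, e 1, e 2)` of the three indices, the bilinear operator
`𝓘_α(· σ_j, · σ_k)` whose values are functions of the `i`-th variable: `𝓘_α` itself if `i` is the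
third index and its partial adjoint otherwise, so that
`∫ 𝓘_α(f_j σ_j, f_k σ_k) f_i dσ_i = ∫ 𝓘_α(f₁σ₁, f₂σ₂) f₃ dσ₃`.
With `w = ![x, y, z] ∘ e⁻¹`, i.e. `w_i = x`, `w_j = y`, `w_k = z`, its kernel is
`(|w₃ - w₁| + |w₃ - w₂|)^{-(2n-α)}`. -/
def partialOp {n : ℕ} (α : ℝ) (σ : Fin 3 → Measure (Rn n)) (e : Equiv.Perm (Fin 3))
    (f g : Rn n → ℝ≥0∞) (x : Rn n) : ℝ≥0∞ :=
  ∫⁻ y, ∫⁻ z, f y * g z *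
    kernel α (![x, y, z] (e.symm 2)) (![x, y, z] (e.symm 0)) (![x, y, z] (e.symm 1))
      ∂(σ (e 2)) ∂(σ (e 1))

/-- The two localizations `T(· 1_Q, · 1_Q)` and `1_Q T(· 1_Q, · 1_Q)` of an operator `T`. -/
inductive Loc : Type
  | input
  | inputOutput

/-- The function `𝓘_{α,Q}(σ_j, σ_k)`, for `(i, j, k) = (e 0, e 1, e 2)`. -/
def localized {n : ℕ} (loc : Loc) (α : ℝ) (σ : Fin 3 → Measure (Rn n)) (e : Equiv.Perm (Fin 3))
    (Q : Set (Rn n)) : Rn n → ℝ≥0∞ :=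
  match loc with
  | Loc.input => partialOp α σ e (Q.indicator 1) (Q.indicator 1)
  | Loc.inputOutput => Q.indicator (partialOp α σ e (Q.indicator 1) (Q.indicator 1))

/-- `‖𝓘_{α,Q}(σ_j, σ_k)‖_{L^{p_i'}(σ_i)}`. -/
def testNorm {n : ℕ} (loc : Loc) (α : ℝ) (p : Fin 3 → ℝ) (σ : Fin 3 → Measure (Rn n))
    (e : Equiv.Perm (Fin 3)) (Q : Set (Rn n)) : ℝ≥0∞ :=
  eLpNorm (localized loc α σ e Q) (ENNReal.ofReal (p (e 0)).conjExponent) (σ (e 0))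

/-! ### Shifted dyadic grids and sparse families -/

/-- The set `{0, 1/3}ⁿ` of shifts. -/
def shifts (n : ℕ) : Finset (Fin n → ℝ) :=
  Fintype.piFinset fun _ => {0, 1 / 3}

/-- The cube `2^{-k} ([0,1)ⁿ + m + (-1)^k t)`. -/
def cube {n : ℕ} (t : Fin n → ℝ) (k : ℤ) (m : Fin n → ℤ) : Set (Rn n) :=
  {x | ∀ l, (2 : ℝ) ^ (-k) * (m l + (-1 : ℝ) ^ k * t l) ≤ x l ∧
    x l < (2 : ℝ) ^ (-k) * (1 + m l + (-1 : ℝ) ^ k * t l)}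

/-- The shifted dyadic grid `𝒟^t`. -/
def grid {n : ℕ} (t : Fin n → ℝ) : Set (Set (Rn n)) :=
  {Q | ∃ (k : ℤ) (m : Fin n → ℤ), Q = cube t k m}

/-- `𝓕` is a `μ`-sparse subfamily of `𝓓`. -/
def IsSparse {n : ℕ} (μ : Measure (Rn n)) (𝓓 𝓕 : Set (Set (Rn n))) : Prop :=
  𝓕 ⊆ 𝓓 ∧ ∃ E : Set (Rn n) → Set (Rn n),
    (∀ F ∈ 𝓕, MeasurableSet (E F) ∧ E F ⊆ F ∧ 2⁻¹ * μ F ≤ μ (E F)) ∧ 𝓕.PairwiseDisjoint E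

/-! ### Exponents and sequence norms -/

/-- The exponent `r_k ∈ (1, ∞]`, `1 / r_k = (1 - 1/p_i - 1/p_j)₊`, for
`(i, j, k) = (e 0, e 1, e 2)`. -/
def rk (p : Fin 3 → ℝ) (e : Equiv.Perm (Fin 3)) : ℝ≥0∞ :=
  (ENNReal.ofReal (1 - 1 / p (e 0) - 1 / p (e 1)))⁻¹

/-- The exponent `r ∈ (1, ∞]`, `1 / r = (1 - 1/p₁ - 1/p₂ - 1/p₃)₊`. -/
def rTot (p : Fin 3 → ℝ) : ℝ≥0∞ :=
  (ENNReal.ofReal (1 - 1 / p 0 - 1 / p 1 - 1 / p 2))⁻¹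

/-- The `ℓ^s` norm, `0 < s ≤ ∞`, of a family of elements of `[0, ∞]`. -/
def seqNorm {ι : Type*} (s : ℝ≥0∞) (a : ι → ℝ≥0∞) : ℝ≥0∞ :=
  if s = ∞ then ⨆ i, a i else (∑' i, a i ^ s.toReal) ^ (1 / s.toReal)

/-! ### Sequential testing constants

In all quotients below `0 / 0 = 0` in `[0, ∞]`: a cube that is null for `σ_j` or `σ_k`
contributes `0`. -/

/-- The sequential testing constant `𝔗_{(i,j,k)}` with respect to the grid `𝓓`, for
`(i, j, k) = (e 0, e 1, e 2)`. -/
def seqTesting {n : ℕ} (loc : Loc) (α : ℝ) (p : Fin 3 → ℝ) (σ : Fin 3 → Measure (Rn n))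
    (𝓓 : Set (Set (Rn n))) (e : Equiv.Perm (Fin 3)) : ℝ≥0∞ :=
  ⨆ (𝓕j : Set (Set (Rn n))) (𝓕k : Set (Set (Rn n)))
    (_ : IsSparse (σ (e 1)) 𝓓 𝓕j) (_ : IsSparse (σ (e 2)) 𝓓 𝓕k),
    seqNorm (rTot p) fun Fk : {F // F ∈ 𝓕k} =>
      seqNorm (rk p e) fun Fj : {F // F ∈ 𝓕j ∧ F ⊆ Fk.1} =>
        testNorm loc α p σ e Fj.1 /
          (σ (e 1) Fj.1 ^ (1 / p (e 1)) * σ (e 2) Fk.1 ^ (1 / p (e 2)))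

/-! ### Abstract Wolff potentials and constants -/

/-- The function
`W_{Q,(i,j,k)} = sup_{Q' ∈ 𝓓, Q' ⊆ Q} 1_{Q'} σ_j(Q')⁻¹ ‖𝓘_{α,Q'}(σ_j, σ_k)‖_{L^{p_i'}(σ_i)}^{p_i'}`. -/
def wolffLocal {n : ℕ} (loc : Loc) (α : ℝ) (p : Fin 3 → ℝ) (σ : Fin 3 → Measure (Rn n))
    (𝓓 : Set (Set (Rn n))) (e : Equiv.Perm (Fin 3)) (Q : Set (Rn n)) (x : Rn n) : ℝ≥0∞ :=
  ⨆ Q' ∈ {Q' ∈ 𝓓 | Q' ⊆ Q}, Q'.indicator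
    (fun _ => testNorm loc α p σ e Q' ^ (p (e 0)).conjExponent / σ (e 1) Q') x

/-- `‖W_{Q,(i,j,k)}^{1/p_i'}‖_{L^{r_k}(σ_j)}`. -/
def wolffLocalNorm {n : ℕ} (loc : Loc) (α : ℝ) (p : Fin 3 → ℝ) (σ : Fin 3 → Measure (Rn n))
    (𝓓 : Set (Set (Rn n))) (e : Equiv.Perm (Fin 3)) (Q : Set (Rn n)) : ℝ≥0∞ :=
  eLpNorm (fun x => wolffLocal loc α p σ 𝓓 e Q x ^ (1 / (p (e 0)).conjExponent))
    (rk p e) (σ (e 1))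

/-- The function
`W_{(i,j,k)} = sup_{Q ∈ 𝓓} 1_Q σ_k(Q)⁻¹ ‖W_{Q,(i,j,k)}^{1/p_i'}‖_{L^{r_k}(σ_j)}^{r_k}`
(used only when `r_k < ∞`). -/
def wolffGlobal {n : ℕ} (loc : Loc) (α : ℝ) (p : Fin 3 → ℝ) (σ : Fin 3 → Measure (Rn n))
    (𝓓 : Set (Set (Rn n))) (e : Equiv.Perm (Fin 3)) (x : Rn n) : ℝ≥0∞ :=
  ⨆ Q ∈ 𝓓, Q.indicator
    (fun _ => wolffLocalNorm loc α p σ 𝓓 e Q ^ (rk p e).toReal / σ (e 2) Q) x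

/-- The abstract Wolff constant `𝔚_{(i,j,k)}` with respect to the grid `𝓓`. -/
def wolff {n : ℕ} (loc : Loc) (α : ℝ) (p : Fin 3 → ℝ) (σ : Fin 3 → Measure (Rn n))
    (𝓓 : Set (Set (Rn n))) (e : Equiv.Perm (Fin 3)) : ℝ≥0∞ :=
  if 1 ≤ 1 / p (e 0) + 1 / p (e 1) then
    ⨆ Q ∈ 𝓓, testNorm loc α p σ e Q /
      (σ (e 1) Q ^ (1 / p (e 1)) * σ (e 2) Q ^ (1 / p (e 2)))
  else if 1 ≤ 1 / p (e 0) + 1 / p (e 1) + 1 / p (e 2) then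
    ⨆ Q ∈ 𝓓, wolffLocalNorm loc α p σ 𝓓 e Q / σ (e 2) Q ^ (1 / p (e 2))
  else
    eLpNorm (fun x => wolffGlobal loc α p σ 𝓓 e x ^ (1 / (rk p e).toReal)) (rTot p) (σ (e 2))

/-- `a ≲ b` and `b ≲ a`, both with the constant `C`. -/
def Comparable (C : ℝ≥0) (a b : ℝ≥0∞) : Prop :=
  a ≤ C * b ∧ b ≤ C * a

end BilinearFractional

end

noncomputable section

namespace BilinearFractional

/-! ### Inequalities for finite sums in `[0, ∞]` -/

/-! The equivalence is the cycle N ≲ 𝔗 ≲ 𝔚 ≲ N, where 𝔗 and 𝔚 are the two sums over grids and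
permutations. Put β = 2n - α > 0.

N ≲ 𝔗 (`opNorm_le_seqTesting`). By the one-third trick, three points always lie in a cube of one of
the shifted grids whose diameter is comparable to their separation. So the kernel is dominated by
sums of (diam Q)^{-β} over cubes Q containing the three points (`inv_edist_le_of_coeff_le`).
Conversely, within one grid such a sum is geometric and is dominated by the kernel (`sum_coeff_le`).
By duality it remains to bound the form ∑ λ_Q ∏ ∫_Q f_i dσ_i (`trilinear_le`). For each i, choose
stopping cubes at which the average of f_i has doubled. The three stopping parents of Q all contain
Q, hence are nested in some order (i,j,k). With the j-parent F_j fixed, Hölder's inequality in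
L^{p_i'}(σ_i) produces the testing quantity of F_j. Two discrete Hölder inequalities, first in F_j
and then in F_k, finish the bound (`sum_ordered_le`). The exponents r_k and r are exactly what
brings the reciprocals up to at least 1 there. Stopping families are sparse, and the Carleson
embedding (`IsStopping.carleson`) returns the norms of the f_i.

𝔗 ≲ 𝔚 (`seqTesting_le_wolff`). A sum over a sparse family is moved to the disjoint sets E(F), on
each of which the coefficient of F is at most the maximal function defining the Wolff potential.
This is done once for each of the two families.

𝔚 ≲ N (`wolff_le_opNorm`). By Tonelli and duality N also bounds the partial adjoints
(`lintegral_partialOp_rpow_le`). The operator is then tested on powers of the Wolff maximal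
functions themselves. Stopping replaces a supremum by a sum, superadditivity of t^q puts the sum
inside the positive operator, and the resulting inequality contains the unknown norm on both sides,
to a smaller power on the right (`local_wolff_le`, `global_wolff_le`). Absorption needs finiteness,
so the argument is run on finite families of cubes, followed by monotone convergence. The global
case also uses an ℓ^u × ℓ^v → ℓ^q extension of the operator (`sum_bilin_rpow_le`). -/

theorem eLpNorm_ofReal_eq {X : Type*} [MeasurableSpace X] (μ : Measure X) {p : ℝ} (hp : 0 < p)
    (f : X → ℝ≥0∞) :
    eLpNorm f (ENNReal.ofReal p) μ = (∫⁻ x, f x ^ p ∂μ) ^ (1 / p) := by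
  rw [eLpNorm_eq_lintegral_rpow_enorm_toReal (by simpa using hp) ENNReal.ofReal_ne_top]
  simp [ENNReal.toReal_ofReal hp.le]

theorem sum_rpow_le_rpow_sum {ι : Type*} (S : Finset ι) (a : ι → ℝ≥0∞) {w : ℝ} (hw : 1 ≤ w) :
    ∑ i ∈ S, a i ^ w ≤ (∑ i ∈ S, a i) ^ w := by
  classical
  induction S using Finset.induction_on with
  | empty => simp
  | insert i S hi ih =>
    rw [Finset.sum_insert hi, Finset.sum_insert hi]
    exact (add_le_add le_rfl ih).trans (ENNReal.add_rpow_le_rpow_add _ _ hw)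

theorem sum_prod_rpow_le_of_sum_eq_one {ι κ : Type*} (S : Finset ι) (L : Finset κ)
    (a : κ → ι → ℝ≥0∞) {w : κ → ℝ} (hw : ∀ l ∈ L, 0 ≤ w l) (h1 : ∑ l ∈ L, w l = 1) :
    ∑ i ∈ S, ∏ l ∈ L, a l i ^ w l ≤ ∏ l ∈ L, (∑ i ∈ S, a l i) ^ w l := by
  let _ : MeasurableSpace S := ⊤
  have := ENNReal.lintegral_prod_norm_pow_le (α := S) (μ := Measure.count) L
    (f := fun l i => a l i) (fun l _ => (measurable_from_top).aemeasurable) h1 hw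
  simp only [lintegral_count, tsum_fintype] at this
  rw [Finset.sum_coe_sort S (fun i => ∏ l ∈ L, a l i ^ w l)] at this
  refine this.trans_eq (Finset.prod_congr rfl fun l _ => ?_)
  rw [Finset.sum_coe_sort S (fun i => a l i)]

/-- Hölder's inequality for finite sums, with exponents whose reciprocals add up to at least `1`. -/
theorem sum_prod_rpow_le {ι κ : Type*} (S : Finset ι) (L : Finset κ)
    (a : κ → ι → ℝ≥0∞) {w : κ → ℝ} (hw : ∀ l ∈ L, 0 ≤ w l) (h1 : 1 ≤ ∑ l ∈ L, w l) :
    ∑ i ∈ S, ∏ l ∈ L, a l i ^ w l ≤ ∏ l ∈ L, (∑ i ∈ S, a l i) ^ w l := by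
  set W := ∑ l ∈ L, w l with hW
  have hW0 : 0 < W := by linarith
  -- Normalize the exponents to sum to 1; the surplus power W ≥ 1 is recovered from the embedding of
  -- ℓ^1 into ℓ^W.
  have key := sum_prod_rpow_le_of_sum_eq_one S L a (w := fun l => w l / W)
    (fun l hl => div_nonneg (hw l hl) hW0.le) (by rw [← Finset.sum_div, ← hW, div_self hW0.ne'])
  have pw : ∀ b : κ → ℝ≥0∞, (∏ l ∈ L, b l ^ (w l / W)) ^ W = ∏ l ∈ L, b l ^ w l := fun b => by
    rw [← ENNReal.prod_rpow_of_nonneg hW0.le]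
    refine Finset.prod_congr rfl fun l _ => ?_
    rw [← ENNReal.rpow_mul, div_mul_cancel₀ _ hW0.ne']
  calc ∑ i ∈ S, ∏ l ∈ L, a l i ^ w l = ∑ i ∈ S, (∏ l ∈ L, a l i ^ (w l / W)) ^ W :=
        Finset.sum_congr rfl fun i _ => (pw fun l => a l i).symm
    _ ≤ (∑ i ∈ S, ∏ l ∈ L, a l i ^ (w l / W)) ^ W := sum_rpow_le_rpow_sum _ _ h1
    _ ≤ (∏ l ∈ L, (∑ i ∈ S, a l i) ^ (w l / W)) ^ W := ENNReal.rpow_le_rpow key hW0.le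
    _ = _ := pw _

theorem le_seqNorm_top {ι : Type*} (a : ι → ℝ≥0∞) (i : ι) : a i ≤ seqNorm ∞ a := by
  simp only [seqNorm, if_true]
  exact le_iSup a i

theorem sum_rpow_le_seqNorm {ι : Type*} {P : ι → Prop} {S : Finset ι} (hS : ∀ i ∈ S, P i)
    {s : ℝ≥0∞} (hs : s ≠ ∞) (a : ι → ℝ≥0∞) :
    (∑ i ∈ S, a i ^ s.toReal) ^ (1 / s.toReal) ≤ seqNorm s (fun i : {i // P i} => a i) := by
  classical
  simp only [seqNorm, if_neg hs]
  refine ENNReal.rpow_le_rpow ?_ (by positivity)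
  have h : ∑ i ∈ S, a i ^ s.toReal =
      ∑ i ∈ S.attach.map ⟨fun i => (⟨i.1, hS i.1 i.2⟩ : {i // P i}),
        fun x y h => Subtype.ext (by simpa using h)⟩, a i.1 ^ s.toReal := by
    rw [Finset.sum_map]
    exact (Finset.sum_attach S fun i => a i ^ s.toReal).symm
  rw [h]
  exact ENNReal.sum_le_tsum _

theorem seqNorm_mono {ι : Type*} (s : ℝ≥0∞) {a b : ι → ℝ≥0∞} (h : ∀ i, a i ≤ b i) :
    seqNorm s a ≤ seqNorm s b := by
  unfold seqNorm
  split_ifs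
  · exact iSup_mono h
  · exact ENNReal.rpow_le_rpow (ENNReal.tsum_le_tsum fun i =>
      ENNReal.rpow_le_rpow (h i) ENNReal.toReal_nonneg) (by positivity)

theorem seqNorm_mul_le {ι : Type*} {s : ℝ≥0∞} (hs : s ≠ 0) (a : ι → ℝ≥0∞) (c : ℝ≥0∞) :
    seqNorm s (fun i => a i * c) ≤ seqNorm s a * c := by
  unfold seqNorm
  split_ifs with h
  · exact iSup_le fun i => mul_le_mul_left (le_iSup a i) c
  · have h0 : 0 < s.toReal := ENNReal.toReal_pos hs h
    simp_rw [ENNReal.mul_rpow_of_nonneg _ _ h0.le, ENNReal.tsum_mul_right]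
    rw [ENNReal.mul_rpow_of_nonneg _ _ (by positivity), ← ENNReal.rpow_mul,
      mul_one_div_cancel h0.ne', ENNReal.rpow_one]

/-- Hölder's inequality with one factor in `ℓ^s`, `0 < s ≤ ∞`. -/
theorem sum_mul_prod_rpow_le_seqNorm {ι κ : Type*} {P : ι → Prop} {S : Finset ι}
    (hS : ∀ i ∈ S, P i) (L : Finset κ) {s : ℝ≥0∞} (hs : s ≠ 0) (A : ι → ℝ≥0∞)
    (b : κ → ι → ℝ≥0∞) {w : κ → ℝ} (hw : ∀ l ∈ L, 0 ≤ w l)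
    (h1 : 1 ≤ s⁻¹.toReal + ∑ l ∈ L, w l) :
    ∑ i ∈ S, A i * ∏ l ∈ L, b l i ^ w l ≤
      seqNorm s (fun i : {i // P i} => A i) * ∏ l ∈ L, (∑ i ∈ S, b l i) ^ w l := by
  by_cases h : s = ∞
  · subst h
    calc ∑ i ∈ S, A i * ∏ l ∈ L, b l i ^ w l
        ≤ ∑ i ∈ S, seqNorm ∞ (fun i : {i // P i} => A i) * ∏ l ∈ L, b l i ^ w l := by
          refine Finset.sum_le_sum fun i hi => ?_
          gcongr
          exact le_seqNorm_top (fun i : {i // P i} => A i) ⟨i, hS i hi⟩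
      _ ≤ _ := by
          rw [← Finset.mul_sum]
          gcongr
          exact sum_prod_rpow_le S L b hw (by simpa using h1)
  · have h0 : 0 < s.toReal := ENNReal.toReal_pos hs h
    have key := sum_prod_rpow_le S (Finset.insertNone L)
      (fun o : Option κ => o.elim (fun i => A i ^ s.toReal) b)
      (w := fun o : Option κ => o.elim (1 / s.toReal) w)
      (by rintro (_ | l) hl
          · simp
          · exact hw l (by simpa using hl))
      (by simpa [Finset.sum_insertNone, ENNReal.toReal_inv] using h1)
    simp only [Finset.prod_insertNone, Option.elim] at key
    refine le_trans (le_of_eq ?_) (key.trans ?_)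
    · refine Finset.sum_congr rfl fun i _ => ?_
      rw [← ENNReal.rpow_mul, mul_one_div_cancel h0.ne', ENNReal.rpow_one]
    · gcongr
      exact sum_rpow_le_seqNorm hS h A

/-- If `x ≤ C x^{1/p}` and `x` is finite, then `x^{1/q} ≤ C`, for conjugate exponents. -/
theorem rpow_le_of_le_mul_rpow {p q : ℝ} (hq : 0 < q) (hpq : 1 / p + 1 / q = 1)
    {x C : ℝ≥0∞} (hx : x ≠ ∞) (h : x ≤ C * x ^ (1 / p)) : x ^ (1 / q) ≤ C := by
  rcases eq_or_ne x 0 with rfl | h0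
  · rw [ENNReal.zero_rpow_of_pos (by positivity)]; exact zero_le
  · have hne : x ^ (1 / p) ≠ 0 := (ENNReal.rpow_pos (pos_iff_ne_zero.2 h0) hx).ne'
    have hnt : x ^ (1 / p) ≠ ∞ := ENNReal.rpow_ne_top_of_ne_zero h0 hx
    have h2 : x / x ^ (1 / p) ≤ C := ENNReal.div_le_of_le_mul h
    refine le_trans (le_of_eq ?_) h2
    rw [ENNReal.eq_div_iff hne hnt, ← ENNReal.rpow_add _ _ h0 hx, hpq, ENNReal.rpow_one]

/-! ### Duality -/

/-- The converse of Hölder's inequality. -/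
theorem lintegral_rpow_le_of_forall_dual {X : Type*} [MeasurableSpace X] (μ : Measure X)
    [SigmaFinite μ] {p : ℝ} (hp : 1 < p) {g : X → ℝ≥0∞} (hg : Measurable g) {C : ℝ≥0∞}
    (h : ∀ f : X → ℝ≥0∞, Measurable f → ∫⁻ x, f x ^ p ∂μ ≠ ∞ →
      ∫⁻ x, g x * f x ∂μ ≤ C * (∫⁻ x, f x ^ p ∂μ) ^ (1 / p)) :
    (∫⁻ x, g x ^ p.conjExponent ∂μ) ^ (1 / p.conjExponent) ≤ C := by
  set q := p.conjExponent with hq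
  have hpq : p.HolderConjugate q := Real.HolderConjugate.conjExponent hp
  have hq1 : 1 < q := hpq.symm.lt
  have hq0 : 0 < q := by linarith
  -- Truncation in height and in support makes the L^q norm finite, so that G^{q-1} is an admissible
  -- test function and its norm can be absorbed.
  let G : ℕ → X → ℝ≥0∞ := fun n => (spanningSets μ n).indicator fun x => min (g x) n
  have hGm : ∀ n, Measurable (G n) := fun n =>
    (hg.min measurable_const).indicator (measurableSet_spanningSets μ n)
  have hGmono : Monotone G := by
    intro m n hmn x
    refine (Set.indicator_le_indicator_of_subset (spanningSets_mono hmn)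
      (fun _ => zero_le) x).trans (Set.indicator_le_indicator ?_)
    gcongr
  have hGsup : ∀ x, ⨆ n, G n x = g x := by
    intro x
    apply le_antisymm
    · refine iSup_le fun n => ?_
      refine (Set.indicator_le_self' (fun _ _ => zero_le) x).trans (min_le_left _ _)
    · refine le_of_forall_lt fun c hc => ?_
      obtain ⟨m, hm⟩ := ENNReal.exists_nat_gt (ne_top_of_lt hc)
      obtain ⟨k, hk⟩ := Set.mem_iUnion.1
        ((iUnion_spanningSets μ).symm ▸ Set.mem_univ x : x ∈ ⋃ i, spanningSets μ i)
      refine lt_of_lt_of_le ?_ (le_iSup (fun n => G n x) (max m k))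
      have : x ∈ spanningSets μ (max m k) := spanningSets_mono (le_max_right _ _) hk
      simp only [G, Set.indicator_of_mem this]
      exact lt_min hc (hm.trans_le (by exact_mod_cast le_max_left m k))
  have hfin : ∀ n, ∫⁻ x, G n x ^ q ∂μ ≠ ∞ := by
    intro n
    have hb : ∀ x, G n x ^ q ≤ (spanningSets μ n).indicator (fun _ => (n : ℝ≥0∞) ^ q) x := by
      intro x
      by_cases hx : x ∈ spanningSets μ n
      · simp only [G, Set.indicator_of_mem hx]
        exact ENNReal.rpow_le_rpow (min_le_right _ _) hq0.le
      · simp [G, Set.indicator_of_notMem hx, hq0]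
    refine ne_top_of_le_ne_top ?_ (lintegral_mono hb)
    rw [lintegral_indicator (measurableSet_spanningSets μ n), setLIntegral_const]
    exact ENNReal.mul_ne_top (ENNReal.rpow_ne_top_of_nonneg hq0.le (by simp))
      (measure_spanningSets_lt_top μ n).ne
  have hn : ∀ n, (∫⁻ x, G n x ^ q ∂μ) ^ (1 / q) ≤ C := by
    intro n
    refine rpow_le_of_le_mul_rpow hq0 (by simpa using hpq.inv_add_inv_eq_one) (hfin n) ?_
    have hpow : ∀ x, (G n x ^ (q - 1)) ^ p = G n x ^ q := fun x => by
      rw [← ENNReal.rpow_mul]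
      congr 1
      have := hpq.symm.sub_one_mul_conj
      linarith
    have h1 := h (fun x => G n x ^ (q - 1)) ((hGm n).pow_const _) (by simp_rw [hpow]; exact hfin n)
    simp_rw [hpow] at h1
    refine le_trans (lintegral_mono fun x => ?_) h1
    calc G n x ^ q = G n x ^ (1 + (q - 1)) := by congr 1; ring
      _ = G n x * G n x ^ (q - 1) := by
        rw [ENNReal.rpow_add_of_nonneg _ _ zero_le_one (by linarith), ENNReal.rpow_one]
      _ ≤ g x * G n x ^ (q - 1) := by
        gcongr
        exact (Set.indicator_le_self' (fun _ _ => zero_le) x).trans (min_le_left _ _)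
  have hle : ∫⁻ x, g x ^ q ∂μ ≤ C ^ q := by
    have : ∫⁻ x, g x ^ q ∂μ = ⨆ n, ∫⁻ x, G n x ^ q ∂μ := by
      rw [← lintegral_iSup (fun n => (hGm n).pow_const q)
        (fun m n hmn x => ENNReal.rpow_le_rpow (hGmono hmn x) hq0.le)]
      refine lintegral_congr fun x => ?_
      rw [← hGsup x]
      exact (ENNReal.orderIsoRpow q hq0).map_iSup _
    rw [this]
    refine iSup_le fun n => ?_
    have := ENNReal.rpow_le_rpow (hn n) hq0.le
    rwa [← ENNReal.rpow_mul, one_div_mul_cancel hq0.ne', ENNReal.rpow_one] at this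
  calc _ ≤ (C ^ q) ^ (1 / q) := ENNReal.rpow_le_rpow hle (by positivity)
    _ = C := by rw [← ENNReal.rpow_mul, mul_one_div_cancel hq0.ne', ENNReal.rpow_one]

/-! ### Laminar families and stopping families -/

/-- Any two members of the family are nested or disjoint. -/
def IsLaminar {X : Type*} (G : Set (Set X)) : Prop :=
  ∀ A ∈ G, ∀ B ∈ G, A ⊆ B ∨ B ⊆ A ∨ Disjoint A B

/-- `𝓕` is the subfamily of `G` obtained by stopping, from large sets to small ones, whenever
the value of `a` has more than doubled. -/
def IsStopping {X : Type*} (a : Set X → ℝ≥0∞) (G 𝓕 : Finset (Set X)) : Prop :=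
  ∀ Q, Q ∈ 𝓕 ↔ Q ∈ G ∧ ∀ A ∈ 𝓕, Q ⊂ A → 2 * a A < a Q

/-- The maximal function `sup_{Q ∈ G} 1_Q a_Q`. -/
def maxFun {X : Type*} (G : Set (Set X)) (a : Set X → ℝ≥0∞) (x : X) : ℝ≥0∞ :=
  ⨆ Q ∈ G, Q.indicator (fun _ => a Q) x

/-- The sum `∑_m 2^{-mv}` of a geometric series. -/
def geomConst (v : ℝ) : ℝ≥0∞ := (1 - (2⁻¹ : ℝ≥0∞) ^ v)⁻¹

/-- Elements are added from large to small: no earlier element lies strictly below the new one. -/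
theorem induction_on_minimal {α : Type*} [PartialOrder α] [DecidableEq α] {P : Finset α → Prop}
    (h0 : P ∅) (step : ∀ G Q, Q ∉ G → (∀ A ∈ G, ¬ A < Q) → P G → P (insert Q G))
    (G : Finset α) : P G := by
  induction G using Finset.strongInduction with
  | H G ih =>
    rcases G.eq_empty_or_nonempty with rfl | hG
    · exact h0
    · obtain ⟨Q, hQ⟩ := G.exists_minimal hG
      rw [← Finset.insert_erase hQ.1]
      refine step _ _ (Finset.notMem_erase _ _) (fun A hA hlt => ?_)
        (ih _ (Finset.erase_ssubset hQ.1))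
      exact hlt.not_ge (hQ.2 (Finset.mem_of_mem_erase hA) hlt.le)

/-- The defining condition refers to 𝓕 itself, but only to strictly larger members. A set added
after all larger ones can therefore be decided at once, and its addition changes no earlier
decision. -/
theorem exists_isStopping {X : Type*} (a : Set X → ℝ≥0∞) (G : Finset (Set X)) :
    ∃ 𝓕, IsStopping a G 𝓕 := by
  classical
  refine induction_on_minimal (P := fun G => ∃ 𝓕, IsStopping a G 𝓕) ⟨∅, by simp [IsStopping]⟩ ?_ G
  rintro G Q hQG hmin ⟨𝓕, h𝓕⟩
  have hsub : ∀ {R}, R ∈ 𝓕 → R ∈ G := fun {R} hR => ((h𝓕 R).1 hR).1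
  by_cases hs : ∀ A ∈ 𝓕, Q ⊂ A → 2 * a A < a Q
  · refine ⟨insert Q 𝓕, fun R => ?_⟩
    rw [Finset.mem_insert, Finset.mem_insert]
    constructor
    · rintro (rfl | hR)
      · refine ⟨Or.inl rfl, fun A hA hRA => ?_⟩
        rcases Finset.mem_insert.1 hA with rfl | hA
        · exact absurd hRA (ssubset_irrefl _)
        · exact hs A hA hRA
      · refine ⟨Or.inr (hsub hR), fun A hA hRA => ?_⟩
        rcases Finset.mem_insert.1 hA with rfl | hA
        · exact absurd hRA (hmin R (hsub hR))
        · exact ((h𝓕 R).1 hR).2 A hA hRA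
    · rintro ⟨rfl | hR, h⟩
      · exact Or.inl rfl
      · exact Or.inr ((h𝓕 R).2 ⟨hR, fun A hA => h A (Finset.mem_insert_of_mem hA)⟩)
  · refine ⟨𝓕, fun R => ?_⟩
    rw [Finset.mem_insert]
    constructor
    · exact fun hR => ⟨Or.inr (hsub hR), ((h𝓕 R).1 hR).2⟩
    · rintro ⟨rfl | hR, h⟩
      · exact absurd h hs
      · exact (h𝓕 R).2 ⟨hR, h⟩

namespace IsStopping

variable {X : Type*} {a : Set X → ℝ≥0∞} {G 𝓕 : Finset (Set X)}

theorem subset (h : IsStopping a G 𝓕) : 𝓕 ⊆ G := fun Q hQ => ((h Q).1 hQ).1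

theorem two_mul_lt (h : IsStopping a G 𝓕) {F A : Set X} (hF : F ∈ 𝓕) (hA : A ∈ 𝓕)
    (hFA : F ⊂ A) : 2 * a A < a F := ((h F).1 hF).2 A hA hFA

end IsStopping

/-- In a laminar family the members containing a nonempty set form a chain, so a minimal one is the
smallest. -/
theorem exists_minimal_superset {X : Type*} {G : Set (Set X)} (hG : IsLaminar G)
    {𝓕 : Finset (Set X)} (h𝓕 : ↑𝓕 ⊆ G) {Q : Set X} (hQ : Q.Nonempty) (h : ∃ A ∈ 𝓕, Q ⊆ A) :
    ∃ P ∈ 𝓕, Q ⊆ P ∧ ∀ A ∈ 𝓕, Q ⊆ A → P ⊆ A := by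
  classical
  obtain ⟨A, hA, hQA⟩ := h
  obtain ⟨P, hP⟩ := (𝓕.filter (Q ⊆ ·)).exists_minimal ⟨A, by simp [hA, hQA]⟩
  have hP1 := Finset.mem_filter.1 hP.1
  refine ⟨P, hP1.1, hP1.2, fun B hB hQB => ?_⟩
  rcases hG P (h𝓕 hP1.1) B (h𝓕 hB) with h | h | h
  · exact h
  · exact hP.2 (by simp [hB, hQB]) h
  · obtain ⟨x, hx⟩ := hQ
    exact absurd (hQB hx) (Set.disjoint_left.1 h (hP1.2 hx))

/-- If Q was not selected, some selected A ⊃ Q violates doubling. Passing from A to the smallest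
selected superset can only increase the value of `a`. -/
theorem IsStopping.exists_parent {X : Type*} {a : Set X → ℝ≥0∞} {G 𝓕 : Finset (Set X)}
    (h : IsStopping a G 𝓕) (hG : IsLaminar (G : Set (Set X))) {Q : Set X} (hQG : Q ∈ G)
    (hQ : Q.Nonempty) :
    ∃ P ∈ 𝓕, Q ⊆ P ∧ a Q ≤ 2 * a P ∧ ∀ A ∈ 𝓕, Q ⊆ A → P ⊆ A := by
  have key : ∃ A ∈ 𝓕, Q ⊆ A ∧ a Q ≤ 2 * a A := by
    by_cases hQF : Q ∈ 𝓕
    · exact ⟨Q, hQF, subset_rfl, le_mul_of_one_le_left' one_le_two⟩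
    · have : ¬ ∀ A ∈ 𝓕, Q ⊂ A → 2 * a A < a Q := fun hh => hQF ((h Q).2 ⟨hQG, hh⟩)
      push Not at this
      obtain ⟨A, hA, hQA, hle⟩ := this
      exact ⟨A, hA, hQA.subset, hle⟩
  obtain ⟨A, hA, hQA, hle⟩ := key
  obtain ⟨P, hP, hQP, hmin⟩ := exists_minimal_superset hG (by exact_mod_cast h.subset) hQ
    ⟨A, hA, hQA⟩
  refine ⟨P, hP, hQP, hle.trans ?_, hmin⟩
  rcases (hmin A hA hQA).eq_or_ssubset with rfl | hss
  · exact le_rfl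
  · have h1 := h.two_mul_lt hP hA hss
    have h2 : a A ≤ 2 * a A := le_mul_of_one_le_left' one_le_two
    gcongr
    exact h2.trans h1.le

theorem geomConst_ne_top {v : ℝ} (hv : 0 < v) : geomConst v ≠ ∞ := by
  refine ENNReal.inv_ne_top.2 (tsub_pos_of_lt ?_).ne'
  exact ENNReal.rpow_lt_one (by simp) hv

theorem geomConst_eq {v : ℝ} (hv : 0 < v) :
    1 + (2⁻¹ : ℝ≥0∞) ^ v * geomConst v = geomConst v := by
  have h1 : (2⁻¹ : ℝ≥0∞) ^ v < 1 := ENNReal.rpow_lt_one (by simp) hv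
  have h2 : (1 - (2⁻¹ : ℝ≥0∞) ^ v) * geomConst v = 1 :=
    ENNReal.mul_inv_cancel (tsub_pos_of_lt h1).ne' (by simp)
  nth_rw 1 [← h2]
  rw [← add_mul, tsub_add_cancel_of_le h1.le, one_mul]

/-- Values that are pairwise a factor 2 apart decay at least geometrically below the largest, so the
sum of their powers is comparable to its top term. -/
theorem sum_rpow_le_of_doubling {ι : Type*} (S : Finset ι) (a : ι → ℝ≥0∞) {v : ℝ} (hv : 0 < v)
    (h : ∀ i ∈ S, ∀ j ∈ S, i ≠ j → 2 * a i ≤ a j ∨ 2 * a j ≤ a i) :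
    ∑ i ∈ S, a i ^ v ≤ geomConst v * (S.sup a) ^ v := by
  classical
  induction S using Finset.induction_on_max_value a with
  | empty => simp
  | insert m S hm hmax ih =>
    have hs : S.sup a ≤ 2⁻¹ * a m := by
      refine Finset.sup_le fun i hi => ?_
      have h2 : 2 * a i ≤ a m := by
        rcases h i (Finset.mem_insert_of_mem hi) m (Finset.mem_insert_self _ _)
          (by rintro rfl; exact hm hi) with h | h
        · exact h
        · calc 2 * a i ≤ 2 * a m := by gcongr; exact hmax i hi
            _ ≤ a i := h
            _ ≤ a m := hmax i hi
      calc a i = 2⁻¹ * (2 * a i) := by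
            rw [← mul_assoc, ENNReal.inv_mul_cancel two_ne_zero (by simp), one_mul]
        _ ≤ _ := by gcongr
    have hsup : (insert m S).sup a = a m := by
      rw [Finset.sup_insert]
      exact sup_of_le_left (Finset.sup_le hmax)
    rw [Finset.sum_insert hm, hsup]
    calc a m ^ v + ∑ i ∈ S, a i ^ v ≤ a m ^ v + geomConst v * (2⁻¹ * a m) ^ v := by
          gcongr
          exact (ih fun i hi j hj => h i (Finset.mem_insert_of_mem hi) j
            (Finset.mem_insert_of_mem hj)).trans (by gcongr)
      _ = (1 + (2⁻¹ : ℝ≥0∞) ^ v * geomConst v) * a m ^ v := by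
          rw [ENNReal.mul_rpow_of_nonneg _ _ hv.le]; ring
      _ = _ := by rw [geomConst_eq hv]

/-! ### Maximal functions and stopping families -/

section maxFun

variable {X : Type*} {G : Set (Set X)} {a : Set X → ℝ≥0∞}

theorem le_maxFun {Q : Set X} (hQ : Q ∈ G) {x : X} (hx : x ∈ Q) : a Q ≤ maxFun G a x :=
  le_iSup₂_of_le Q hQ (by rw [Set.indicator_of_mem hx])

theorem maxFun_le {x : X} {C : ℝ≥0∞} (h : ∀ Q ∈ G, x ∈ Q → a Q ≤ C) : maxFun G a x ≤ C := by
  refine iSup₂_le fun Q hQ => ?_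
  by_cases hx : x ∈ Q
  · rw [Set.indicator_of_mem hx]; exact h Q hQ hx
  · rw [Set.indicator_of_notMem hx]; exact zero_le

theorem maxFun_mono {G' : Set (Set X)} {a' : Set X → ℝ≥0∞} (hG : G ⊆ G')
    (ha : ∀ Q ∈ G, a Q ≤ a' Q) (x : X) : maxFun G a x ≤ maxFun G' a' x :=
  maxFun_le fun Q hQ hx => (ha Q hQ).trans (le_maxFun (hG hQ) hx)

theorem measurable_maxFun [MeasurableSpace X] (hG : G.Countable)
    (hm : ∀ Q ∈ G, MeasurableSet Q) : Measurable (maxFun G a) :=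
  Measurable.biSup _ hG fun Q hQ => measurable_const.indicator (hm Q hQ)

/-- The stopping sets containing x form a chain along which `a` more than doubles, so the sum is a
geometric series dominated by its largest term. -/
theorem IsStopping.sum_rpow_le {G 𝓕 : Finset (Set X)} (h : IsStopping a G 𝓕)
    (hG : IsLaminar (G : Set (Set X))) {v : ℝ} (hv : 0 < v) (x : X) :
    ∑ F ∈ 𝓕, F.indicator (fun _ => a F ^ v) x ≤ geomConst v * maxFun 𝓕 a x ^ v := by
  classical
  simp only [Set.indicator_apply]
  rw [← Finset.sum_filter]
  refine (sum_rpow_le_of_doubling _ a hv fun A hA B hB hAB => ?_).trans ?_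
  · rw [Finset.mem_filter] at hA hB
    rcases hG A (h.subset hA.1) B (h.subset hB.1) with hs | hs | hs
    · exact Or.inr (h.two_mul_lt hA.1 hB.1 (hs.ssubset_of_ne hAB)).le
    · exact Or.inl (h.two_mul_lt hB.1 hA.1 (hs.ssubset_of_ne hAB.symm)).le
    · exact absurd hB.2 (Set.disjoint_left.1 hs hA.2)
  · gcongr
    refine Finset.sup_le fun F hF => ?_
    rw [Finset.mem_filter] at hF
    exact le_maxFun (by exact_mod_cast hF.1) hF.2

theorem maxFun_rpow_le_sum {𝓕 : Finset (Set X)} {s : ℝ} (hs : 0 < s) (x : X) :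
    maxFun 𝓕 a x ^ s ≤ ∑ F ∈ 𝓕, F.indicator (fun _ => a F ^ s) x := by
  rw [← ENNReal.le_rpow_inv_iff hs]
  refine maxFun_le fun Q hQ hx => ?_
  rw [ENNReal.le_rpow_inv_iff hs]
  have := Finset.single_le_sum (f := fun F : Set X => F.indicator (fun _ => a F ^ s) x)
    (fun _ _ => zero_le) (Finset.mem_coe.1 hQ)
  simpa [Set.indicator_of_mem hx] using this

theorem IsStopping.maxFun_le {G 𝓕 : Finset (Set X)} (h : IsStopping a G 𝓕)
    (hG : IsLaminar (G : Set (Set X))) (x : X) :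
    maxFun G a x ≤ 2 * maxFun 𝓕 a x := by
  refine BilinearFractional.maxFun_le fun Q hQ hx => ?_
  obtain ⟨P, hP, hQP, hle, -⟩ := h.exists_parent hG hQ ⟨x, hx⟩
  refine hle.trans ?_
  gcongr
  exact le_maxFun (by exact_mod_cast hP) (hQP hx)

end maxFun

/-! ### Sparseness and the Carleson embedding for averages -/

/-- The union is the disjoint union of the maximal members, and the inequality adds up over these.
With sets added from large to small, each new one is either covered already or disjoint from
everything before. -/
theorem mul_measure_biUnion_le {X : Type*} [MeasurableSpace X] (μ ν : Measure X) {c : ℝ≥0∞}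
    (𝓐 : Finset (Set X)) (hm : ∀ A ∈ 𝓐, MeasurableSet A) (hl : IsLaminar (𝓐 : Set (Set X)))
    (h : ∀ A ∈ 𝓐, c * μ A ≤ ν A) : c * μ (⋃ A ∈ 𝓐, A) ≤ ν (⋃ A ∈ 𝓐, A) := by
  classical
  revert hm hl h
  refine induction_on_minimal (P := fun 𝓐 : Finset (Set X) => (∀ A ∈ 𝓐, MeasurableSet A) →
    IsLaminar (𝓐 : Set (Set X)) → (∀ A ∈ 𝓐, c * μ A ≤ ν A) →
    c * μ (⋃ A ∈ 𝓐, A) ≤ ν (⋃ A ∈ 𝓐, A)) (by simp) ?_ 𝓐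
  intro G Q hQ hmin ih hm hl h
  have ih' := ih (fun A hA => hm A (Finset.mem_insert_of_mem hA))
    (fun A hA B hB => hl A (by simpa using Or.inr hA) B (by simpa using Or.inr hB))
    (fun A hA => h A (Finset.mem_insert_of_mem hA))
  rw [Finset.set_biUnion_insert]
  by_cases hsub : ∃ B ∈ G, Q ⊆ B
  · obtain ⟨B, hB, hQB⟩ := hsub
    have hQU : Q ⊆ ⋃ A ∈ G, A := fun x hx => Set.mem_iUnion₂.2 ⟨B, hB, hQB hx⟩
    rwa [Set.union_eq_right.2 hQU]
  · push Not at hsub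
    have hd : Disjoint Q (⋃ A ∈ G, A) := by
      rw [Set.disjoint_iUnion₂_right]
      intro A hA
      rcases hl Q (by simp) A (by simpa using Or.inr hA) with h1 | h1 | h1
      · exact absurd h1 (hsub A hA)
      · refine absurd ?_ (hmin A hA)
        exact h1.ssubset_of_ne (by rintro rfl; exact hQ hA)
      · exact h1
    have hmU : MeasurableSet (⋃ A ∈ G, A) :=
      Finset.measurableSet_biUnion _ fun A hA => hm A (Finset.mem_insert_of_mem hA)
    rw [measure_union hd hmU, measure_union hd hmU, mul_add]
    exact add_le_add (h Q (Finset.mem_insert_self _ _)) ih'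

/-- The average of `f` over `Q`. -/
def average {X : Type*} [MeasurableSpace X] (μ : Measure X) (f : X → ℝ≥0∞) (Q : Set X) : ℝ≥0∞ :=
  (∫⁻ x in Q, f x ∂μ) / μ Q

/-- The part of `F` not covered by smaller members of `𝓕`. -/
def stoppingPart {X : Type*} (𝓕 : Finset (Set X)) (F : Set X) : Set X :=
  F \ ⋃ A ∈ {A | A ∈ 𝓕 ∧ A ⊂ F}, A

theorem pairwiseDisjoint_stoppingPart {X : Type*} {𝓕 : Finset (Set X)}
    (hl : IsLaminar (𝓕 : Set (Set X))) :
    (𝓕 : Set (Set X)).PairwiseDisjoint (stoppingPart 𝓕) := by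
  have key : ∀ A ∈ 𝓕, ∀ B, A ⊂ B → Disjoint (stoppingPart 𝓕 A) (stoppingPart 𝓕 B) := by
    intro A hA B hAB
    rw [Set.disjoint_left]
    exact fun x hxA hxB => hxB.2 (Set.mem_biUnion (t := fun A => A)
      (show A ∈ {A | A ∈ 𝓕 ∧ A ⊂ B} from ⟨hA, hAB⟩) hxA.1)
  intro A hA B hB hAB
  rcases hl A hA B hB with h | h | h
  · exact key A hA B (h.ssubset_of_ne hAB)
  · exact (key B hB A (h.ssubset_of_ne hAB.symm)).symm
  · exact h.mono Set.sdiff_subset Set.sdiff_subset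

section average

variable {X : Type*} [MeasurableSpace X] {μ : Measure X} {f : X → ℝ≥0∞} {G 𝓕 : Finset (Set X)}

theorem average_mul {Q : Set X} (h0 : μ Q ≠ 0) (ht : μ Q ≠ ∞) :
    average μ f Q * μ Q = ∫⁻ x in Q, f x ∂μ := ENNReal.div_mul_cancel h0 ht

theorem measurableSet_stoppingPart (hm : ∀ Q ∈ 𝓕, MeasurableSet Q) {F : Set X} (hF : F ∈ 𝓕) :
    MeasurableSet (stoppingPart 𝓕 F) :=
  (hm F hF).diff (MeasurableSet.biUnion ((𝓕.finite_toSet.subset fun _ h => h.1).countable)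
    fun A hA => hm A hA.1)

/-- On each smaller stopping set the average is more than twice that on F. Their union U thus
satisfies 2⟨f⟩_F μ(U) ≤ ∫_F f = ⟨f⟩_F μ(F), and so fills at most half of F. -/
theorem IsStopping.measure_le_stoppingPart (h : IsStopping (average μ f) G 𝓕)
    (hG : IsLaminar (G : Set (Set X))) (hm : ∀ Q ∈ G, MeasurableSet Q)
    (h0 : ∀ Q ∈ G, μ Q ≠ 0) (ht : ∀ Q ∈ G, μ Q ≠ ∞) (hf : ∀ Q ∈ G, ∫⁻ x in Q, f x ∂μ ≠ ∞)
    {F : Set X} (hF : F ∈ 𝓕) : 2⁻¹ * μ F ≤ μ (stoppingPart 𝓕 F) := by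
  classical
  have hFG := h.subset hF
  set U := ⋃ A ∈ {A | A ∈ 𝓕 ∧ A ⊂ F}, A with hU
  have hUm : MeasurableSet U :=
    MeasurableSet.biUnion ((𝓕.finite_toSet.subset fun _ h => h.1).countable)
      fun A hA => hm A (h.subset hA.1)
  have hUF : U ⊆ F := Set.iUnion₂_subset fun A hA => hA.2.subset
  have hint := average_mul (f := f) (h0 F hFG) (ht F hFG)
  have key : 2 * μ U ≤ μ F := by
    have h1 : 2 * average μ f F * μ U ≤ ∫⁻ x in U, f x ∂μ := by
      have := mul_measure_biUnion_le μ (μ.withDensity f) (c := 2 * average μ f F)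
        (𝓕.filter (· ⊂ F)) (fun A hA => hm A (h.subset (Finset.mem_filter.1 hA).1))
        (fun A hA B hB => hG A (h.subset (Finset.mem_filter.1 hA).1) B
          (h.subset (Finset.mem_filter.1 hB).1)) (fun A hA => ?_)
      · have hUe : (⋃ A ∈ 𝓕.filter (· ⊂ F), A) = U := by simp [hU]
        rwa [hUe, withDensity_apply _ hUm] at this
      · rw [Finset.mem_filter] at hA
        have hAG := h.subset hA.1
        rw [withDensity_apply _ (hm A hAG), ← average_mul (h0 A hAG) (ht A hAG)]
        gcongr
        exact (h.two_mul_lt hA.1 hF hA.2).le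
    -- The average cannot be cancelled when it vanishes; but then f = 0 a.e. on F, and F has no
    -- smaller stopping sets.
    by_cases hz : average μ f F = 0
    · have hUe : U = ∅ := by
        simp only [hU, Set.iUnion_eq_empty]
        intro A hA
        have h2 := h.two_mul_lt hA.1 hF hA.2
        rw [hz, zero_mul] at hint
        have h3 : ∫⁻ x in A, f x ∂μ = 0 :=
          le_antisymm ((lintegral_mono_set hA.2.subset).trans hint.ge) zero_le
        simp [average, h3] at h2
      simp [hUe]
    · have htop : average μ f F ≠ ∞ := ENNReal.div_ne_top (hf F hFG) (h0 F hFG)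
      have h2 : average μ f F * (2 * μ U) ≤ average μ f F * μ F := by
        rw [hint]
        calc _ = 2 * average μ f F * μ U := by ring
          _ ≤ _ := h1.trans (lintegral_mono_set hUF)
      exact (ENNReal.mul_le_mul_iff_right hz htop).1 h2
  have hUt : μ U ≠ ∞ := ne_top_of_le_ne_top (ht F hFG) (measure_mono hUF)
  have hd : μ (stoppingPart 𝓕 F) = μ F - μ U := measure_sdiff hUF hUm.nullMeasurableSet hUt
  rw [hd]
  refine ENNReal.le_sub_of_add_le_right hUt ?_
  have h3 : μ U ≤ 2⁻¹ * μ F := by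
    calc μ U = 2⁻¹ * (2 * μ U) := by
          rw [← mul_assoc, ENNReal.inv_mul_cancel two_ne_zero (by simp), one_mul]
      _ ≤ _ := by gcongr
  calc 2⁻¹ * μ F + μ U ≤ 2⁻¹ * μ F + 2⁻¹ * μ F := by gcongr
    _ = μ F := by rw [← add_mul, ENNReal.inv_two_add_inv_two, one_mul]

/-- No maximal theorem is needed. Writing S for the sum on the left, S = ∫ f ∑ ⟨f⟩_F^{p-1} 1_F. The
inner sum is geometric, hence at most a constant times M^{p-1}, with M the maximal function of the
averages over 𝓕. Hölder and ∫ M^p ≤ S give S ≲ ‖f‖_p S^{1/p'}, and the finite S^{1/p'} is absorbed.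
-/
theorem IsStopping.carleson (h : IsStopping (average μ f) G 𝓕)
    (hG : IsLaminar (G : Set (Set X))) (hm : ∀ Q ∈ G, MeasurableSet Q)
    (h0 : ∀ Q ∈ G, μ Q ≠ 0) (ht : ∀ Q ∈ G, μ Q ≠ ∞) (hf : ∀ Q ∈ G, ∫⁻ x in Q, f x ∂μ ≠ ∞)
    (hfm : Measurable f) {p : ℝ} (hp : 1 < p) :
    (∑ F ∈ 𝓕, average μ f F ^ p * μ F) ^ (1 / p) ≤
      geomConst (p - 1) * (∫⁻ x, f x ^ p ∂μ) ^ (1 / p) := by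
  have hpq := Real.HolderConjugate.conjExponent hp
  have hp0 : 0 < p := by linarith
  have hm' : ∀ Q ∈ 𝓕, MeasurableSet Q := fun Q hQ => hm Q (h.subset hQ)
  have hatop : ∀ F ∈ 𝓕, average μ f F ≠ ∞ := fun F hF =>
    ENNReal.div_ne_top (hf F (h.subset hF)) (h0 F (h.subset hF))
  have hMm : Measurable (maxFun 𝓕 (average μ f)) :=
    measurable_maxFun 𝓕.countable_toSet fun Q hQ => hm' Q hQ
  refine rpow_le_of_le_mul_rpow hp0 (p := p.conjExponent)
    (by simpa using hpq.symm.inv_add_inv_eq_one) ?_ ?_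
  · exact ENNReal.sum_ne_top.2 fun F hF =>
      ENNReal.mul_ne_top (ENNReal.rpow_ne_top_of_nonneg hp0.le (hatop F hF)) (ht F (h.subset hF))
  calc ∑ F ∈ 𝓕, average μ f F ^ p * μ F
      = ∑ F ∈ 𝓕, ∫⁻ x, f x * F.indicator (fun _ => average μ f F ^ (p - 1)) x ∂μ := by
        refine Finset.sum_congr rfl fun F hF => ?_
        have e1 : average μ f F ^ p = average μ f F ^ (p - 1) * average μ f F := by
          conv_lhs => rw [show p = (p - 1) + 1 by ring]
          rw [ENNReal.rpow_add_of_nonneg _ _ (by linarith) zero_le_one, ENNReal.rpow_one]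
        rw [e1, mul_assoc, average_mul (h0 F (h.subset hF)) (ht F (h.subset hF)),
          ← lintegral_const_mul _ hfm, ← lintegral_indicator (hm' F hF)]
        refine lintegral_congr fun x => ?_
        by_cases hx : x ∈ F <;> simp [hx, mul_comm]
    _ = ∫⁻ x, f x * ∑ F ∈ 𝓕, F.indicator (fun _ => average μ f F ^ (p - 1)) x ∂μ := by
        simp_rw [Finset.mul_sum]
        rw [lintegral_finsetSum]
        exact fun F hF => Measurable.mul hfm (measurable_const.indicator (hm' F hF))
    _ ≤ ∫⁻ x, geomConst (p - 1) * (f x * maxFun 𝓕 (average μ f) x ^ (p - 1)) ∂μ := by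
        refine lintegral_mono fun x => ?_
        calc _ ≤ f x * (geomConst (p - 1) * maxFun 𝓕 (average μ f) x ^ (p - 1)) := by
              gcongr
              exact h.sum_rpow_le hG (by linarith) x
          _ = _ := by ring
    _ = geomConst (p - 1) * ∫⁻ x, f x * maxFun 𝓕 (average μ f) x ^ (p - 1) ∂μ :=
        lintegral_const_mul _ (hfm.mul (hMm.pow_const _))
    _ ≤ geomConst (p - 1) * ((∫⁻ x, f x ^ p ∂μ) ^ (1 / p) *
          (∫⁻ x, (maxFun 𝓕 (average μ f) x ^ (p - 1)) ^ p.conjExponent ∂μ) ^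
            (1 / p.conjExponent)) := by
        gcongr
        exact ENNReal.lintegral_mul_le_Lp_mul_Lq μ hpq hfm.aemeasurable
          (hMm.pow_const _).aemeasurable
    _ ≤ geomConst (p - 1) * ((∫⁻ x, f x ^ p ∂μ) ^ (1 / p) *
          (∑ F ∈ 𝓕, average μ f F ^ p * μ F) ^ (1 / p.conjExponent)) := by
        have hq0 := hpq.symm.pos
        gcongr
        calc ∫⁻ x, (maxFun 𝓕 (average μ f) x ^ (p - 1)) ^ p.conjExponent ∂μ
            ≤ ∫⁻ x, ∑ F ∈ 𝓕, F.indicator (fun _ => average μ f F ^ p) x ∂μ := by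
              refine lintegral_mono fun x => ?_
              rw [← ENNReal.rpow_mul, hpq.sub_one_mul_conj]
              exact maxFun_rpow_le_sum hp0 x
          _ = _ := by
              rw [lintegral_finsetSum _ fun F hF => measurable_const.indicator (hm' F hF)]
              refine Finset.sum_congr rfl fun F hF => ?_
              rw [lintegral_indicator (hm' F hF), setLIntegral_const]
    _ = _ := by ring

end average

/-! ### The trilinear dyadic form -/

theorem sum_sum_filter_eq_le {ι κ : Type*} [DecidableEq κ] (S : Finset ι) (T : Finset κ)
    (g : ι → κ) (f : ι → ℝ≥0∞) :
    ∑ y ∈ T, ∑ x ∈ S with g x = y, f x ≤ ∑ x ∈ S, f x := by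
  classical
  calc ∑ y ∈ T, ∑ x ∈ S with g x = y, f x
      = ∑ y ∈ T, ∑ x ∈ S.filter (fun x => g x ∈ T) with g x = y, f x := by
        refine Finset.sum_congr rfl fun y hy => ?_
        rw [Finset.filter_filter]
        refine Finset.sum_congr (Finset.filter_congr fun x _ => ?_) fun _ _ => rfl
        constructor
        · rintro rfl; exact ⟨hy, rfl⟩
        · exact fun h => h.2
    _ = ∑ x ∈ S.filter (fun x => g x ∈ T), f x :=
        Finset.sum_fiberwise_of_maps_to (fun x hx => (Finset.mem_filter.1 hx).2) _
    _ ≤ _ := Finset.sum_le_sum_of_subset (Finset.filter_subset _ _)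

/-- The `L^q` norm of the localized dyadic operator applied to the two measures `μj`, `μk`. -/
def dyadicNorm {X : Type*} [MeasurableSpace X] (lam : Set X → ℝ≥0∞) (μi μj μk : Measure X) (q : ℝ)
    (G : Finset (Set X)) (F : Set X) : ℝ≥0∞ := by
  classical exact (∫⁻ x, (∑ Q ∈ G with Q ⊆ F,
    Q.indicator (fun _ => lam Q * (μj Q * μk Q)) x) ^ q ∂μi) ^ (1 / q)

section ordered

variable {X : Type*} [MeasurableSpace X] {μi μj μk : Measure X} {lam ai : Set X → ℝ≥0∞}
  {G H : Finset (Set X)} {pi : ℝ}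

/-- At every x ∈ Q the coefficient `ai (πi Q)` is at most the maximal function of `ai` over 𝓕i. This
pulls it out of the sum over Q, and Hölder in `μi` separates the dyadic operator localized to F from
the coefficients. -/
theorem sum_le_dyadicNorm_mul (hpi : 1 < pi) (hm : ∀ Q ∈ G, MeasurableSet Q) (hH : H ⊆ G)
    {𝓕i : Finset (Set X)} (h𝓕i : 𝓕i ⊆ G) (πi : Set X → Set X) {F : Set X}
    (hπi : ∀ Q ∈ H, πi Q ∈ 𝓕i ∧ Q ⊆ πi Q) (hF : ∀ Q ∈ H, Q ⊆ F) :
    ∑ Q ∈ H, lam Q * (μi Q * (μj Q * μk Q)) * ai (πi Q) ≤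
      dyadicNorm lam μi μj μk pi.conjExponent G F *
        (∑ A ∈ 𝓕i, ai A ^ pi * μi A) ^ (1 / pi) := by
  classical
  have hpq := Real.HolderConjugate.conjExponent hpi
  have hm' : ∀ A ∈ 𝓕i, MeasurableSet A := fun A hA => hm A (h𝓕i hA)
  have hΘm : Measurable fun x => ∑ Q ∈ G with Q ⊆ F,
      Q.indicator (fun _ => lam Q * (μj Q * μk Q)) x :=
    Finset.measurable_sum _ fun Q hQ =>
      measurable_const.indicator (hm Q (Finset.mem_filter.1 hQ).1)
  have hMm : Measurable (maxFun 𝓕i ai) := measurable_maxFun 𝓕i.countable_toSet hm'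
  calc ∑ Q ∈ H, lam Q * (μi Q * (μj Q * μk Q)) * ai (πi Q)
      = ∫⁻ x, ∑ Q ∈ H, Q.indicator (fun _ => lam Q * (μj Q * μk Q) * ai (πi Q)) x ∂μi := by
        rw [lintegral_finsetSum _ fun Q hQ => measurable_const.indicator (hm Q (hH hQ))]
        refine Finset.sum_congr rfl fun Q hQ => ?_
        rw [lintegral_indicator (hm Q (hH hQ)), setLIntegral_const]
        ring
    _ ≤ ∫⁻ x, (∑ Q ∈ G with Q ⊆ F, Q.indicator (fun _ => lam Q * (μj Q * μk Q)) x) *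
          maxFun 𝓕i ai x ∂μi := by
        refine lintegral_mono fun x => ?_
        rw [Finset.sum_mul]
        refine (Finset.sum_le_sum fun Q hQ => ?_).trans
          (Finset.sum_le_sum_of_subset fun Q hQ => Finset.mem_filter.2 ⟨hH hQ, hF Q hQ⟩)
        by_cases hx : x ∈ Q
        · simp only [Set.indicator_of_mem hx]
          gcongr
          exact le_maxFun (by exact_mod_cast (hπi Q hQ).1) ((hπi Q hQ).2 hx)
        · simp [Set.indicator_of_notMem hx]
    _ ≤ _ := ENNReal.lintegral_mul_le_Lp_mul_Lq μi hpq.symm hΘm.aemeasurable hMm.aemeasurable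
    _ ≤ _ := by
        have h0 : 0 < pi := by linarith
        refine mul_le_mul' (le_of_eq rfl) (ENNReal.rpow_le_rpow ?_ (by positivity))
        calc ∫⁻ x, maxFun 𝓕i ai x ^ pi ∂μi
            ≤ ∫⁻ x, ∑ A ∈ 𝓕i, A.indicator (fun _ => ai A ^ pi) x ∂μi :=
              lintegral_mono fun x => maxFun_rpow_le_sum h0 x
          _ = _ := by
              rw [lintegral_finsetSum _ fun A hA => measurable_const.indicator (hm' A hA)]
              refine Finset.sum_congr rfl fun A hA => ?_
              rw [lintegral_indicator (hm' A hA), setLIntegral_const]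

/-- The part of the trilinear form in which the three stopping parents are nested. -/
theorem sum_ordered_le {aj ak : Set X → ℝ≥0∞} {pj pk : ℝ} {r s : ℝ≥0∞}
    (hpi : 1 < pi) (hpj : 1 < pj) (hpk : 1 < pk) (hr : r ≠ 0) (hs : s ≠ 0)
    (hs1 : 1 ≤ s⁻¹.toReal + (1 / pj + 1 / pi))
    (hr1 : 1 ≤ r⁻¹.toReal + (1 / pk + 1 / pj + 1 / pi))
    (hm : ∀ Q ∈ G, MeasurableSet Q)
    (hj0 : ∀ Q ∈ G, μj Q ≠ 0) (hjt : ∀ Q ∈ G, μj Q ≠ ∞)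
    (hk0 : ∀ Q ∈ G, μk Q ≠ 0) (hkt : ∀ Q ∈ G, μk Q ≠ ∞)
    (hH : H ⊆ G) {𝓕i 𝓕j 𝓕k : Finset (Set X)} (h𝓕i : 𝓕i ⊆ G) (h𝓕j : 𝓕j ⊆ G) (h𝓕k : 𝓕k ⊆ G)
    (πi πj πk : Set X → Set X)
    (hπi : ∀ Q ∈ H, πi Q ∈ 𝓕i ∧ Q ⊆ πi Q) (hπj : ∀ Q ∈ H, πj Q ∈ 𝓕j ∧ Q ⊆ πj Q)
    (hπk : ∀ Q ∈ H, πk Q ∈ 𝓕k ∧ πj Q ⊆ πk Q)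
    (hij : ∀ Q ∈ H, πj (πi Q) = πj Q) (hjk : ∀ Q ∈ H, πk (πj Q) = πk Q)
    {Θ : Set X → ℝ≥0∞}
    (hΘ : ∀ F ∈ 𝓕j, dyadicNorm lam μi μj μk pi.conjExponent G F ≤ Θ F) :
    ∑ Q ∈ H, lam Q * (μi Q * (μj Q * μk Q)) * (ai (πi Q) * (aj (πj Q) * ak (πk Q))) ≤
      seqNorm r (fun Fk : {F // F ∈ (𝓕k : Set (Set X))} =>
        seqNorm s (fun Fj : {F // F ∈ (𝓕j : Set (Set X)) ∧ F ⊆ Fk.1} =>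
          Θ Fj / (μj Fj ^ (1 / pj) * μk Fk ^ (1 / pk)))) *
      ((∑ F ∈ 𝓕i, ai F ^ pi * μi F) ^ (1 / pi) *
        ((∑ F ∈ 𝓕j, aj F ^ pj * μj F) ^ (1 / pj) *
          (∑ F ∈ 𝓕k, ak F ^ pk * μk F) ^ (1 / pk))) := by
  classical
  set z : Set X → ℝ≥0∞ := fun Fj => ∑ A ∈ 𝓕i with πj A = Fj, ai A ^ pi * μi A with hz
  set J := H.image πj with hJ
  have hJj : J ⊆ 𝓕j := Finset.image_subset_iff.2 fun Q hQ => (hπj Q hQ).1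
  have hJk : ∀ F ∈ J, πk F ∈ 𝓕k ∧ F ⊆ πk F := by
    intro F hF
    obtain ⟨Q, hQ, rfl⟩ := Finset.mem_image.1 hF
    rw [hjk Q hQ]
    exact hπk Q hQ
  have hi0 : 0 < pi := by linarith
  have hj0' : 0 < pj := by linarith
  have hk0' : 0 < pk := by linarith
  set A : Set X → Set X → ℝ≥0∞ := fun Fk Fj => Θ Fj / (μj Fj ^ (1 / pj) * μk Fk ^ (1 / pk))
    with hA
  set N : Set X → ℝ≥0∞ := fun Fk =>
    seqNorm s (fun Fj : {F // F ∈ (𝓕j : Set (Set X)) ∧ F ⊆ Fk} => A Fk Fj) with hN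
  have step1 : ∑ Q ∈ H, lam Q * (μi Q * (μj Q * μk Q)) * (ai (πi Q) * (aj (πj Q) * ak (πk Q))) ≤
      ∑ Fj ∈ J, aj Fj * ak (πk Fj) * (Θ Fj * z Fj ^ (1 / pi)) := by
    rw [← Finset.sum_fiberwise_of_maps_to (fun Q hQ => Finset.mem_image_of_mem πj hQ)]
    refine Finset.sum_le_sum fun Fj hFj => ?_
    calc ∑ Q ∈ H with πj Q = Fj,
          lam Q * (μi Q * (μj Q * μk Q)) * (ai (πi Q) * (aj (πj Q) * ak (πk Q)))
        = aj Fj * ak (πk Fj) * ∑ Q ∈ H with πj Q = Fj,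
            lam Q * (μi Q * (μj Q * μk Q)) * ai (πi Q) := by
          rw [Finset.mul_sum]
          refine Finset.sum_congr rfl fun Q hQ => ?_
          rw [Finset.mem_filter] at hQ
          rw [← hjk Q hQ.1, hQ.2]
          ring
      _ ≤ _ := by
          gcongr
          refine (sum_le_dyadicNorm_mul (F := Fj) hpi hm ((Finset.filter_subset _ _).trans hH)
            (𝓕i := 𝓕i.filter (fun A => πj A = Fj)) ((Finset.filter_subset _ _).trans h𝓕i) πi
            (fun Q hQ => ?_) (fun Q hQ => ?_)).trans ?_
          · rw [Finset.mem_filter] at hQ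
            exact ⟨Finset.mem_filter.2 ⟨(hπi Q hQ.1).1, (hij Q hQ.1).trans hQ.2⟩, (hπi Q hQ.1).2⟩
          · rw [Finset.mem_filter] at hQ
            rw [← hQ.2]
            exact (hπj Q hQ.1).2
          · gcongr
            exact hΘ Fj (hJj hFj)
  -- For fixed F_k, Hölder over F_j with the testing ratios in ℓ^s, the j-coefficients in ℓ^{pj} and
  -- the i-masses in ℓ^{pi}.
  have step2 : ∀ Fk ∈ 𝓕k, ∑ Fj ∈ J with πk Fj = Fk, aj Fj * ak (πk Fj) * (Θ Fj * z Fj ^ (1 / pi))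
      ≤ (ak Fk ^ pk * μk Fk) ^ (1 / pk) * (N Fk *
        ((∑ Fj ∈ J with πk Fj = Fk, aj Fj ^ pj * μj Fj) ^ (1 / pj) *
          (∑ Fj ∈ J with πk Fj = Fk, z Fj) ^ (1 / pi))) := by
    intro Fk hFk
    have h1 := sum_mul_prod_rpow_le_seqNorm (P := fun F => F ∈ (𝓕j : Set (Set X)) ∧ F ⊆ Fk)
      (S := J.filter fun F => πk F = Fk) (fun F hF => by
        rw [Finset.mem_filter] at hF
        exact ⟨by exact_mod_cast hJj hF.1, hF.2 ▸ (hJk F hF.1).2⟩)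
      (Finset.univ : Finset (Fin 2)) hs (A Fk)
      ![fun F => aj F ^ pj * μj F, z] (w := ![1 / pj, 1 / pi])
      (by intro l _; fin_cases l <;> simp [hi0.le, hj0'.le]) (by simpa using hs1)
    simp only [Fin.prod_univ_two, Matrix.cons_val_zero, Matrix.cons_val_one] at h1
    refine le_trans (le_of_eq ?_) (mul_le_mul' le_rfl h1)
    rw [Finset.mul_sum]
    refine Finset.sum_congr rfl fun Fj hFj => ?_
    rw [Finset.mem_filter] at hFj
    have hFjG := h𝓕j (hJj hFj.1)
    rw [hFj.2, ENNReal.mul_rpow_of_nonneg _ _ (by positivity),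
      ENNReal.mul_rpow_of_nonneg _ _ (by positivity : 0 ≤ 1 / pj), ← ENNReal.rpow_mul,
      ← ENNReal.rpow_mul, mul_one_div_cancel hk0'.ne', mul_one_div_cancel hj0'.ne',
      ENNReal.rpow_one, ENNReal.rpow_one]
    have e1 : Θ Fj = A Fk Fj * (μj Fj ^ (1 / pj) * μk Fk ^ (1 / pk)) := by
      refine (ENNReal.div_mul_cancel ?_ ?_).symm
      · exact mul_ne_zero
          (ENNReal.rpow_pos (pos_iff_ne_zero.2 (hj0 Fj hFjG)) (hjt Fj hFjG)).ne'
          (ENNReal.rpow_pos (pos_iff_ne_zero.2 (hk0 Fk (h𝓕k hFk))) (hkt Fk (h𝓕k hFk))).ne'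
      · exact ENNReal.mul_ne_top (ENNReal.rpow_ne_top_of_nonneg (by positivity) (hjt Fj hFjG))
          (ENNReal.rpow_ne_top_of_nonneg (by positivity) (hkt Fk (h𝓕k hFk)))
    rw [e1]
    ring
  -- Hölder over F_k, now with all three coefficient sequences and the inner norms `N` in ℓ^r.
  have step3 := sum_mul_prod_rpow_le_seqNorm (P := fun F => F ∈ (𝓕k : Set (Set X)))
      (S := 𝓕k) (fun F hF => by exact_mod_cast hF)
      (Finset.univ : Finset (Fin 3)) hr N
      ![fun F => ak F ^ pk * μk F, fun Fk => ∑ Fj ∈ J with πk Fj = Fk, aj Fj ^ pj * μj Fj,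
        fun Fk => ∑ Fj ∈ J with πk Fj = Fk, z Fj] (w := ![1 / pk, 1 / pj, 1 / pi])
      (by intro l _; fin_cases l <;> simp [hi0.le, hj0'.le, hk0'.le])
      (by simpa [Fin.sum_univ_three] using hr1)
  simp only [Fin.prod_univ_three, Matrix.cons_val_zero, Matrix.cons_val_one,
    Matrix.cons_val] at step3
  calc _ ≤ ∑ Fj ∈ J, aj Fj * ak (πk Fj) * (Θ Fj * z Fj ^ (1 / pi)) := step1
    _ = ∑ Fk ∈ 𝓕k, ∑ Fj ∈ J with πk Fj = Fk,
          aj Fj * ak (πk Fj) * (Θ Fj * z Fj ^ (1 / pi)) :=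
        (Finset.sum_fiberwise_of_maps_to (fun F hF => (hJk F hF).1) _).symm
    _ ≤ _ := Finset.sum_le_sum step2
    _ = _ := Finset.sum_congr rfl fun Fk _ => by ring
    _ ≤ _ := step3
    _ = seqNorm r (fun Fk : {F // F ∈ (𝓕k : Set (Set X))} => N Fk) *
        ((∑ Fk ∈ 𝓕k, ∑ Fj ∈ J with πk Fj = Fk, z Fj) ^ (1 / pi) *
        ((∑ Fk ∈ 𝓕k, ∑ Fj ∈ J with πk Fj = Fk, aj Fj ^ pj * μj Fj) ^ (1 / pj) *
          (∑ F ∈ 𝓕k, ak F ^ pk * μk F) ^ (1 / pk))) := by ring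
    _ ≤ _ := by
        refine mul_le_mul' le_rfl (mul_le_mul' (ENNReal.rpow_le_rpow ?_ (by positivity))
          (mul_le_mul' (ENNReal.rpow_le_rpow ?_ (by positivity)) le_rfl))
        · exact (sum_sum_filter_eq_le J 𝓕k πk z).trans (sum_sum_filter_eq_le 𝓕i J πj _)
        · exact (sum_sum_filter_eq_le J 𝓕k πk _).trans (Finset.sum_le_sum_of_subset hJj)

end ordered

/-- A tournament on three vertices has a Hamiltonian path; transitivity is not needed. -/
theorem exists_perm_chain {r : Fin 3 → Fin 3 → Prop} (ht : ∀ i j, r i j ∨ r j i) :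
    ∃ e : Equiv.Perm (Fin 3), r (e 0) (e 1) ∧ r (e 1) (e 2) := by
  have mk : ∀ e : Equiv.Perm (Fin 3), r (e 0) (e 1) → r (e 1) (e 2) →
    ∃ e : Equiv.Perm (Fin 3), r (e 0) (e 1) ∧ r (e 1) (e 2) := fun e h1 h2 => ⟨e, h1, h2⟩
  rcases ht 0 1 with h01 | h10
  · rcases ht 1 2 with h12 | h21
    · exact mk 1 h01 h12
    · rcases ht 0 2 with h02 | h20
      · exact mk (Equiv.swap 1 2) h02 h21
      · exact mk (Equiv.swap 0 1 * Equiv.swap 0 2) h20 h01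
  · rcases ht 0 2 with h02 | h20
    · exact mk (Equiv.swap 0 1) h10 h02
    · rcases ht 1 2 with h12 | h21
      · exact mk (Equiv.swap 0 1 * Equiv.swap 1 2) h12 h20
      · exact mk (Equiv.swap 0 2) h21 h10

theorem rk_ne_zero (p : Fin 3 → ℝ) (e : Equiv.Perm (Fin 3)) : rk p e ≠ 0 := by
  simp [rk]

theorem rTot_ne_zero (p : Fin 3 → ℝ) : rTot p ≠ 0 := by
  simp [rTot]

theorem sum_inv_perm (p : Fin 3 → ℝ) (e : Equiv.Perm (Fin 3)) :
    1 / p (e 0) + 1 / p (e 1) + 1 / p (e 2) = 1 / p 0 + 1 / p 1 + 1 / p 2 := by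
  have := Equiv.sum_comp e (fun i => 1 / p i)
  simpa [Fin.sum_univ_three] using this

theorem prod_perm (g : Fin 3 → ℝ≥0∞) (e : Equiv.Perm (Fin 3)) :
    ∏ l, g l = g (e 0) * (g (e 1) * g (e 2)) := by
  rw [← Equiv.prod_comp e, Fin.prod_univ_three, mul_assoc]

/-- The trilinear dyadic form is controlled by the sequential testing constants. -/
theorem trilinear_le {n : ℕ} {p : Fin 3 → ℝ} (hp : ∀ i, 1 < p i) {σ : Fin 3 → Measure (Rn n)}
    {𝓓 : Set (Set (Rn n))} {G : Finset (Set (Rn n))} (hG𝓓 : (G : Set (Set (Rn n))) ⊆ 𝓓)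
    (hl : IsLaminar (G : Set (Set (Rn n)))) (hne : ∀ Q ∈ G, Q.Nonempty)
    (hm : ∀ Q ∈ G, MeasurableSet Q) (h0 : ∀ i, ∀ Q ∈ G, σ i Q ≠ 0) (ht : ∀ i, ∀ Q ∈ G, σ i Q ≠ ∞)
    (lam : Set (Rn n) → ℝ≥0∞) {f : Fin 3 → Rn n → ℝ≥0∞} (hfm : ∀ i, Measurable (f i))
    (hf : ∀ i, ∀ Q ∈ G, ∫⁻ x in Q, f i x ∂σ i ≠ ∞)
    {Θ : Equiv.Perm (Fin 3) → Set (Rn n) → ℝ≥0∞} {τ : Equiv.Perm (Fin 3) → ℝ≥0∞}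
    (hΘ : ∀ e, ∀ F ∈ G, dyadicNorm lam (σ (e 0)) (σ (e 1)) (σ (e 2))
      (p (e 0)).conjExponent G F ≤ Θ e F)
    (hτ : ∀ e, ∀ 𝓕j 𝓕k : Set (Set (Rn n)), IsSparse (σ (e 1)) 𝓓 𝓕j → IsSparse (σ (e 2)) 𝓓 𝓕k →
      seqNorm (rTot p) (fun Fk : {F // F ∈ 𝓕k} =>
        seqNorm (rk p e) fun Fj : {F // F ∈ 𝓕j ∧ F ⊆ Fk.1} =>
          Θ e Fj / (σ (e 1) Fj ^ (1 / p (e 1)) * σ (e 2) Fk ^ (1 / p (e 2)))) ≤ τ e) :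
    ∑ Q ∈ G, lam Q * ∏ i, ∫⁻ x in Q, f i x ∂σ i ≤
      8 * (∑ e, τ e) * ∏ i, (geomConst (p i - 1) * (∫⁻ x, f i x ^ p i ∂σ i) ^ (1 / p i)) := by
  classical
  choose 𝓕 h𝓕 using fun i => exists_isStopping (average (σ i) (f i)) G
  have hpar : ∀ i, ∀ Q : Set (Rn n), ∃ P, Q ∈ G → P ∈ 𝓕 i ∧ Q ⊆ P ∧
      average (σ i) (f i) Q ≤ 2 * average (σ i) (f i) P ∧ ∀ A ∈ 𝓕 i, Q ⊆ A → P ⊆ A := by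
    intro i Q
    by_cases hQ : Q ∈ G
    · obtain ⟨P, h⟩ := (h𝓕 i).exists_parent hl hQ (hne Q hQ)
      exact ⟨P, fun _ => h⟩
    · exact ⟨∅, fun h => absurd h hQ⟩
  choose π hπ using hpar
  -- Parents are smallest stopping supersets, so passing through an intermediate set between Q and
  -- its j-parent does not change that parent.
  have hππ : ∀ i j, ∀ Q ∈ G, π i Q ⊆ π j Q → π j (π i Q) = π j Q := by
    intro i j Q hQ hij
    have hPG := (h𝓕 i).subset (hπ i Q hQ).1
    apply Set.Subset.antisymm
    · exact (hπ j _ hPG).2.2.2 _ (hπ j Q hQ).1 hij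
    · exact (hπ j Q hQ).2.2.2 _ (hπ j _ hPG).1 ((hπ i Q hQ).2.1.trans (hπ j _ hPG).2.1)
  have hsparse : ∀ i, IsSparse (σ i) 𝓓 (𝓕 i : Set (Set (Rn n))) := by
    intro i
    refine ⟨fun F hF => hG𝓓 ((h𝓕 i).subset hF), stoppingPart (𝓕 i), fun F hF => ⟨?_, ?_, ?_⟩, ?_⟩
    · exact measurableSet_stoppingPart (fun Q hQ => hm Q ((h𝓕 i).subset hQ)) hF
    · exact Set.sdiff_subset
    · exact (h𝓕 i).measure_le_stoppingPart hl hm (h0 i) (ht i) (hf i) hF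
    · exact pairwiseDisjoint_stoppingPart
        fun A hA B hB => hl A ((h𝓕 i).subset hA) B ((h𝓕 i).subset hB)
  -- The cubes whose parents are nested in the order `e`. These classes cover G but may overlap,
  -- which costs nothing since all terms are nonnegative.
  let H : Equiv.Perm (Fin 3) → Finset (Set (Rn n)) := fun e =>
    G.filter fun Q => π (e 0) Q ⊆ π (e 1) Q ∧ π (e 1) Q ⊆ π (e 2) Q
  have hcover : ∀ Q ∈ G, ∃ e, Q ∈ H e := by
    intro Q hQ
    obtain ⟨e, he⟩ := exists_perm_chain (r := fun i j => π i Q ⊆ π j Q) (fun i j => by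
      rcases hl _ ((h𝓕 i).subset (hπ i Q hQ).1) _ ((h𝓕 j).subset (hπ j Q hQ).1) with h | h | h
      · exact Or.inl h
      · exact Or.inr h
      · obtain ⟨x, hx⟩ := hne Q hQ
        exact absurd ((hπ j Q hQ).2.1 hx) (Set.disjoint_left.1 h ((hπ i Q hQ).2.1 hx)))
    exact ⟨e, Finset.mem_filter.2 ⟨hQ, he⟩⟩
  have hterm : ∀ e, ∑ Q ∈ H e, lam Q * ∏ i, ∫⁻ x in Q, f i x ∂σ i ≤
      8 * τ e * ∏ i, (geomConst (p i - 1) * (∫⁻ x, f i x ^ p i ∂σ i) ^ (1 / p i)) := by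
    intro e
    have hs1 : 1 ≤ (rk p e)⁻¹.toReal + (1 / p (e 1) + 1 / p (e 0)) := by
      have := le_max_left (1 - 1 / p (e 0) - 1 / p (e 1)) 0
      simp only [rk, inv_inv, ENNReal.toReal_ofReal']
      linarith
    have hr1 : 1 ≤ (rTot p)⁻¹.toReal + (1 / p (e 2) + 1 / p (e 1) + 1 / p (e 0)) := by
      have := le_max_left (1 - 1 / p 0 - 1 / p 1 - 1 / p 2) 0
      have h2 := sum_inv_perm p e
      simp only [rTot, inv_inv, ENNReal.toReal_ofReal']
      linarith
    have key := sum_ordered_le (μi := σ (e 0)) (μj := σ (e 1)) (μk := σ (e 2)) (lam := lam)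
      (ai := average (σ (e 0)) (f (e 0))) (aj := average (σ (e 1)) (f (e 1)))
      (ak := average (σ (e 2)) (f (e 2)))
      (hp (e 0)) (hp (e 1)) (hp (e 2)) (rTot_ne_zero p) (rk_ne_zero p e) hs1 hr1 hm
      (h0 _) (ht _) (h0 _) (ht _) (H := H e) (Finset.filter_subset _ _)
      (h𝓕 (e 0)).subset (h𝓕 (e 1)).subset (h𝓕 (e 2)).subset (π (e 0)) (π (e 1)) (π (e 2))
      (fun Q hQ => ⟨(hπ _ Q (Finset.mem_filter.1 hQ).1).1, (hπ _ Q (Finset.mem_filter.1 hQ).1).2.1⟩)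
      (fun Q hQ => ⟨(hπ _ Q (Finset.mem_filter.1 hQ).1).1, (hπ _ Q (Finset.mem_filter.1 hQ).1).2.1⟩)
      (fun Q hQ => ⟨(hπ _ Q (Finset.mem_filter.1 hQ).1).1, (Finset.mem_filter.1 hQ).2.2⟩)
      (fun Q hQ => hππ _ _ Q (Finset.mem_filter.1 hQ).1 (Finset.mem_filter.1 hQ).2.1)
      (fun Q hQ => hππ _ _ Q (Finset.mem_filter.1 hQ).1 (Finset.mem_filter.1 hQ).2.2)
      (fun F hF => hΘ e F ((h𝓕 (e 1)).subset hF))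
    -- One factor 2 from the stopping rule for each of the three functions accounts for the constant
    -- 8.
    have hint : ∀ i, ∀ Q ∈ G, ∫⁻ x in Q, f i x ∂σ i ≤
        2 * average (σ i) (f i) (π i Q) * σ i Q := fun i Q hQ => by
      rw [← average_mul (h0 i Q hQ) (ht i Q hQ)]
      exact mul_le_mul' (hπ i Q hQ).2.2.1 le_rfl
    have hC := fun i => (h𝓕 i).carleson hl hm (h0 i) (ht i) (hf i) (hfm i) (hp i)
    calc ∑ Q ∈ H e, lam Q * ∏ i, ∫⁻ x in Q, f i x ∂σ i
        ≤ ∑ Q ∈ H e, 8 * (lam Q * (σ (e 0) Q * (σ (e 1) Q * σ (e 2) Q)) *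
          (average (σ (e 0)) (f (e 0)) (π (e 0) Q) * (average (σ (e 1)) (f (e 1)) (π (e 1) Q) *
            average (σ (e 2)) (f (e 2)) (π (e 2) Q)))) := by
          refine Finset.sum_le_sum fun Q hQ => ?_
          have hQG := (Finset.mem_filter.1 hQ).1
          rw [prod_perm _ e]
          refine (mul_le_mul' le_rfl (mul_le_mul' (hint (e 0) Q hQG)
            (mul_le_mul' (hint (e 1) Q hQG) (hint (e 2) Q hQG)))).trans (le_of_eq ?_)
          ring
      _ ≤ 8 * (τ e * ∏ i, (geomConst (p i - 1) * (∫⁻ x, f i x ^ p i ∂σ i) ^ (1 / p i))) := by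
          rw [← Finset.mul_sum, prod_perm _ e]
          gcongr
          refine key.trans (mul_le_mul' (hτ e _ _ (hsparse _) (hsparse _)) ?_)
          exact mul_le_mul' (hC _) (mul_le_mul' (hC _) (hC _))
      _ = _ := by ring
  calc ∑ Q ∈ G, lam Q * ∏ i, ∫⁻ x in Q, f i x ∂σ i
      ≤ ∑ e, ∑ Q ∈ H e, lam Q * ∏ i, ∫⁻ x in Q, f i x ∂σ i := by
        rw [Finset.sum_comm' (t' := G) (s' := fun Q => Finset.univ.filter fun e => Q ∈ H e)]
        · refine Finset.sum_le_sum fun Q hQ => ?_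
          obtain ⟨e, he⟩ := hcover Q hQ
          exact Finset.single_le_sum (f := fun _ : Equiv.Perm (Fin 3) =>
            lam Q * ∏ i, ∫⁻ x in Q, f i x ∂σ i) (fun _ _ => zero_le)
            (Finset.mem_filter.2 ⟨Finset.mem_univ e, he⟩)
        · intro e Q
          simp only [Finset.mem_univ, true_and, Finset.mem_filter]
          exact ⟨fun h => ⟨h, (Finset.mem_filter.1 h).1⟩, fun h => h.1⟩
    _ ≤ ∑ e, 8 * τ e * ∏ i, (geomConst (p i - 1) * (∫⁻ x, f i x ^ p i ∂σ i) ^ (1 / p i)) :=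
        Finset.sum_le_sum fun e _ => hterm e
    _ = _ := by rw [← Finset.sum_mul, ← Finset.mul_sum]

/-! ### Geometry of the shifted dyadic grids -/

section grid

variable {n : ℕ}

theorem mem_cube_iff {t : Fin n → ℝ} {k : ℤ} {m : Fin n → ℤ} {x : Rn n} :
    x ∈ cube t k m ↔ ∀ l, ⌊(2 : ℝ) ^ k * x l - (-1) ^ k * t l⌋ = m l := by
  have h2 : (0 : ℝ) < 2 ^ k := by positivity
  refine forall_congr' fun l => ?_
  rw [Int.floor_eq_iff, zpow_neg, inv_mul_le_iff₀ h2, lt_inv_mul_iff₀ h2]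
  constructor
  · rintro ⟨h, h'⟩; constructor <;> linarith
  · rintro ⟨h, h'⟩; constructor <;> linarith

theorem cube_eq_of_mem {t : Fin n → ℝ} {k : ℤ} {m : Fin n → ℤ} {x : Rn n} (h : x ∈ cube t k m) :
    cube t k m = cube t k fun l => ⌊(2 : ℝ) ^ k * x l - (-1) ^ k * t l⌋ := by
  congr 1
  exact funext fun l => (mem_cube_iff.1 h l).symm

theorem measurableSet_cube (t : Fin n → ℝ) (k : ℤ) (m : Fin n → ℤ) :
    MeasurableSet (cube t k m) := by
  have : cube t k m = ⋂ l, {x : Rn n | (2 : ℝ) ^ (-k) * (m l + (-1 : ℝ) ^ k * t l) ≤ x l ∧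
    x l < (2 : ℝ) ^ (-k) * (1 + m l + (-1 : ℝ) ^ k * t l)} := by
    ext x; simp [cube]
  rw [this]
  refine MeasurableSet.iInter fun l => ?_
  have hc : Measurable fun x : Rn n => x l := (EuclideanSpace.proj l).continuous.measurable
  exact (measurableSet_le measurable_const hc).inter (measurableSet_lt hc measurable_const)

theorem countable_grid (t : Fin n → ℝ) : (grid t).Countable := by
  have : grid t = Set.range fun km : ℤ × (Fin n → ℤ) => cube t km.1 km.2 := by
    ext Q; simp [grid, eq_comm]
  rw [this]
  exact Set.countable_range _

theorem measurableSet_of_mem_grid {t : Fin n → ℝ} {Q : Set (Rn n)} (hQ : Q ∈ grid t) :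
    MeasurableSet Q := by
  obtain ⟨k, m, rfl⟩ := hQ
  exact measurableSet_cube t k m

/-- Consecutive generations nest because (-1)^{k+1} τ = 2 (-1)^k τ - 3 (-1)^k τ and 3τ is an
integer. Up to an integer translation, the index at level k+1 is ⌊2u⌋ when that at level k is ⌊u⌋,
and ⌊u⌋ = ⌊2u⌋ / 2. -/
theorem floor_eq_of_floor_succ_eq {τ : ℝ} (hτ : τ = 0 ∨ τ = 1 / 3) {k : ℤ} {x y : ℝ}
    (h : ⌊(2 : ℝ) ^ (k + 1) * x - (-1) ^ (k + 1) * τ⌋ =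
      ⌊(2 : ℝ) ^ (k + 1) * y - (-1) ^ (k + 1) * τ⌋) :
    ⌊(2 : ℝ) ^ k * x - (-1) ^ k * τ⌋ = ⌊(2 : ℝ) ^ k * y - (-1) ^ k * τ⌋ := by
  obtain ⟨c, hc⟩ : ∃ c : ℤ, 3 * ((-1 : ℝ) ^ k * τ) = c := by
    rcases hτ with rfl | rfl
    · exact ⟨0, by simp⟩
    · rcases Int.even_or_odd k with hk | hk
      · exact ⟨1, by simp [hk.neg_one_zpow]⟩
      · exact ⟨-1, by simp [hk.neg_one_zpow]⟩
  have key : ∀ z : ℝ, ⌊(2 : ℝ) ^ (k + 1) * z - (-1) ^ (k + 1) * τ⌋ =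
      ⌊2 * ((2 : ℝ) ^ k * z - (-1) ^ k * τ)⌋ + c := fun z => by
    rw [← Int.floor_add_intCast, ← hc, zpow_add_one₀ two_ne_zero, zpow_add_one₀ (by norm_num)]
    congr 1
    ring
  have key2 : ∀ u : ℝ, ⌊u⌋ = ⌊2 * u⌋ / 2 := fun u => by
    have h1 := Int.floor_le u
    have h2 := Int.lt_floor_add_one u
    have h3 : 2 * ⌊u⌋ ≤ ⌊2 * u⌋ := Int.le_floor.2 (by push_cast; linarith)
    have h4 : ⌊2 * u⌋ < 2 * ⌊u⌋ + 2 := Int.floor_lt.2 (by push_cast; linarith)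
    omega
  rw [key, key, add_left_inj] at h
  rw [key2, key2 (_ * y - _), h]

theorem cube_subset_of_le {t : Fin n → ℝ} (ht : t ∈ shifts n) {k k' : ℤ} (hk : k ≤ k')
    {m m' : Fin n → ℤ} {x : Rn n} (hx : x ∈ cube t k m) (hx' : x ∈ cube t k' m') :
    cube t k' m' ⊆ cube t k m := by
  intro y hy
  rw [mem_cube_iff] at hx hx' hy ⊢
  intro l
  rw [← hx l]
  have hτ : t l = 0 ∨ t l = 1 / 3 := by
    simpa using (Fintype.mem_piFinset.1 ht l)
  have h := (hy l).trans (hx' l).symm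
  obtain ⟨j, rfl⟩ := Int.le.dest hk
  clear hx hx' hy hk
  induction j with
  | zero => simpa using h
  | succ j ih =>
    refine ih (floor_eq_of_floor_succ_eq hτ ?_)
    simpa [add_assoc] using h

theorem isLaminar_grid {t : Fin n → ℝ} (ht : t ∈ shifts n) : IsLaminar (grid t) := by
  rintro _ ⟨k, m, rfl⟩ _ ⟨k', m', rfl⟩
  by_cases hd : Disjoint (cube t k m) (cube t k' m')
  · exact Or.inr (Or.inr hd)
  · obtain ⟨x, hx, hx'⟩ := Set.not_disjoint_iff.1 hd
    rcases le_total k k' with h | h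
    · exact Or.inr (Or.inl (cube_subset_of_le ht h hx hx'))
    · exact Or.inl (cube_subset_of_le ht h hx' hx)

theorem edist_le_of_mem_cube {t : Fin n → ℝ} {k : ℤ} {m : Fin n → ℤ} {x y : Rn n}
    (hx : x ∈ cube t k m) (hy : y ∈ cube t k m) :
    edist x y ≤ ENNReal.ofReal (n * 2 ^ (-k)) := by
  rw [edist_dist]
  refine ENNReal.ofReal_le_ofReal ?_
  have h2 : (0 : ℝ) < 2 ^ (-k) := by positivity
  rw [EuclideanSpace.dist_eq]
  refine Real.sqrt_le_iff.2 ⟨by positivity, ?_⟩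
  have : ∀ l, dist (x l) (y l) ^ 2 ≤ (2 ^ (-k) : ℝ) ^ 2 := fun l => by
    have h1 := hx l
    have h3 := hy l
    rw [Real.dist_eq]
    refine pow_le_pow_left₀ (abs_nonneg _) (abs_le.2 ⟨?_, ?_⟩) 2 <;> nlinarith
  calc ∑ l, dist (x l) (y l) ^ 2 ≤ ∑ _l : Fin n, (2 ^ (-k) : ℝ) ^ 2 :=
        Finset.sum_le_sum fun l _ => this l
    _ = n * (2 ^ (-k) : ℝ) ^ 2 := by simp
    _ ≤ n ^ 2 * (2 ^ (-k) : ℝ) ^ 2 := by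
        gcongr
        exact_mod_cast Nat.le_self_pow two_ne_zero n
    _ = _ := by ring

theorem ediam_cube_le (t : Fin n → ℝ) (k : ℤ) (m : Fin n → ℤ) :
    Metric.ediam (cube t k m) ≤ ENNReal.ofReal (n * 2 ^ (-k)) :=
  Metric.ediam_le fun _ hx _ hy => edist_le_of_mem_cube hx hy

/-- The corner and the centre differ by half the side in each coordinate. The opposite corner is not
in the half-open cube, and half the side suffices. -/
theorem le_ediam_cube (hn : 0 < n) (t : Fin n → ℝ) (k : ℤ) (m : Fin n → ℤ) :
    ENNReal.ofReal (2 ^ (-k) / 2) ≤ Metric.ediam (cube t k m) := by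
  have h2 : (0 : ℝ) < 2 ^ (-k) := by positivity
  let x : Rn n := WithLp.toLp 2 fun l => (2 : ℝ) ^ (-k) * (m l + (-1 : ℝ) ^ k * t l)
  let y : Rn n := WithLp.toLp 2 fun l => (2 : ℝ) ^ (-k) * (m l + (-1 : ℝ) ^ k * t l) + 2 ^ (-k) / 2
  have hx : x ∈ cube t k m := fun l => by
    simp only [x]
    constructor <;> nlinarith
  have hy : y ∈ cube t k m := fun l => by
    simp only [y]
    constructor <;> nlinarith
  refine le_trans ?_ (Metric.edist_le_ediam_of_mem hx hy)
  rw [edist_dist]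
  refine ENNReal.ofReal_le_ofReal ?_
  have h3 := PiLp.norm_apply_le (y - x) ⟨0, hn⟩
  rw [dist_comm, dist_eq_norm]
  refine le_trans (le_of_eq ?_) h3
  simp only [PiLp.sub_apply, x, y, add_sub_cancel_left, Real.norm_eq_abs]
  rw [abs_of_pos (by positivity)]

theorem nonempty_of_mem_grid {t : Fin n → ℝ} {Q : Set (Rn n)} (hQ : Q ∈ grid t) :
    Q.Nonempty := by
  obtain ⟨k, m, rfl⟩ := hQ
  have h2 : (0 : ℝ) < 2 ^ (-k) := by positivity
  refine ⟨WithLp.toLp 2 fun l => (2 : ℝ) ^ (-k) * (m l + (-1 : ℝ) ^ k * t l), fun l => ?_⟩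
  constructor <;> simp only <;> nlinarith

theorem measure_ne_top_of_mem_grid (μ : Measure (Rn n)) [IsLocallyFiniteMeasure μ] {t : Fin n → ℝ}
    {Q : Set (Rn n)} (hQ : Q ∈ grid t) : μ Q ≠ ∞ := by
  obtain ⟨k, m, rfl⟩ := hQ
  have hb : Bornology.IsBounded (cube t k m) :=
    Metric.isBounded_iff_ediam_ne_top.2
      (ne_top_of_le_ne_top ENNReal.ofReal_ne_top (ediam_cube_le t k m))
  exact hb.measure_lt_top.ne

/-! ### Dyadic description of the kernel -/

/-- The coefficient `(diam Q)^{-β}` of a cube. -/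
def coeff (β : ℝ) (Q : Set (Rn n)) : ℝ≥0∞ := (Metric.ediam Q ^ β)⁻¹

/-- The one-third trick on the line. If an interval of length below 1/3 straddles the integer N, it
lies in (N - 1/3, N + 1/3), so translation by 1/3 in either direction takes it off the integers. -/
theorem exists_floor_eq {lo hi s : ℝ} (hs : s = 1 ∨ s = -1) (h : hi - lo < 1 / 3) :
    ∃ τ : ℝ, (τ = 0 ∨ τ = 1 / 3) ∧ ∃ M : ℤ, ∀ u, lo ≤ u → u ≤ hi → ⌊u - s * τ⌋ = M := by
  by_cases hN : (⌊hi⌋ : ℝ) ≤ lo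
  · refine ⟨0, Or.inl rfl, ⌊hi⌋, fun u h1 h2 => ?_⟩
    rw [mul_zero, sub_zero, Int.floor_eq_iff]
    have := Int.lt_floor_add_one hi
    constructor <;> linarith
  · push Not at hN
    have := Int.floor_le hi
    rcases hs with rfl | rfl
    · refine ⟨1 / 3, Or.inr rfl, ⌊hi⌋ - 1, fun u h1 h2 => ?_⟩
      rw [Int.floor_eq_iff]
      push_cast
      constructor <;> linarith
    · refine ⟨1 / 3, Or.inr rfl, ⌊hi⌋, fun u h1 h2 => ?_⟩
      rw [Int.floor_eq_iff]
      constructor <;> linarith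

/-- The shift is chosen separately in each coordinate, so every element of {0, 1/3}ⁿ may occur. -/
theorem exists_cube_of_dist_lt (k : ℤ) (x y z : Rn n)
    (h : 3 * (dist x y + dist x z) < 2 ^ (-k)) :
    ∃ t ∈ shifts n, ∃ m, x ∈ cube t k m ∧ y ∈ cube t k m ∧ z ∈ cube t k m := by
  have hs : (-1 : ℝ) ^ k = 1 ∨ (-1 : ℝ) ^ k = -1 := by
    rcases Int.even_or_odd k with hk | hk
    · exact Or.inl hk.neg_one_zpow
    · exact Or.inr hk.neg_one_zpow
  have h2 : (0 : ℝ) < 2 ^ k := by positivity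
  have hd : ∀ (v w : Rn n) l, |v l - w l| ≤ dist v w := fun v w l => by
    have := PiLp.norm_apply_le (v - w) l
    rwa [PiLp.sub_apply, Real.norm_eq_abs, ← dist_eq_norm] at this
  have key : ∀ l, ∃ τ : ℝ, (τ = 0 ∨ τ = 1 / 3) ∧ ∃ M : ℤ, ∀ v ∈ ({x, y, z} : Set (Rn n)),
      ⌊(2 : ℝ) ^ k * v l - (-1) ^ k * τ⌋ = M := by
    intro l
    have hy := abs_le.1 (hd x y l)
    have hz := abs_le.1 (hd x z l)
    have hy0 := dist_nonneg (x := x) (y := y)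
    have hz0 := dist_nonneg (x := x) (y := z)
    set d := dist x y + dist x z with hdef
    have hd1 : (2 : ℝ) ^ k * d < 1 / 3 := by
      have := mul_lt_mul_of_pos_left h h2
      rw [zpow_neg, mul_inv_cancel₀ h2.ne'] at this
      linarith
    have hyz : |y l - z l| ≤ d := by
      rw [abs_le]; constructor <;> linarith
    have hyz' := abs_le.1 hyz
    set lo := min (x l) (min (y l) (z l)) with hlo
    have hl1 : lo ≤ x l := min_le_left _ _
    have hl2 : lo ≤ y l := (min_le_right _ _).trans (min_le_left _ _)
    have hl3 : lo ≤ z l := (min_le_right _ _).trans (min_le_right _ _)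
    have hup : x l ≤ lo + d ∧ y l ≤ lo + d ∧ z l ≤ lo + d := by
      simp only [← sub_le_iff_le_add, hlo, le_min_iff]
      refine ⟨⟨?_, ?_, ?_⟩, ⟨?_, ?_, ?_⟩, ?_, ?_, ?_⟩ <;> linarith
    obtain ⟨τ, hτ, M, hM⟩ := exists_floor_eq (lo := 2 ^ k * lo) (hi := 2 ^ k * (lo + d)) hs
      (by linarith [mul_add ((2 : ℝ) ^ k) lo d])
    refine ⟨τ, hτ, M, ?_⟩
    rintro v (rfl | rfl | rfl)
    · exact hM _ (by gcongr) (by gcongr; exact hup.1)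
    · exact hM _ (by gcongr) (by gcongr; exact hup.2.1)
    · exact hM _ (by gcongr) (by gcongr; exact hup.2.2)
  choose t ht m hm using key
  refine ⟨t, Fintype.mem_piFinset.2 fun l => by simpa using ht l, m, ?_, ?_, ?_⟩
  · exact mem_cube_iff.2 fun l => hm l x (by simp)
  · exact mem_cube_iff.2 fun l => hm l y (by simp)
  · exact mem_cube_iff.2 fun l => hm l z (by simp)

/-- The kernel is dominated by the sum over the shifted grids of the dyadic kernels. -/
theorem inv_edist_le_of_coeff_le {β : ℝ} (hβ : 0 < β) (hn : 0 < n) (x y z : Rn n) {R : ℝ≥0∞}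
    (hR : ∀ t ∈ shifts n, ∀ Q ∈ grid t, x ∈ Q → y ∈ Q → z ∈ Q → coeff β Q ≤ R) :
    ((edist x y + edist x z) ^ β)⁻¹ ≤ ENNReal.ofReal (6 * n) ^ β * R := by
  have hn' : (0 : ℝ) < n := by exact_mod_cast hn
  have key : ∀ k : ℤ, 3 * (dist x y + dist x z) < 2 ^ (-k) →
      (ENNReal.ofReal (n * 2 ^ (-k)))⁻¹ ≤ R ^ (1 / β) := by
    intro k hk
    obtain ⟨t, ht, m, hx, hy, hz⟩ := exists_cube_of_dist_lt k x y z hk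
    have h1 := hR t ht _ ⟨k, m, rfl⟩ hx hy hz
    rw [one_div, ENNReal.le_rpow_inv_iff hβ, ENNReal.inv_rpow]
    refine le_trans ?_ h1
    exact ENNReal.inv_le_inv.2 (ENNReal.rpow_le_rpow (ediam_cube_le t k m) hβ.le)
  have main : (edist x y + edist x z)⁻¹ ≤ ENNReal.ofReal (6 * n) * R ^ (1 / β) := by
    rw [edist_dist, edist_dist, ← ENNReal.ofReal_add dist_nonneg dist_nonneg]
    set d := dist x y + dist x z with hd
    have hd0 : 0 ≤ d := by positivity
    -- When the three points coincide, arbitrarily small cubes contain them and force R to be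
    -- infinite. Otherwise take the cube with side 2^{j+1}, where 2^j ≤ 3d < 2^{j+1}; its diameter
    -- is at most n 2^{j+1} ≤ 6nd, whence the constant 6n.
    rcases hd0.eq_or_lt with h0 | h0
    · have htop : R ^ (1 / β) = ∞ := by
        by_contra hne
        obtain ⟨j, hj⟩ := ENNReal.exists_nat_gt
          (ENNReal.mul_ne_top (ENNReal.ofReal_ne_top (r := n)) hne)
        have h1 := key j (by rw [← h0, mul_zero]; positivity)
        refine hj.not_ge ?_
        calc (j : ℝ≥0∞) ≤ ENNReal.ofReal (2 ^ j) := by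
              rw [← ENNReal.ofReal_natCast]
              exact ENNReal.ofReal_le_ofReal (by exact_mod_cast Nat.lt_two_pow_self.le)
          _ = ENNReal.ofReal n * (ENNReal.ofReal (n * 2 ^ (-(j : ℤ))))⁻¹ := by
              rw [← ENNReal.ofReal_inv_of_pos (by positivity), ← ENNReal.ofReal_mul hn'.le]
              congr 1
              rw [zpow_neg, zpow_natCast]
              field_simp
          _ ≤ _ := by gcongr
      rw [htop, ENNReal.mul_top (by simpa using hn.ne')]
      exact le_top
    · obtain ⟨j, hj1, hj2⟩ := exists_mem_Ico_zpow (x := 3 * d) (by positivity) one_lt_two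
      have h1 := key (-(j + 1)) (by simpa using hj2)
      calc (ENNReal.ofReal d)⁻¹ ≤ (ENNReal.ofReal (2 ^ (j + 1) / 6))⁻¹ := by
            refine ENNReal.inv_le_inv.2 (ENNReal.ofReal_le_ofReal ?_)
            rw [zpow_add_one₀ two_ne_zero]
            linarith
        _ = ENNReal.ofReal (6 * n) * (ENNReal.ofReal (n * 2 ^ (-(-(j + 1)))))⁻¹ := by
            rw [← ENNReal.ofReal_inv_of_pos (by positivity),
              ← ENNReal.ofReal_inv_of_pos (by positivity), ← ENNReal.ofReal_mul (by positivity)]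
            congr 1
            rw [neg_neg]
            field_simp
        _ ≤ _ := by gcongr
  calc ((edist x y + edist x z) ^ β)⁻¹ = ((edist x y + edist x z)⁻¹) ^ β :=
        (ENNReal.inv_rpow _ _).symm
    _ ≤ (ENNReal.ofReal (6 * n) * R ^ (1 / β)) ^ β := ENNReal.rpow_le_rpow main hβ.le
    _ = _ := by
        rw [ENNReal.mul_rpow_of_nonneg _ _ hβ.le, ← ENNReal.rpow_mul, one_div_mul_cancel hβ.ne',
          ENNReal.rpow_one]

/-- The constant in the domination of the dyadic kernels by the kernel. -/
def dyadicConst (n : ℕ) (β : ℝ) : ℝ≥0∞ :=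
  geomConst β * ENNReal.ofReal (4 * n) ^ β

theorem dyadicConst_ne_top {β : ℝ} (hβ : 0 < β) : dyadicConst n β ≠ ∞ :=
  ENNReal.mul_ne_top (geomConst_ne_top hβ)
    (ENNReal.rpow_ne_top_of_nonneg hβ.le ENNReal.ofReal_ne_top)

/-- Each generation has only one cube containing x, so the coefficients are bounded by a geometric
sequence governed by the smallest cube. That cube contains all three points, so its side cannot be
much smaller than their distances. -/
theorem sum_coeff_le {β : ℝ} (hβ : 0 < β) (hn : 0 < n) {t : Fin n → ℝ} (x y z : Rn n)
    (G : Finset (Set (Rn n))) (hG : ∀ Q ∈ G, Q ∈ grid t ∧ x ∈ Q ∧ y ∈ Q ∧ z ∈ Q) :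
    ∑ Q ∈ G, coeff β Q ≤ dyadicConst n β * ((edist x y + edist x z) ^ β)⁻¹ := by
  classical
  have hn' : (0 : ℝ) < n := by exact_mod_cast hn
  have hex : ∀ Q : Set (Rn n), ∃ k : ℤ, Q ∈ G → Q = cube t k fun l =>
      ⌊(2 : ℝ) ^ k * x l - (-1) ^ k * t l⌋ := by
    intro Q
    by_cases hQ : Q ∈ G
    · obtain ⟨⟨k, m, rfl⟩, hx, -⟩ := hG Q hQ
      exact ⟨k, fun _ => cube_eq_of_mem hx⟩
    · exact ⟨0, fun h => absurd h hQ⟩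
  choose κ hκ using hex
  let a : ℤ → ℝ≥0∞ := fun k => ENNReal.ofReal (2 * 2 ^ k)
  have ha : ∀ k l : ℤ, k < l → 2 * a k ≤ a l := by
    intro k l hkl
    have : (2 : ℝ≥0∞) = ENNReal.ofReal 2 := by simp
    simp only [a]
    rw [this, ← ENNReal.ofReal_mul zero_le_two]
    refine ENNReal.ofReal_le_ofReal ?_
    gcongr
    calc (2 : ℝ) * 2 ^ k = 2 ^ (k + 1) := by rw [zpow_add_one₀ two_ne_zero]; ring
      _ ≤ 2 ^ l := zpow_le_zpow_right₀ one_le_two hkl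
  have hinj : Set.InjOn κ G := fun Q hQ Q' hQ' h => by
    rw [hκ Q hQ, hκ Q' hQ', h]
  calc ∑ Q ∈ G, coeff β Q ≤ ∑ Q ∈ G, a (κ Q) ^ β := by
        refine Finset.sum_le_sum fun Q hQ => ?_
        rw [coeff, ← ENNReal.inv_rpow]
        refine ENNReal.rpow_le_rpow ?_ hβ.le
        have h1 := le_ediam_cube hn t (κ Q) fun l =>
          ⌊(2 : ℝ) ^ κ Q * x l - (-1) ^ κ Q * t l⌋
        rw [← hκ Q hQ] at h1
        refine (ENNReal.inv_le_inv.2 h1).trans (le_of_eq ?_)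
        rw [← ENNReal.ofReal_inv_of_pos (by positivity)]
        congr 1
        rw [zpow_neg]
        field_simp
    _ ≤ geomConst β * (G.sup fun Q => a (κ Q)) ^ β := by
        refine sum_rpow_le_of_doubling G (fun Q => a (κ Q)) hβ fun Q hQ Q' hQ' hne => ?_
        rcases lt_trichotomy (κ Q) (κ Q') with h | h | h
        · exact Or.inl (ha _ _ h)
        · exact absurd (hinj hQ hQ' h) hne
        · exact Or.inr (ha _ _ h)
    _ ≤ geomConst β * (ENNReal.ofReal (4 * n) / (edist x y + edist x z)) ^ β := by
        gcongr
        refine Finset.sup_le fun Q hQ => ?_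
        have h4 : ENNReal.ofReal (4 * n) ≠ 0 := by simpa using hn.ne'
        rw [ENNReal.le_div_iff_mul_le (Or.inr h4) (Or.inr ENNReal.ofReal_ne_top)]
        obtain ⟨-, hx, hy, hz⟩ := hG Q hQ
        rw [hκ Q hQ] at hx hy hz
        calc a (κ Q) * (edist x y + edist x z)
            ≤ a (κ Q) * (ENNReal.ofReal (n * 2 ^ (-κ Q)) + ENNReal.ofReal (n * 2 ^ (-κ Q))) := by
              gcongr
              · exact edist_le_of_mem_cube hx hy
              · exact edist_le_of_mem_cube hx hz
          _ = ENNReal.ofReal (4 * n) := by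
              rw [← ENNReal.ofReal_add (by positivity) (by positivity),
                ← ENNReal.ofReal_mul (by positivity)]
              congr 1
              rw [zpow_neg]
              field_simp
              ring
    _ = _ := by
        rw [div_eq_mul_inv, ENNReal.mul_rpow_of_nonneg _ _ hβ.le, ENNReal.inv_rpow, dyadicConst,
          mul_assoc]

end grid

/-! ### The norm is controlled by the sequential testing constants -/

section upper

variable {n : ℕ} {α : ℝ}

theorem measurable_kernel_comp {X : Type*} [MeasurableSpace X] {u v w : X → Rn n}
    (hu : Measurable u) (hv : Measurable v) (hw : Measurable w) :
    Measurable fun x => kernel α (u x) (v x) (w x) :=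
  (((hu.edist hv).add (hu.edist hw)).pow_const _).inv

theorem measurable_permuted_kernel (e : Equiv.Perm (Fin 3)) :
    Measurable fun q : Rn n × Rn n × Rn n => kernel α (![q.1, q.2.1, q.2.2] (e.symm 2))
      (![q.1, q.2.1, q.2.2] (e.symm 0)) (![q.1, q.2.1, q.2.2] (e.symm 1)) := by
  have h : ∀ i : Fin 3, Measurable fun q : Rn n × Rn n × Rn n =>
      (![q.1, q.2.1, q.2.2] : Fin 3 → Rn n) i := fun i => by
    fin_cases i
    · exact measurable_fst
    · exact measurable_fst.comp measurable_snd
    · exact measurable_snd.comp measurable_snd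
  exact measurable_kernel_comp (h _) (h _) (h _)

theorem measurable_partialOp (σ : Fin 3 → Measure (Rn n)) [∀ i, SFinite (σ i)]
    (e : Equiv.Perm (Fin 3)) {f g : Rn n → ℝ≥0∞} (hf : Measurable f) (hg : Measurable g) :
    Measurable (partialOp α σ e f g) := by
  unfold partialOp
  refine Measurable.lintegral_prod_right' (f := fun q : Rn n × Rn n => ∫⁻ z, f q.2 * g z *
    kernel α (![q.1, q.2, z] (e.symm 2)) (![q.1, q.2, z] (e.symm 0))
      (![q.1, q.2, z] (e.symm 1)) ∂(σ (e 2))) ?_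
  refine Measurable.lintegral_prod_right' (f := fun q : (Rn n × Rn n) × Rn n =>
    f q.1.2 * g q.2 * kernel α (![q.1.1, q.1.2, q.2] (e.symm 2))
      (![q.1.1, q.1.2, q.2] (e.symm 0)) (![q.1.1, q.1.2, q.2] (e.symm 1))) ?_
  refine ((hf.comp (measurable_snd.comp measurable_fst)).mul (hg.comp measurable_snd)).mul ?_
  exact (measurable_permuted_kernel e).comp
    (g := fun q : Rn n × Rn n × Rn n => kernel α (![q.1, q.2.1, q.2.2] (e.symm 2))
      (![q.1, q.2.1, q.2.2] (e.symm 0)) (![q.1, q.2.1, q.2.2] (e.symm 1)))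
    (f := fun q : (Rn n × Rn n) × Rn n => (q.1.1, q.1.2, q.2)) (by fun_prop)

theorem fracInt_eq_partialOp (σ : Fin 3 → Measure (Rn n)) (f g : Rn n → ℝ≥0∞) :
    fracInt α (σ 0) (σ 1) f g = partialOp α σ (finRotate 3).symm f g := by
  rfl

/-- Together with `localized_le_input` this sandwiches both localizations. The upper bound for N
needs only the smaller one and the lower bound only the larger, so every choice of `loc` gives the
same theorem. -/
theorem localized_inputOutput_le (loc : Loc) (σ : Fin 3 → Measure (Rn n))
    (e : Equiv.Perm (Fin 3)) (Q : Set (Rn n)) (x : Rn n) :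
    localized Loc.inputOutput α σ e Q x ≤ localized loc α σ e Q x := by
  cases loc
  · exact Set.indicator_le_self' (fun _ _ => zero_le) x
  · exact le_rfl

theorem localized_le_input (loc : Loc) (σ : Fin 3 → Measure (Rn n))
    (e : Equiv.Perm (Fin 3)) (Q : Set (Rn n)) (x : Rn n) :
    localized loc α σ e Q x ≤ localized Loc.input α σ e Q x := by
  cases loc
  · exact le_rfl
  · exact Set.indicator_le_self' (fun _ _ => zero_le) x

theorem testNorm_eq {p : Fin 3 → ℝ} (hp : ∀ i, 1 < p i) (loc : Loc) (σ : Fin 3 → Measure (Rn n))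
    (e : Equiv.Perm (Fin 3)) (Q : Set (Rn n)) :
    testNorm loc α p σ e Q = (∫⁻ x, localized loc α σ e Q x ^ (p (e 0)).conjExponent ∂σ (e 0)) ^
      (1 / (p (e 0)).conjExponent) :=
  eLpNorm_ofReal_eq _ (Real.HolderConjugate.conjExponent (hp (e 0))).symm.pos _

/-- A cube Q ⊆ F containing x, y and z forces all three into F, so the dyadic kernel sum is
controlled by the kernel with output as well as inputs cut off to F. -/
theorem sum_indicator_coeff_le (hα : α < 2 * (n : ℝ)) (hn : 0 < n) {t : Fin n → ℝ}
    (σ : Fin 3 → Measure (Rn n)) [∀ i, SFinite (σ i)] (e : Equiv.Perm (Fin 3))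
    (G : Finset (Set (Rn n))) {F : Set (Rn n)} (hG : ∀ Q ∈ G, Q ∈ grid t ∧ Q ⊆ F) (x : Rn n) :
    ∑ Q ∈ G, Q.indicator (fun _ => coeff (2 * n - α) Q * (σ (e 1) Q * σ (e 2) Q)) x ≤
      dyadicConst n (2 * n - α) * localized Loc.inputOutput α σ e F x := by
  classical
  have hβ : 0 < 2 * (n : ℝ) - α := by linarith
  have hm : ∀ Q ∈ G, MeasurableSet Q := fun Q hQ => measurableSet_of_mem_grid (hG Q hQ).1
  by_cases hx : x ∈ F
  swap
  · rw [Finset.sum_eq_zero]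
    · exact zero_le
    · exact fun Q hQ => Set.indicator_of_notMem (fun h => hx ((hG Q hQ).2 h)) _
  simp only [localized, Set.indicator_of_mem hx, partialOp]
  simp_rw [← lintegral_const_mul' _ _ (dyadicConst_ne_top (n := n) hβ)]
  calc ∑ Q ∈ G, Q.indicator (fun _ => coeff (2 * n - α) Q * (σ (e 1) Q * σ (e 2) Q)) x
      = ∑ Q ∈ G with x ∈ Q, coeff (2 * n - α) Q * (σ (e 1) Q * σ (e 2) Q) := by
        simp only [Set.indicator_apply]
        rw [← Finset.sum_filter]
    _ = ∫⁻ y, ∫⁻ z, ∑ Q ∈ G with x ∈ Q,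
          coeff (2 * n - α) Q * (Q.indicator 1 y * Q.indicator 1 z) ∂σ (e 2) ∂σ (e 1) := by
        have hi : ∀ y, ∫⁻ z, ∑ Q ∈ G with x ∈ Q,
          coeff (2 * n - α) Q * (Q.indicator 1 y * Q.indicator 1 z) ∂σ (e 2) =
            ∑ Q ∈ G with x ∈ Q, coeff (2 * n - α) Q * (Q.indicator 1 y * σ (e 2) Q) := by
          intro y
          rw [lintegral_finsetSum]
          · refine Finset.sum_congr rfl fun Q hQ => ?_
            have hQm := hm Q (Finset.mem_filter.1 hQ).1
            rw [lintegral_const_mul, lintegral_const_mul, lintegral_indicator_one hQm]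
            · exact measurable_one.indicator hQm
            · exact (measurable_one.indicator hQm).const_mul _
          · intro Q hQ
            have hQm := hm Q (Finset.mem_filter.1 hQ).1
            exact ((measurable_one.indicator hQm).const_mul _).const_mul _
        simp_rw [hi]
        rw [lintegral_finsetSum]
        · refine Finset.sum_congr rfl fun Q hQ => ?_
          have hQm := hm Q (Finset.mem_filter.1 hQ).1
          rw [lintegral_const_mul, lintegral_mul_const, lintegral_indicator_one hQm]
          · exact measurable_one.indicator hQm
          · exact (measurable_one.indicator hQm).mul_const _
        · intro Q hQ
          have hQm := hm Q (Finset.mem_filter.1 hQ).1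
          exact ((measurable_one.indicator hQm).mul_const _).const_mul _
    _ ≤ _ := by
        refine lintegral_mono fun y => lintegral_mono fun z => ?_
        by_cases hyz : y ∈ F ∧ z ∈ F
        · simp only [Set.indicator_of_mem hyz.1, Set.indicator_of_mem hyz.2, Pi.one_apply, one_mul]
          calc ∑ Q ∈ G with x ∈ Q, coeff (2 * n - α) Q * (Q.indicator 1 y * Q.indicator 1 z)
              = ∑ Q ∈ (G.filter (x ∈ ·)).filter (fun Q => y ∈ Q ∧ z ∈ Q),
                  coeff (2 * n - α) Q := by
                rw [Finset.sum_filter (fun Q : Set (Rn n) => y ∈ Q ∧ z ∈ Q)]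
                refine Finset.sum_congr rfl fun Q _ => ?_
                by_cases h1 : y ∈ Q <;> by_cases h2 : z ∈ Q <;> simp [h1, h2]
            _ ≤ _ := by
                refine sum_coeff_le hβ hn (t := t) _ _ _ _ fun Q hQ => ?_
                simp only [Finset.mem_filter] at hQ
                have hw : ∀ i : Fin 3, (![x, y, z] : Fin 3 → Rn n) i ∈ Q := fun i => by
                  fin_cases i
                  · exact hQ.1.2
                  · exact hQ.2.1
                  · exact hQ.2.2
                exact ⟨(hG Q hQ.1.1).1, hw _, hw _, hw _⟩
        · rw [Finset.sum_eq_zero]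
          · exact zero_le
          · intro Q hQ
            have hQF := (hG Q (Finset.mem_filter.1 hQ).1).2
            by_cases h1 : y ∈ Q <;> by_cases h2 : z ∈ Q <;> simp [h1, h2]
            exact absurd ⟨hQF h1, hQF h2⟩ hyz

theorem dyadicNorm_le_testNorm (hα : α < 2 * (n : ℝ)) (hn : 0 < n) {p : Fin 3 → ℝ}
    (hp : ∀ i, 1 < p i) {t : Fin n → ℝ} (σ : Fin 3 → Measure (Rn n)) [∀ i, SFinite (σ i)]
    (loc : Loc) (e : Equiv.Perm (Fin 3)) (G : Finset (Set (Rn n)))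
    (hG : (G : Set (Set (Rn n))) ⊆ grid t) (F : Set (Rn n)) :
    dyadicNorm (coeff (2 * n - α)) (σ (e 0)) (σ (e 1)) (σ (e 2)) (p (e 0)).conjExponent G F ≤
      dyadicConst n (2 * n - α) * testNorm loc α p σ e F := by
  classical
  have hβ : 0 < 2 * (n : ℝ) - α := by linarith
  have hq := (Real.HolderConjugate.conjExponent (hp (e 0))).symm.pos
  rw [testNorm_eq hp]
  set q := (p (e 0)).conjExponent
  have hc : dyadicConst n (2 * n - α) ^ q ≠ ∞ :=
    ENNReal.rpow_ne_top_of_nonneg hq.le (dyadicConst_ne_top hβ)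
  have e1 : dyadicConst n (2 * n - α) *
      (∫⁻ x, localized loc α σ e F x ^ q ∂σ (e 0)) ^ (1 / q) =
      (∫⁻ x, (dyadicConst n (2 * n - α) * localized loc α σ e F x) ^ q ∂σ (e 0)) ^ (1 / q) := by
    simp_rw [ENNReal.mul_rpow_of_nonneg _ _ hq.le]
    rw [lintegral_const_mul' _ _ hc, ENNReal.mul_rpow_of_nonneg _ _ (by positivity),
      ← ENNReal.rpow_mul, mul_one_div_cancel hq.ne', ENNReal.rpow_one]
  rw [e1]
  refine ENNReal.rpow_le_rpow (lintegral_mono fun x => ENNReal.rpow_le_rpow ?_ hq.le)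
    (by positivity)
  refine (sum_indicator_coeff_le hα hn (t := t) σ e _ (F := F) (fun Q hQ => ?_) x).trans ?_
  · rw [Finset.mem_filter] at hQ
    exact ⟨hG hQ.1, hQ.2⟩
  · gcongr
    exact localized_inputOutput_le loc σ e F x

theorem setLIntegral_ne_top_of_rpow {X : Type*} [MeasurableSpace X] {μ : Measure X} {p : ℝ}
    (hp : 1 < p) {f : X → ℝ≥0∞} (hf : Measurable f) (hfin : ∫⁻ x, f x ^ p ∂μ ≠ ∞) {Q : Set X}
    (hμ : μ Q ≠ ∞) : ∫⁻ x in Q, f x ∂μ ≠ ∞ := by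
  have hpq := Real.HolderConjugate.conjExponent hp
  have h := ENNReal.lintegral_mul_le_Lp_mul_Lq (μ.restrict Q) hpq hf.aemeasurable
    (aemeasurable_const (b := (1 : ℝ≥0∞)))
  simp only [Pi.mul_apply, mul_one, ENNReal.one_rpow, lintegral_const, one_mul,
    Measure.restrict_apply MeasurableSet.univ, Set.univ_inter] at h
  refine ne_top_of_le_ne_top (ENNReal.mul_ne_top ?_ ?_) h
  · refine ENNReal.rpow_ne_top_of_nonneg (by have := hpq.pos; positivity) ?_
    exact ne_top_of_le_ne_top hfin (setLIntegral_le_lintegral _ _)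
  · exact ENNReal.rpow_ne_top_of_nonneg (by have := hpq.symm.pos; positivity) hμ

/-- The constant in the bound for dyadic trilinear forms. -/
def trilinearConst (n : ℕ) (α : ℝ) (p : Fin 3 → ℝ) : ℝ≥0∞ :=
  8 * dyadicConst n (2 * n - α) * ∏ i, geomConst (p i - 1)

theorem tsum_coeff_le (hα : α < 2 * (n : ℝ)) (hn : 0 < n) {p : Fin 3 → ℝ}
    (hp : ∀ i, 1 < p i) {t : Fin n → ℝ} (ht : t ∈ shifts n) (σ : Fin 3 → Measure (Rn n))
    [∀ i, IsLocallyFiniteMeasure (σ i)] (loc : Loc) {f : Fin 3 → Rn n → ℝ≥0∞}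
    (hfm : ∀ i, Measurable (f i)) (hf : ∀ i, ∫⁻ x, f i x ^ p i ∂σ i ≠ ∞) :
    ∑' Q : grid t, coeff (2 * n - α) Q.1 * ∏ i, ∫⁻ x in Q.1, f i x ∂σ i ≤
      trilinearConst n α p * (∑ e, seqTesting loc α p σ (grid t) e) *
        ∏ i, (∫⁻ x, f i x ^ p i ∂σ i) ^ (1 / p i) := by
  classical
  rw [ENNReal.tsum_eq_iSup_sum]
  refine iSup_le fun s => ?_
  set c := dyadicConst n (2 * n - α)
  -- Cubes null for some σ_i contribute nothing to the form. Discarding them makes averages and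
  -- quotients over the remaining cubes legitimate.
  let G : Finset (Set (Rn n)) := (s.map (Function.Embedding.subtype _)).filter
    fun Q => ∀ i, σ i Q ≠ 0
  have hGgrid : ∀ Q ∈ G, Q ∈ grid t := by
    intro Q hQ
    simp only [G, Finset.mem_filter, Finset.mem_map, Function.Embedding.coe_subtype] at hQ
    obtain ⟨⟨Q', -, rfl⟩, -⟩ := hQ
    exact Q'.2
  have hsum : ∑ Q ∈ s, coeff (2 * n - α) Q.1 * ∏ i, ∫⁻ x in Q.1, f i x ∂σ i =
      ∑ Q ∈ G, coeff (2 * n - α) Q * ∏ i, ∫⁻ x in Q, f i x ∂σ i := by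
    rw [Finset.sum_filter_of_ne, Finset.sum_map]
    · rfl
    · intro Q _ hne i hi
      refine hne ?_
      rw [Finset.prod_eq_zero (Finset.mem_univ i), mul_zero]
      exact setLIntegral_measure_zero _ _ hi
  rw [hsum]
  refine (trilinear_le (τ := fun e => seqTesting loc α p σ (grid t) e * c)
    (Θ := fun e F => c * testNorm loc α p σ e F)
    hp (𝓓 := grid t) (fun Q hQ => hGgrid Q hQ)
    (fun A hA B hB => isLaminar_grid ht A (hGgrid A hA) B (hGgrid B hB))
    (fun Q hQ => nonempty_of_mem_grid (hGgrid Q hQ))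
    (fun Q hQ => measurableSet_of_mem_grid (hGgrid Q hQ))
    (fun i Q hQ => (Finset.mem_filter.1 hQ).2 i)
    (fun i Q hQ => measure_ne_top_of_mem_grid _ (hGgrid Q hQ)) _ hfm
    (fun i Q hQ => setLIntegral_ne_top_of_rpow (hp i) (hfm i) (hf i)
      (measure_ne_top_of_mem_grid _ (hGgrid Q hQ)))
    (fun e F hF => dyadicNorm_le_testNorm hα hn hp σ loc e G (fun Q hQ => hGgrid Q hQ) F)
    (fun e 𝓕j 𝓕k hj hk => ?_)).trans (le_of_eq ?_)
  · refine le_trans ?_ (mul_le_mul_left (le_iSup₂_of_le 𝓕j 𝓕k (le_iSup₂_of_le hj hk le_rfl)) c)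
    refine le_trans (seqNorm_mono _ fun Fk => ?_) (seqNorm_mul_le (rTot_ne_zero p) _ c)
    refine le_trans (seqNorm_mono _ fun Fj => ?_) (seqNorm_mul_le (rk_ne_zero p e) _ c)
    exact le_of_eq (by simp only [div_eq_mul_inv]; ring)
  · rw [Finset.prod_mul_distrib, ← Finset.sum_mul, trilinearConst]
    ring

theorem fracInt_le_tsum (hα : α < 2 * (n : ℝ)) (hn : 0 < n) (σ₁ σ₂ : Measure (Rn n))
    {f₁ f₂ : Rn n → ℝ≥0∞} (hf₁ : Measurable f₁) (hf₂ : Measurable f₂) (x : Rn n) :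
    fracInt α σ₁ σ₂ f₁ f₂ x ≤ ENNReal.ofReal (6 * n) ^ (2 * n - α) *
      ∑ t ∈ shifts n, ∑' Q : grid t, coeff (2 * n - α) Q.1 * (Q.1.indicator 1 x *
        ((∫⁻ y in Q.1, f₁ y ∂σ₁) * ∫⁻ z in Q.1, f₂ z ∂σ₂)) := by
  have hβ : 0 < 2 * (n : ℝ) - α := by linarith
  set C := ENNReal.ofReal (6 * n) ^ (2 * n - α)
  have hC : C ≠ ∞ := ENNReal.rpow_ne_top_of_nonneg hβ.le ENNReal.ofReal_ne_top
  let T : (t : Fin n → ℝ) → grid t → Rn n → Rn n → ℝ≥0∞ := fun t Q y z =>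
    coeff (2 * n - α) Q.1 * (Q.1.indicator 1 x * (Q.1.indicator f₁ y * Q.1.indicator f₂ z))
  have hcount : ∀ t : Fin n → ℝ, Countable (grid t) := fun t => (countable_grid t).to_subtype
  have hm : ∀ (t : Fin n → ℝ) (Q : grid t), MeasurableSet Q.1 :=
    fun t Q => measurableSet_of_mem_grid Q.2
  have hTz : ∀ t (Q : grid t) y, Measurable (T t Q y) := fun t Q y =>
    (((hf₂.indicator (hm t Q)).const_mul _).const_mul _).const_mul _
  calc fracInt α σ₁ σ₂ f₁ f₂ x
      ≤ ∫⁻ y, ∫⁻ z, C * ∑ t ∈ shifts n, ∑' Q : grid t, T t Q y z ∂σ₂ ∂σ₁ := by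
        refine lintegral_mono fun y => lintegral_mono fun z => ?_
        have hk : kernel α x y z ≤ C * ∑ t ∈ shifts n, ∑' Q : grid t, coeff (2 * n - α) Q.1 *
            (Q.1.indicator 1 x * (Q.1.indicator 1 y * Q.1.indicator 1 z)) := by
          refine inv_edist_le_of_coeff_le hβ hn x y z fun t ht Q hQ hx hy hz => ?_
          refine le_trans ?_ (Finset.single_le_sum (f := fun t => ∑' Q : grid t,
            coeff (2 * n - α) Q.1 * (Q.1.indicator 1 x * (Q.1.indicator 1 y * Q.1.indicator 1 z)))
            (fun _ _ => zero_le) ht)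
          refine le_trans ?_ (ENNReal.le_tsum ⟨Q, hQ⟩)
          simp [hx, hy, hz]
        calc f₁ y * f₂ z * kernel α x y z ≤ f₁ y * f₂ z * _ := mul_le_mul' le_rfl hk
          _ = _ := by
            rw [mul_left_comm, Finset.mul_sum]
            congr 1
            refine Finset.sum_congr rfl fun t _ => ?_
            rw [← ENNReal.tsum_mul_left]
            refine tsum_congr fun Q => ?_
            by_cases h1 : y ∈ Q.1 <;> by_cases h2 : z ∈ Q.1 <;> simp [T, h1, h2]
            ring
    _ = C * ∑ t ∈ shifts n, ∑' Q : grid t, ∫⁻ y, ∫⁻ z, T t Q y z ∂σ₂ ∂σ₁ := by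
        have h1 : ∀ y, ∫⁻ z, C * ∑ t ∈ shifts n, ∑' Q : grid t, T t Q y z ∂σ₂ =
            C * ∑ t ∈ shifts n, ∑' Q : grid t, ∫⁻ z, T t Q y z ∂σ₂ := fun y => by
          rw [lintegral_const_mul' _ _ hC, lintegral_finsetSum]
          · congr 1
            exact Finset.sum_congr rfl fun t _ => lintegral_tsum fun Q => (hTz t Q y).aemeasurable
          · exact fun t _ => Measurable.tsum fun Q => hTz t Q y
        have hTy : ∀ t (Q : grid t), Measurable fun y => ∫⁻ z, T t Q y z ∂σ₂ := fun t Q => by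
          have : ∀ y, ∫⁻ z, T t Q y z ∂σ₂ = coeff (2 * n - α) Q.1 * (Q.1.indicator 1 x *
              (Q.1.indicator f₁ y * ∫⁻ z, Q.1.indicator f₂ z ∂σ₂)) := fun y => by
            have hi := hf₂.indicator (hm t Q)
            rw [lintegral_const_mul _ ((hi.const_mul _).const_mul _),
              lintegral_const_mul _ (hi.const_mul _), lintegral_const_mul _ hi]
          simp_rw [this]
          exact (((hf₁.indicator (hm t Q)).mul_const _).const_mul _).const_mul _
        simp_rw [h1]
        rw [lintegral_const_mul' _ _ hC, lintegral_finsetSum]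
        · congr 1
          exact Finset.sum_congr rfl fun t _ => lintegral_tsum fun Q => (hTy t Q).aemeasurable
        · exact fun t _ => Measurable.tsum fun Q => hTy t Q
    _ = _ := by
        congr 1
        refine Finset.sum_congr rfl fun t _ => tsum_congr fun Q => ?_
        have hi := hf₂.indicator (hm t Q)
        have hi1 := hf₁.indicator (hm t Q)
        have : ∀ y, ∫⁻ z, T t Q y z ∂σ₂ = coeff (2 * n - α) Q.1 * (Q.1.indicator 1 x *
            (Q.1.indicator f₁ y * ∫⁻ z, Q.1.indicator f₂ z ∂σ₂)) := fun y => by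
          rw [lintegral_const_mul _ ((hi.const_mul _).const_mul _),
            lintegral_const_mul _ (hi.const_mul _), lintegral_const_mul _ hi]
        simp_rw [this]
        rw [lintegral_const_mul _ ((hi1.mul_const _).const_mul _),
          lintegral_const_mul _ (hi1.mul_const _), lintegral_mul_const _ hi1,
          lintegral_indicator (hm t Q), lintegral_indicator (hm t Q)]

/-- The constant in the bound of the norm by the testing constants. -/
def upperConst (n : ℕ) (α : ℝ) (p : Fin 3 → ℝ) : ℝ≥0∞ :=
  ENNReal.ofReal (6 * n) ^ (2 * n - α) * trilinearConst n α p

theorem upperConst_ne_top (hα : α < 2 * (n : ℝ)) {p : Fin 3 → ℝ} (hp : ∀ i, 1 < p i) :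
    upperConst n α p ≠ ∞ := by
  have hβ : 0 < 2 * (n : ℝ) - α := by linarith
  refine ENNReal.mul_ne_top (ENNReal.rpow_ne_top_of_nonneg hβ.le ENNReal.ofReal_ne_top)
    (ENNReal.mul_ne_top (ENNReal.mul_ne_top (by simp) (dyadicConst_ne_top hβ)) ?_)
  exact ENNReal.prod_ne_top fun i _ => geomConst_ne_top (by linarith [hp i])

/-- Dualizing against h ∈ L^{p_3}(σ_3) and inserting the dyadic domination of the kernel turns the
norm into a sum over the grids of trilinear forms in (f₁, f₂, h). -/
theorem eLpNorm_fracInt_le (hα : α < 2 * (n : ℝ)) (hn : 0 < n) {p : Fin 3 → ℝ}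
    (hp : ∀ i, 1 < p i) (σ : Fin 3 → Measure (Rn n)) [∀ i, IsLocallyFiniteMeasure (σ i)]
    (loc : Loc) {f₁ f₂ : Rn n → ℝ≥0∞} (hf₁ : Measurable f₁) (hf₂ : Measurable f₂)
    (h₁ : ∫⁻ x, f₁ x ^ p 0 ∂σ 0 ≠ ∞) (h₂ : ∫⁻ x, f₂ x ^ p 1 ∂σ 1 ≠ ∞) :
    eLpNorm (fracInt α (σ 0) (σ 1) f₁ f₂) (ENNReal.ofReal (p 2).conjExponent) (σ 2) ≤
      upperConst n α p * (∑ t ∈ shifts n, ∑ e, seqTesting loc α p σ (grid t) e) *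
        (eLpNorm f₁ (ENNReal.ofReal (p 0)) (σ 0) * eLpNorm f₂ (ENNReal.ofReal (p 1)) (σ 1)) := by
  have hcount : ∀ t : Fin n → ℝ, Countable (grid t) := fun t => (countable_grid t).to_subtype
  have hm : ∀ (t : Fin n → ℝ) (Q : grid t), MeasurableSet Q.1 :=
    fun t Q => measurableSet_of_mem_grid Q.2
  have hβ : 0 < 2 * (n : ℝ) - α := by linarith
  have hp0 : ∀ i, 0 < p i := fun i => by linarith [hp i]
  rw [eLpNorm_ofReal_eq _ (Real.HolderConjugate.conjExponent (hp 2)).symm.pos,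
    eLpNorm_ofReal_eq _ (hp0 0), eLpNorm_ofReal_eq _ (hp0 1)]
  refine lintegral_rpow_le_of_forall_dual (σ 2) (hp 2)
    (by rw [fracInt_eq_partialOp]; exact measurable_partialOp σ _ hf₁ hf₂) fun h hh hhfin => ?_
  set C := ENNReal.ofReal (6 * n) ^ (2 * n - α) with hCdef
  have hC : C ≠ ∞ := ENNReal.rpow_ne_top_of_nonneg hβ.le ENNReal.ofReal_ne_top
  let f : Fin 3 → Rn n → ℝ≥0∞ := ![f₁, f₂, h]
  have hfm : ∀ i, Measurable (f i) := fun i => by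
    fin_cases i
    · exact hf₁
    · exact hf₂
    · exact hh
  have hfin : ∀ i, ∫⁻ x, f i x ^ p i ∂σ i ≠ ∞ := fun i => by
    fin_cases i
    · exact h₁
    · exact h₂
    · exact hhfin
  calc ∫⁻ x, fracInt α (σ 0) (σ 1) f₁ f₂ x * h x ∂σ 2
      ≤ ∫⁻ x, C * ∑ t ∈ shifts n, ∑' Q : grid t, coeff (2 * n - α) Q.1 *
          ((∫⁻ y in Q.1, f₁ y ∂σ 0) * (∫⁻ z in Q.1, f₂ z ∂σ 1) * Q.1.indicator h x) ∂σ 2 := by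
        refine lintegral_mono fun x => ?_
        refine (mul_le_mul_left (fracInt_le_tsum hα hn (σ 0) (σ 1) hf₁ hf₂ x) (h x)).trans
          (le_of_eq ?_)
        rw [mul_assoc, Finset.sum_mul]
        congr 1
        refine Finset.sum_congr rfl fun t _ => ?_
        rw [← ENNReal.tsum_mul_right]
        refine tsum_congr fun Q => ?_
        by_cases hx : x ∈ Q.1 <;> simp [hx]
        ring
    _ = C * ∑ t ∈ shifts n, ∑' Q : grid t, coeff (2 * n - α) Q.1 *
          ∏ i, ∫⁻ x in Q.1, f i x ∂σ i := by
        have hmeas : ∀ t (Q : grid t), Measurable fun x => coeff (2 * n - α) Q.1 *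
          ((∫⁻ y in Q.1, f₁ y ∂σ 0) * (∫⁻ z in Q.1, f₂ z ∂σ 1) * Q.1.indicator h x) :=
          fun t Q => ((hh.indicator (hm t Q)).const_mul _).const_mul _
        rw [lintegral_const_mul' _ _ hC, lintegral_finsetSum]
        · congr 1
          refine Finset.sum_congr rfl fun t _ => ?_
          rw [lintegral_tsum fun Q => (hmeas t Q).aemeasurable]
          refine tsum_congr fun Q => ?_
          rw [lintegral_const_mul _ ((hh.indicator (hm t Q)).const_mul _),
            lintegral_const_mul _ (hh.indicator (hm t Q)), lintegral_indicator (hm t Q),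
            Fin.prod_univ_three]
          rfl
        · exact fun t _ => Measurable.tsum (hmeas t)
    _ ≤ C * ∑ t ∈ shifts n, trilinearConst n α p * (∑ e, seqTesting loc α p σ (grid t) e) *
          ∏ i, (∫⁻ x, f i x ^ p i ∂σ i) ^ (1 / p i) := by
        gcongr with t ht
        exact tsum_coeff_le hα hn hp ht σ loc hfm hfin
    _ = _ := by
        rw [← Finset.sum_mul, ← Finset.mul_sum, Fin.prod_univ_three, upperConst, ← hCdef]
        simp only [f, Matrix.cons_val_zero, Matrix.cons_val_one, Matrix.cons_val]
        ring

theorem opNorm_le_seqTesting (hα : α < 2 * (n : ℝ)) (hn : 0 < n) {p : Fin 3 → ℝ}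
    (hp : ∀ i, 1 < p i) (σ : Fin 3 → Measure (Rn n)) [∀ i, IsLocallyFiniteMeasure (σ i)]
    (loc : Loc) :
    opNorm α p σ ≤
      upperConst n α p * ∑ t ∈ shifts n, ∑ e, seqTesting loc α p σ (grid t) e := by
  have hp0 : ∀ i, 0 < p i := fun i => by linarith [hp i]
  refine le_of_forall_gt fun c hc => ?_
  -- The least constant is tested on all functions, including those of infinite norm. A slightly
  -- larger, hence nonzero, constant makes the right side infinite when one norm is ∞ and the other
  -- is not 0.
  obtain ⟨c', hc', hcc⟩ := exists_between hc
  refine lt_of_le_of_lt (sInf_le fun f₁ f₂ hf₁ hf₂ => ?_) hcc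
  have hc0 : c' ≠ 0 := (zero_le.trans_lt hc').ne'
  have hz : ∀ (i : Fin 3) (f : Rn n → ℝ≥0∞), Measurable f →
      eLpNorm f (ENNReal.ofReal (p i)) (σ i) = 0 → f =ᵐ[σ i] 0 := fun i f hf h =>
    (eLpNorm_eq_zero_iff hf.aestronglyMeasurable (by simpa using hp0 i)).1 h
  by_cases z1 : eLpNorm f₁ (ENNReal.ofReal (p 0)) (σ 0) = 0
  · have h0 : fracInt α (σ 0) (σ 1) f₁ f₂ = 0 := by
      funext x
      unfold fracInt
      rw [Pi.zero_apply, ← lintegral_zero (μ := σ 0)]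
      refine lintegral_congr_ae ?_
      filter_upwards [hz 0 f₁ hf₁ z1] with y hy
      simp [hy]
    rw [h0, eLpNorm_zero]
    exact zero_le
  by_cases z2 : eLpNorm f₂ (ENNReal.ofReal (p 1)) (σ 1) = 0
  · have h0 : fracInt α (σ 0) (σ 1) f₁ f₂ = 0 := by
      funext x
      unfold fracInt
      rw [Pi.zero_apply, ← lintegral_zero (μ := σ 0)]
      refine lintegral_congr fun y => ?_
      rw [← lintegral_zero (μ := σ 1)]
      refine lintegral_congr_ae ?_
      filter_upwards [hz 1 f₂ hf₂ z2] with y hy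
      simp [hy]
    rw [h0, eLpNorm_zero]
    exact zero_le
  have hfin : ∀ (i : Fin 3) (f : Rn n → ℝ≥0∞), ∫⁻ x, f x ^ p i ∂σ i = ∞ →
      eLpNorm f (ENNReal.ofReal (p i)) (σ i) = ∞ := fun i f h => by
    rw [eLpNorm_ofReal_eq _ (hp0 i), h, ENNReal.top_rpow_of_pos (by have := hp0 i; positivity)]
  by_cases t1 : ∫⁻ x, f₁ x ^ p 0 ∂σ 0 = ∞
  · rw [hfin 0 f₁ t1, ENNReal.top_mul z2, ENNReal.mul_top hc0]
    exact le_top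
  by_cases t2 : ∫⁻ x, f₂ x ^ p 1 ∂σ 1 = ∞
  · rw [hfin 1 f₂ t2, ENNReal.mul_top z1, ENNReal.mul_top hc0]
    exact le_top
  refine (eLpNorm_fracInt_le hα hn hp σ loc hf₁ hf₂ t1 t2).trans ?_
  gcongr

end upper

/-! ### The sequential testing constants are controlled by the Wolff constants -/

/-- The exponent identity gives s/p = s/q - 1, which turns a power of a testing ratio into a power
of the Wolff coefficient A^q/μ weighted by the measure μ. The hypothesis `h0` covers null cubes
under the convention 0/0 = 0. -/
theorem div_rpow_eq {A μ : ℝ≥0∞} {p q s : ℝ} (hq : 0 < q) (hs : 0 < s)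
    (h : 1 / s = 1 / q - 1 / p) (hμ : μ ≠ ∞) (h0 : μ = 0 → A = 0) :
    (A / μ ^ (1 / p)) ^ s = (A ^ q / μ) ^ (s / q) * μ := by
  rcases eq_or_ne μ 0 with hz | hz
  · simp [hz, h0 hz, hs]
  · have hsp : s / p = s / q - 1 := by
      have : s * (1 / s) = s * (1 / q - 1 / p) := by rw [h]
      rw [mul_one_div_cancel hs.ne'] at this
      rw [div_eq_mul_one_div s p, div_eq_mul_one_div s q]
      linarith
    rw [ENNReal.div_rpow_of_nonneg _ _ hs.le, ENNReal.div_rpow_of_nonneg _ _ (by positivity),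
      ← ENNReal.rpow_mul, ← ENNReal.rpow_mul, mul_div_cancel₀ _ hq.ne',
      show 1 / p * s = s / q - 1 by rw [← hsp]; ring]
    simp only [ENNReal.div_eq_inv_mul]
    rw [mul_right_comm]
    congr 1
    rw [← ENNReal.rpow_neg, ← ENNReal.rpow_neg]
    nth_rw 3 [← ENNReal.rpow_one μ]
    rw [← ENNReal.rpow_add _ _ hz hμ]
    congr 1
    ring

/-- Replace μ(F) by 2μ(E(F)). On E(F) ⊆ F the coefficient is at most the maximal function, and the
sets E(F) are disjoint. The predicate P allows the sum to be restricted to the members of 𝓕 inside a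
given cube. -/
theorem tsum_rpow_mul_le_of_isSparse {n : ℕ} {μ : Measure (Rn n)} {𝓓 𝓕 : Set (Set (Rn n))}
    (h : IsSparse μ 𝓓 𝓕) (h𝓓 : 𝓓.Countable) (a : Set (Rn n) → ℝ≥0∞) {u : ℝ} (hu : 0 ≤ u)
    (P : Set (Rn n) → Prop) (hP : ∀ F, P F → F ∈ 𝓕) {𝓖 : Set (Set (Rn n))} (h𝓖 : ∀ F, P F → F ∈ 𝓖) :
    ∑' F : {F // P F}, a F ^ u * μ F ≤ 2 * ∫⁻ x, maxFun 𝓖 a x ^ u ∂μ := by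
  obtain ⟨h𝓕, E, hE, hd⟩ := h
  have : Countable {F // P F} :=
    (h𝓓.mono fun F (hF : F ∈ {F | P F}) => h𝓕 (hP F hF)).to_subtype
  calc ∑' F : {F // P F}, a F ^ u * μ F
      ≤ ∑' F : {F // P F}, 2 * ∫⁻ x in E F, maxFun 𝓖 a x ^ u ∂μ := by
        refine ENNReal.tsum_le_tsum fun F => ?_
        obtain ⟨-, hsub, hle⟩ := hE F (hP F F.2)
        calc a F ^ u * μ F = a F ^ u * (2 * (2⁻¹ * μ F)) := by
              rw [← mul_assoc 2, ENNReal.mul_inv_cancel two_ne_zero (by simp), one_mul]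
          _ ≤ a F ^ u * (2 * μ (E F)) := by gcongr
          _ = 2 * ∫⁻ _ in E F, a F ^ u ∂μ := by rw [setLIntegral_const]; ring
          _ ≤ _ := by
              refine mul_le_mul' le_rfl (setLIntegral_mono' (hE F (hP F F.2)).1 fun x hx => ?_)
              exact ENNReal.rpow_le_rpow (le_maxFun (h𝓖 F F.2) (hsub hx)) hu
    _ = 2 * ∫⁻ x in ⋃ F : {F // P F}, E F, maxFun 𝓖 a x ^ u ∂μ := by
        rw [ENNReal.tsum_mul_left,
          lintegral_iUnion (fun F : {F // P F} => (hE F.1 (hP F.1 F.2)).1)]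
        intro F F' hne
        exact hd (hP F F.2) (hP F' F'.2) (fun h => hne (Subtype.ext h))
    _ ≤ _ := mul_le_mul' le_rfl (setLIntegral_le_lintegral _ _)

/-! ### Arithmetic of the exponents: 1/r_k = 1/p_i' - 1/p_j and 1/r = 1/r_k - 1/p_k when positive -/

section exponents

variable (p : Fin 3 → ℝ) (e : Equiv.Perm (Fin 3))

theorem rk_eq_top (h : 1 ≤ 1 / p (e 0) + 1 / p (e 1)) : rk p e = ∞ := by
  rw [rk, ENNReal.ofReal_of_nonpos (by linarith), ENNReal.inv_zero]

theorem rTot_eq_top (h : 1 ≤ 1 / p (e 0) + 1 / p (e 1) + 1 / p (e 2)) : rTot p = ∞ := by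
  rw [sum_inv_perm] at h
  rw [rTot, ENNReal.ofReal_of_nonpos (by linarith), ENNReal.inv_zero]

theorem exists_rk_eq (hp : ∀ i, 1 < p i) (h : 1 / p (e 0) + 1 / p (e 1) < 1) :
    ∃ s : ℝ, 1 ≤ s ∧ rk p e = ENNReal.ofReal s ∧
      1 / s = 1 / (p (e 0)).conjExponent - 1 / p (e 1) := by
  have hq := (Real.HolderConjugate.conjExponent (hp (e 0))).inv_add_inv_eq_one
  have h0 : 0 < 1 - 1 / p (e 0) - 1 / p (e 1) := by linarith
  have h1 : 0 < 1 / p (e 0) := by have := hp (e 0); positivity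
  have h2 : 0 < 1 / p (e 1) := by have := hp (e 1); positivity
  refine ⟨(1 - 1 / p (e 0) - 1 / p (e 1))⁻¹, (one_le_inv₀ h0).2 (by linarith), ?_, ?_⟩
  · rw [rk, ENNReal.ofReal_inv_of_pos h0]
  · rw [one_div, inv_inv]
    simp only [one_div] at *
    linarith

theorem exists_rTot_eq (hp : ∀ i, 1 < p i) {s : ℝ}
    (hs : 1 / s = 1 / (p (e 0)).conjExponent - 1 / p (e 1))
    (h : 1 / p (e 0) + 1 / p (e 1) + 1 / p (e 2) < 1) :
    ∃ r : ℝ, 1 ≤ r ∧ rTot p = ENNReal.ofReal r ∧ 1 / r = 1 / s - 1 / p (e 2) := by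
  have hq := (Real.HolderConjugate.conjExponent (hp (e 0))).inv_add_inv_eq_one
  have hsum := sum_inv_perm p e
  have hpos : ∀ i, 0 < 1 / p i := fun i => by have := hp i; positivity
  have h0 : 0 < 1 - 1 / p 0 - 1 / p 1 - 1 / p 2 := by linarith
  refine ⟨(1 - 1 / p 0 - 1 / p 1 - 1 / p 2)⁻¹,
    (one_le_inv₀ h0).2 (by linarith [hpos 0, hpos 1, hpos 2]), ?_, ?_⟩
  · rw [rTot, ENNReal.ofReal_inv_of_pos h0]
  · rw [hs, one_div, inv_inv]
    simp only [one_div] at *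
    linarith

end exponents

theorem seqNorm_ofReal {ι : Type*} {s : ℝ} (hs : 0 < s) (a : ι → ℝ≥0∞) :
    seqNorm (ENNReal.ofReal s) a = (∑' i, a i ^ s) ^ (1 / s) := by
  rw [seqNorm, if_neg ENNReal.ofReal_ne_top, ENNReal.toReal_ofReal hs.le]

theorem two_rpow_le {s : ℝ} (hs : 1 ≤ s) : (2 : ℝ≥0∞) ^ (1 / s) ≤ 2 := by
  conv_rhs => rw [← ENNReal.rpow_one 2]
  exact ENNReal.rpow_le_rpow_of_exponent_le one_le_two ((div_le_one (by linarith)).2 hs)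

section wolff

variable {n : ℕ} {α : ℝ} {p : Fin 3 → ℝ} (loc : Loc) (σ : Fin 3 → Measure (Rn n))
  (e : Equiv.Perm (Fin 3))

theorem testNorm_eq_zero_of_partialOp (hp : ∀ i, 1 < p i) {Q : Set (Rn n)}
    (h : ∀ x, partialOp α σ e (Q.indicator 1) (Q.indicator 1) x = 0) :
    testNorm loc α p σ e Q = 0 := by
  have hq := (Real.HolderConjugate.conjExponent (hp (e 0))).symm.pos
  rw [testNorm_eq hp]
  have : ∀ x, localized loc α σ e Q x = 0 := fun x =>
    le_antisymm ((localized_le_input loc σ e Q x).trans (h x).le) zero_le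
  simp [this, hq]

theorem ae_indicator_eq_zero {μ : Measure (Rn n)} {Q : Set (Rn n)} (h : μ Q = 0) :
    ∀ᵐ x ∂μ, Q.indicator (1 : Rn n → ℝ≥0∞) x = 0 := by
  filter_upwards [measure_eq_zero_iff_ae_notMem.1 h] with x hx
  exact Set.indicator_of_notMem hx _

theorem testNorm_eq_zero_left (hp : ∀ i, 1 < p i) {Q : Set (Rn n)} (h : σ (e 1) Q = 0) :
    testNorm loc α p σ e Q = 0 := by
  refine testNorm_eq_zero_of_partialOp loc σ e hp fun x => ?_
  unfold partialOp
  rw [← lintegral_zero (μ := σ (e 1))]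
  refine lintegral_congr_ae ?_
  filter_upwards [ae_indicator_eq_zero h] with y hy
  simp [hy]

theorem testNorm_eq_zero_right (hp : ∀ i, 1 < p i) {Q : Set (Rn n)} (h : σ (e 2) Q = 0) :
    testNorm loc α p σ e Q = 0 := by
  refine testNorm_eq_zero_of_partialOp loc σ e hp fun x => ?_
  unfold partialOp
  rw [← lintegral_zero (μ := σ (e 1))]
  refine lintegral_congr fun y => ?_
  rw [← lintegral_zero (μ := σ (e 2))]
  refine lintegral_congr_ae ?_
  filter_upwards [ae_indicator_eq_zero h] with z hz
  simp [hz]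

/-- The coefficients of the local Wolff maximal functions. -/
def wolffCoeff (loc : Loc) (α : ℝ) (p : Fin 3 → ℝ) (σ : Fin 3 → Measure (Rn n))
    (e : Equiv.Perm (Fin 3)) (Q : Set (Rn n)) : ℝ≥0∞ :=
  testNorm loc α p σ e Q ^ (p (e 0)).conjExponent / σ (e 1) Q

theorem wolffLocal_eq (𝓓 : Set (Set (Rn n))) (Q : Set (Rn n)) :
    wolffLocal loc α p σ 𝓓 e Q = maxFun {Q' ∈ 𝓓 | Q' ⊆ Q} (wolffCoeff loc α p σ e) := rfl

theorem wolffLocalNorm_eq {𝓓 : Set (Set (Rn n))} {s : ℝ} (hs0 : 0 < s)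
    (hs : rk p e = ENNReal.ofReal s) (Q : Set (Rn n)) :
    wolffLocalNorm loc α p σ 𝓓 e Q =
      (∫⁻ x, maxFun {Q' ∈ 𝓓 | Q' ⊆ Q} (wolffCoeff loc α p σ e) x ^
        (s / (p (e 0)).conjExponent) ∂σ (e 1)) ^ (1 / s) := by
  rw [wolffLocalNorm, hs, eLpNorm_ofReal_eq _ hs0, wolffLocal_eq]
  congr 1
  refine lintegral_congr fun x => ?_
  rw [← ENNReal.rpow_mul]
  congr 1
  ring

theorem wolffLocalNorm_eq_zero (hp : ∀ i, 1 < p i) {𝓓 : Set (Set (Rn n))} {s : ℝ} (hs0 : 0 < s)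
    (hs : rk p e = ENNReal.ofReal s) {Q : Set (Rn n)} (h : σ (e 2) Q = 0) :
    wolffLocalNorm loc α p σ 𝓓 e Q = 0 := by
  have hq := (Real.HolderConjugate.conjExponent (hp (e 0))).symm.pos
  have hz : ∀ x, maxFun {Q' ∈ 𝓓 | Q' ⊆ Q} (wolffCoeff loc α p σ e) x = 0 := fun x => by
    refine le_antisymm (maxFun_le fun Q' hQ' _ => ?_) zero_le
    rw [wolffCoeff, testNorm_eq_zero_right loc σ e hp (measure_mono_null hQ'.2 h),
      ENNReal.zero_rpow_of_pos hq, ENNReal.zero_div]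
  have hsq : 0 < s / (p (e 0)).conjExponent := by positivity
  rw [wolffLocalNorm_eq loc σ e hs0 hs]
  simp [hz, hsq, hs0]

theorem seqNorm_le_wolffLocalNorm (hp : ∀ i, 1 < p i) {𝓓 : Set (Set (Rn n))} (h𝓓 : 𝓓.Countable)
    (hfin : ∀ Q ∈ 𝓓, σ (e 1) Q ≠ ∞) {s : ℝ} (hs1 : 1 ≤ s) (hs : rk p e = ENNReal.ofReal s)
    (hsq : 1 / s = 1 / (p (e 0)).conjExponent - 1 / p (e 1))
    {𝓕 : Set (Set (Rn n))} (h𝓕 : IsSparse (σ (e 1)) 𝓓 𝓕) (Q : Set (Rn n)) :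
    seqNorm (rk p e) (fun F : {F // F ∈ 𝓕 ∧ F ⊆ Q} =>
      testNorm loc α p σ e F / σ (e 1) F ^ (1 / p (e 1))) ≤
      2 * wolffLocalNorm loc α p σ 𝓓 e Q := by
  have hq := (Real.HolderConjugate.conjExponent (hp (e 0))).symm.pos
  have hs0 : 0 < s := by linarith
  rw [hs, seqNorm_ofReal hs0, wolffLocalNorm_eq loc σ e hs0 hs]
  refine le_trans ?_ (mul_le_mul_left (two_rpow_le hs1) _)
  rw [← ENNReal.mul_rpow_of_nonneg _ _ (by positivity)]
  refine ENNReal.rpow_le_rpow ?_ (by positivity)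
  refine le_trans (le_of_eq (tsum_congr fun F => ?_))
    (tsum_rpow_mul_le_of_isSparse h𝓕 h𝓓 (wolffCoeff loc α p σ e)
      (u := s / (p (e 0)).conjExponent) (by positivity) (fun F => F ∈ 𝓕 ∧ F ⊆ Q) (fun F h => h.1)
      (fun F h => ⟨h𝓕.1 h.1, h.2⟩))
  exact div_rpow_eq hq hs0 hsq (hfin _ (h𝓕.1 F.2.1))
    (testNorm_eq_zero_left loc σ e hp)

/-- The sparse sum over F_j inside F_k is bounded by the local Wolff norm of F_k, and the sparse sum
over F_k by the global one. Each sparse family costs a factor 2. Where r_k or r is infinite the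
corresponding norm is a supremum and no sparseness is used. -/
theorem seqTesting_le_wolff (hp : ∀ i, 1 < p i) {𝓓 : Set (Set (Rn n))} (h𝓓 : 𝓓.Countable)
    (hfin : ∀ i, ∀ Q ∈ 𝓓, σ i Q ≠ ∞) :
    seqTesting loc α p σ 𝓓 e ≤ 4 * wolff loc α p σ 𝓓 e := by
  have hp0 : ∀ i, 0 < 1 / p i := fun i => by have := hp i; positivity
  refine iSup₂_le fun 𝓕j 𝓕k => iSup₂_le fun hj hk => ?_
  by_cases h1 : 1 ≤ 1 / p (e 0) + 1 / p (e 1)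
  · rw [rk_eq_top p e h1, rTot_eq_top p e (by linarith [hp0 (e 2)]), wolff, if_pos h1]
    simp only [seqNorm, if_true]
    refine le_trans ?_ (le_mul_of_one_le_left' (by norm_num))
    refine iSup_le fun Fk => iSup_le fun Fj => ?_
    refine le_trans ?_ (le_iSup₂ Fj.1 (hj.1 Fj.2.1))
    gcongr
    · exact (hp0 _).le
    -- With both norms suprema, enlarging the denominator from F_j to F_k only decreases the
    -- quotient, so the diagonal F_j = F_k dominates.
    · exact Fj.2.2
  obtain ⟨s, hs1, hs, hsq⟩ := exists_rk_eq p e hp (not_le.1 h1)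
  have hs0 : 0 < s := by linarith
  have inner : ∀ Fk : {F // F ∈ 𝓕k}, seqNorm (rk p e) (fun Fj : {F // F ∈ 𝓕j ∧ F ⊆ Fk.1} =>
      testNorm loc α p σ e Fj.1 / (σ (e 1) Fj.1 ^ (1 / p (e 1)) * σ (e 2) Fk.1 ^ (1 / p (e 2)))) ≤
      2 * (wolffLocalNorm loc α p σ 𝓓 e Fk / σ (e 2) Fk.1 ^ (1 / p (e 2))) := by
    intro Fk
    have hk' : σ (e 2) Fk.1 ^ (1 / p (e 2)) ≠ ∞ :=
      ENNReal.rpow_ne_top_of_nonneg (hp0 _).le (hfin _ _ (hk.1 Fk.2))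
    rw [div_eq_mul_inv (wolffLocalNorm _ _ _ _ _ _ _), ← mul_assoc]
    refine le_trans ?_ (mul_le_mul_left (seqNorm_le_wolffLocalNorm loc σ e hp h𝓓 (hfin _) hs1 hs hsq
      hj Fk.1) _)
    refine le_trans (seqNorm_mono _ fun Fj => ?_) (seqNorm_mul_le (rk_ne_zero p e) _ _)
    have hj' : σ (e 1) Fj.1 ^ (1 / p (e 1)) ≠ ∞ :=
      ENNReal.rpow_ne_top_of_nonneg (hp0 _).le (hfin _ _ (hj.1 Fj.2.1))
    rw [div_eq_mul_inv, ENNReal.mul_inv (Or.inr hk') (Or.inl hj'), ← mul_assoc,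
      ← div_eq_mul_inv (testNorm _ _ _ _ _ _)]
  refine le_trans (seqNorm_mono _ inner) ?_
  by_cases h2 : 1 ≤ 1 / p (e 0) + 1 / p (e 1) + 1 / p (e 2)
  · rw [rTot_eq_top p e h2, wolff, if_neg h1, if_pos h2]
    simp only [seqNorm, if_true]
    refine iSup_le fun Fk => ?_
    refine mul_le_mul' (by norm_num) ?_
    exact le_iSup₂ (f := fun Q (_ : Q ∈ 𝓓) =>
      wolffLocalNorm loc α p σ 𝓓 e Q / σ (e 2) Q ^ (1 / p (e 2))) Fk.1 (hk.1 Fk.2)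
  obtain ⟨r, hr1, hr, hrs⟩ := exists_rTot_eq p e hp hsq (not_le.1 h2)
  have hr0 : 0 < r := by linarith
  rw [wolff, if_neg h1, if_neg h2, show (4 : ℝ≥0∞) = 2 * 2 by norm_num, mul_assoc]
  simp_rw [mul_comm (2 : ℝ≥0∞) (_ / _)]
  refine (seqNorm_mul_le (rTot_ne_zero p) _ _).trans ?_
  rw [mul_comm _ (2 : ℝ≥0∞)]
  refine mul_le_mul' le_rfl ?_
  rw [hr, seqNorm_ofReal hr0, eLpNorm_ofReal_eq _ hr0]
  refine le_trans ?_ (mul_le_mul_left (two_rpow_le hr1) _)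
  rw [← ENNReal.mul_rpow_of_nonneg _ _ (by positivity)]
  refine ENNReal.rpow_le_rpow ?_ (by positivity)
  have hpow : ∀ x, (wolffGlobal loc α p σ 𝓓 e x ^ (1 / (rk p e).toReal)) ^ r =
      maxFun 𝓓 (fun Q => wolffLocalNorm loc α p σ 𝓓 e Q ^ s / σ (e 2) Q) x ^ (r / s) := by
    intro x
    rw [wolffGlobal, hs, ENNReal.toReal_ofReal hs0.le, ← ENNReal.rpow_mul, one_div_mul_eq_div]
    rfl
  simp_rw [hpow]
  refine le_trans (le_of_eq (tsum_congr fun F => ?_))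
    (tsum_rpow_mul_le_of_isSparse hk h𝓓 (fun Q => wolffLocalNorm loc α p σ 𝓓 e Q ^ s / σ (e 2) Q)
      (u := r / s) (by positivity) (fun F => F ∈ 𝓕k) (fun F h => h) (fun F h => hk.1 h))
  exact div_rpow_eq hs0 hr0 hrs (hfin _ _ (hk.1 F.2))
    (wolffLocalNorm_eq_zero loc σ e hp hs0 hs)

end wolff

/-! ### The partial adjoints have the same norm -/

section adjoint

variable {n : ℕ} {α : ℝ} (σ : Fin 3 → Measure (Rn n))

/-- The iterated integral of `Φ` in the order of integration prescribed by `e`. -/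
def iterInt (Φ : (Fin 3 → Rn n) → ℝ≥0∞) (e : Equiv.Perm (Fin 3)) : ℝ≥0∞ :=
  ∫⁻ x, ∫⁻ y, ∫⁻ z, Φ (![x, y, z] ∘ e.symm) ∂σ (e 2) ∂σ (e 1) ∂σ (e 0)

/-- The infimum is attained on pairs with finite norm product B: for B ≠ 0 divide by B. For B = 0
any one admissible constant shows that the left side vanishes. -/
theorem eLpNorm_fracInt_le_opNorm {p : Fin 3 → ℝ} (hN : opNorm α p σ ≠ ∞)
    {f₁ f₂ : Rn n → ℝ≥0∞} (hf₁ : Measurable f₁) (hf₂ : Measurable f₂)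
    (h : eLpNorm f₁ (ENNReal.ofReal (p 0)) (σ 0) * eLpNorm f₂ (ENNReal.ofReal (p 1)) (σ 1) ≠ ∞) :
    eLpNorm (fracInt α (σ 0) (σ 1) f₁ f₂) (ENNReal.ofReal (p 2).conjExponent) (σ 2) ≤
      opNorm α p σ *
        (eLpNorm f₁ (ENNReal.ofReal (p 0)) (σ 0) * eLpNorm f₂ (ENNReal.ofReal (p 1)) (σ 1)) := by
  set B := eLpNorm f₁ (ENNReal.ofReal (p 0)) (σ 0) * eLpNorm f₂ (ENNReal.ofReal (p 1)) (σ 1)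
  rcases eq_or_ne B 0 with h0 | h0
  · obtain ⟨C, hC, -⟩ := sInf_lt_iff.1 (lt_top_iff_ne_top.2 hN)
    have := hC f₁ f₂ hf₁ hf₂
    rw [h0, mul_zero]
    exact this.trans_eq (by change C * B = 0; rw [h0, mul_zero])
  · rw [← ENNReal.div_le_iff h0 h]
    exact le_sInf fun C hC => (ENNReal.div_le_iff h0 h).2 (hC f₁ f₂ hf₁ hf₂)

variable [∀ i, SFinite (σ i)] {Φ : (Fin 3 → Rn n) → ℝ≥0∞}

theorem measurable_vec3 (e : Equiv.Perm (Fin 3)) :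
    Measurable fun q : Rn n × Rn n × Rn n => (![q.1, q.2.1, q.2.2] : Fin 3 → Rn n) ∘ e.symm := by
  refine measurable_pi_lambda _ fun i => ?_
  simp only [Function.comp_apply]
  generalize e.symm i = j
  fin_cases j
  · exact measurable_fst
  · exact measurable_fst.comp measurable_snd
  · exact measurable_snd.comp measurable_snd

theorem iterInt_mul_swap_zero_one (hΦ : Measurable Φ) (e : Equiv.Perm (Fin 3)) :
    iterInt σ Φ (e * Equiv.swap 0 1 : Equiv.Perm (Fin 3)) = iterInt σ Φ e := by
  have h1 : ∀ x y z : Rn n, (![x, y, z] : Fin 3 → Rn n) ∘ (e * Equiv.swap 0 1).symm =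
      ![y, x, z] ∘ e.symm := fun x y z => by
    funext i
    rw [Function.comp_apply, Function.comp_apply]
    change (![x, y, z] : Fin 3 → Rn n) ((Equiv.swap 0 1).symm (e.symm i)) = _
    generalize e.symm i = j
    fin_cases j <;> rfl
  unfold iterInt
  simp_rw [h1]
  have e0 : (e * Equiv.swap 0 1 : Equiv.Perm (Fin 3)) 0 = e 1 := rfl
  have e1 : (e * Equiv.swap 0 1 : Equiv.Perm (Fin 3)) 1 = e 0 := rfl
  have e2 : (e * Equiv.swap 0 1 : Equiv.Perm (Fin 3)) 2 = e 2 := rfl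
  rw [e0, e1, e2]
  refine lintegral_lintegral_swap (f := fun x y => ∫⁻ z, Φ (![y, x, z] ∘ e.symm) ∂σ (e 2))
    (Measurable.aemeasurable ?_)
  refine Measurable.lintegral_prod_right' (f := fun q : (Rn n × Rn n) × Rn n =>
    Φ (![q.1.2, q.1.1, q.2] ∘ e.symm)) ?_
  exact hΦ.comp ((measurable_vec3 e).comp
    (f := fun q : (Rn n × Rn n) × Rn n => (q.1.2, q.1.1, q.2)) (by fun_prop))

theorem iterInt_mul_swap_one_two (hΦ : Measurable Φ) (e : Equiv.Perm (Fin 3)) :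
    iterInt σ Φ (e * Equiv.swap 1 2 : Equiv.Perm (Fin 3)) = iterInt σ Φ e := by
  have h1 : ∀ x y z : Rn n, (![x, y, z] : Fin 3 → Rn n) ∘ (e * Equiv.swap 1 2).symm =
      ![x, z, y] ∘ e.symm := fun x y z => by
    funext i
    rw [Function.comp_apply, Function.comp_apply]
    change (![x, y, z] : Fin 3 → Rn n) ((Equiv.swap 1 2).symm (e.symm i)) = _
    generalize e.symm i = j
    fin_cases j <;> rfl
  unfold iterInt
  simp_rw [h1]
  have e0 : (e * Equiv.swap 1 2 : Equiv.Perm (Fin 3)) 0 = e 0 := rfl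
  have e1 : (e * Equiv.swap 1 2 : Equiv.Perm (Fin 3)) 1 = e 2 := rfl
  have e2 : (e * Equiv.swap 1 2 : Equiv.Perm (Fin 3)) 2 = e 1 := rfl
  rw [e0, e1, e2]
  refine lintegral_congr fun x => ?_
  refine lintegral_lintegral_swap (f := fun y z => Φ (![x, z, y] ∘ e.symm))
    (Measurable.aemeasurable ?_)
  exact hΦ.comp ((measurable_vec3 e).comp
    (f := fun q : Rn n × Rn n => (x, q.2, q.1)) (by fun_prop))

/-- Tonelli, since the adjacent transpositions generate S₃. -/
theorem iterInt_eq (hΦ : Measurable Φ) (e : Equiv.Perm (Fin 3)) :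
    iterInt σ Φ e = iterInt σ Φ 1 := by
  have h : ∀ e : Equiv.Perm (Fin 3), e = 1 ∨ e = 1 * Equiv.swap 0 1 ∨ e = 1 * Equiv.swap 1 2 ∨
      e = 1 * Equiv.swap 0 1 * Equiv.swap 1 2 ∨ e = 1 * Equiv.swap 1 2 * Equiv.swap 0 1 ∨
      e = 1 * Equiv.swap 0 1 * Equiv.swap 1 2 * Equiv.swap 0 1 := by decide
  rcases h e with h | h | h | h | h | h <;> rw [h] <;>
    simp only [iterInt_mul_swap_zero_one σ hΦ, iterInt_mul_swap_one_two σ hΦ]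

theorem lintegral_partialOp_mul (e : Equiv.Perm (Fin 3)) {F : Fin 3 → Rn n → ℝ≥0∞}
    (hF : ∀ i, Measurable (F i)) :
    ∫⁻ x, partialOp α σ e (F (e 1)) (F (e 2)) x * F (e 0) x ∂σ (e 0) =
      iterInt σ (fun w => (∏ i, F i (w i)) * kernel α (w 2) (w 0) (w 1)) e := by
  refine lintegral_congr fun x => ?_
  have hKm : Measurable fun q : Rn n × Rn n => kernel α (![x, q.1, q.2] (e.symm 2))
      (![x, q.1, q.2] (e.symm 0)) (![x, q.1, q.2] (e.symm 1)) :=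
    (measurable_permuted_kernel e).comp (f := fun q : Rn n × Rn n => (x, q.1, q.2)) (by fun_prop)
  have hm2 : Measurable fun q : Rn n × Rn n => F (e 1) q.1 * F (e 2) q.2 *
      kernel α (![x, q.1, q.2] (e.symm 2)) (![x, q.1, q.2] (e.symm 0))
        (![x, q.1, q.2] (e.symm 1)) :=
    (((hF _).comp measurable_fst).mul ((hF _).comp measurable_snd)).mul hKm
  unfold partialOp
  rw [← lintegral_mul_const _ (Measurable.lintegral_prod_right' hm2)]
  refine lintegral_congr fun y => ?_
  have hmz : Measurable fun z => F (e 1) y * F (e 2) z *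
      kernel α (![x, y, z] (e.symm 2)) (![x, y, z] (e.symm 0)) (![x, y, z] (e.symm 1)) :=
    hm2.comp (f := fun z => (y, z)) (by fun_prop)
  dsimp only
  rw [← lintegral_mul_const _ hmz]
  refine lintegral_congr fun z => ?_
  have hw : ∏ i, F i ((![x, y, z] ∘ e.symm : Fin 3 → Rn n) i) =
      F (e 0) x * (F (e 1) y * F (e 2) z) := by
    rw [prod_perm _ e]
    simp
  rw [hw]
  simp only [Function.comp_apply]
  ring

/-- Pairing the partial adjoint with h gives the same triple integral as pairing 𝓘_α with the third
function. Hölder in σ_3 and the definition of N bound it symmetrically in the three functions, and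
the converse of Hölder removes h. -/
theorem lintegral_partialOp_rpow_le [∀ i, SigmaFinite (σ i)] {p : Fin 3 → ℝ} (hp : ∀ i, 1 < p i)
    (hN : opNorm α p σ ≠ ∞)
    (e : Equiv.Perm (Fin 3)) {f g : Rn n → ℝ≥0∞} (hf : Measurable f) (hg : Measurable g)
    (hf' : ∫⁻ x, f x ^ p (e 1) ∂σ (e 1) ≠ ∞) (hg' : ∫⁻ x, g x ^ p (e 2) ∂σ (e 2) ≠ ∞) :
    (∫⁻ x, partialOp α σ e f g x ^ (p (e 0)).conjExponent ∂σ (e 0)) ^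
      (1 / (p (e 0)).conjExponent) ≤
      opNorm α p σ * ((∫⁻ x, f x ^ p (e 1) ∂σ (e 1)) ^ (1 / p (e 1)) *
        (∫⁻ x, g x ^ p (e 2) ∂σ (e 2)) ^ (1 / p (e 2))) := by
  have hp0 : ∀ i, 0 < p i := fun i => by linarith [hp i]
  refine lintegral_rpow_le_of_forall_dual (σ (e 0)) (hp (e 0)) (measurable_partialOp σ e hf hg)
    fun h hh hh' => ?_
  let F : Fin 3 → Rn n → ℝ≥0∞ := fun i => (![h, f, g] : Fin 3 → Rn n → ℝ≥0∞) (e.symm i)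
  have F0 : F (e 0) = h := by simp [F]
  have F1 : F (e 1) = f := by simp [F]
  have F2 : F (e 2) = g := by simp [F]
  have all : ∀ P : Fin 3 → Prop, P (e 0) → P (e 1) → P (e 2) → ∀ i, P i := by
    intro P h0 h1 h2 i
    obtain ⟨j, rfl⟩ := e.surjective i
    fin_cases j
    · exact h0
    · exact h1
    · exact h2
  have hF : ∀ i, Measurable (F i) := all _ (F0 ▸ hh) (F1 ▸ hf) (F2 ▸ hg)
  have hF' : ∀ i, ∫⁻ x, F i x ^ p i ∂σ i ≠ ∞ :=
    all (fun i => ∫⁻ x, F i x ^ p i ∂σ i ≠ ∞) (by rwa [F0]) (by rwa [F1]) (by rwa [F2])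
  have hΦ : Measurable fun w : Fin 3 → Rn n => (∏ i, F i (w i)) * kernel α (w 2) (w 0) (w 1) :=
    (Finset.measurable_prod _ fun i _ => (hF i).comp (measurable_pi_apply i)).mul
      (measurable_kernel_comp (measurable_pi_apply 2) (measurable_pi_apply 0)
        (measurable_pi_apply 1))
  have hpq := Real.HolderConjugate.conjExponent (hp 2)
  have hB : eLpNorm (F 0) (ENNReal.ofReal (p 0)) (σ 0) *
      eLpNorm (F 1) (ENNReal.ofReal (p 1)) (σ 1) ≠ ∞ := by
    rw [eLpNorm_ofReal_eq _ (hp0 0), eLpNorm_ofReal_eq _ (hp0 1)]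
    exact ENNReal.mul_ne_top
      (ENNReal.rpow_ne_top_of_nonneg (by have := hp0 0; positivity) (hF' 0))
      (ENNReal.rpow_ne_top_of_nonneg (by have := hp0 1; positivity) (hF' 1))
  have key := eLpNorm_fracInt_le_opNorm σ hN (hF 0) (hF 1) hB
  rw [eLpNorm_ofReal_eq _ (hp0 0), eLpNorm_ofReal_eq _ (hp0 1),
    eLpNorm_ofReal_eq _ hpq.symm.pos] at key
  have hprod := prod_perm (fun i => (∫⁻ x, F i x ^ p i ∂σ i) ^ (1 / p i)) e
  rw [F0, F1, F2] at hprod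
  calc ∫⁻ x, partialOp α σ e f g x * h x ∂σ (e 0)
      = ∫⁻ x, partialOp α σ e (F (e 1)) (F (e 2)) x * F (e 0) x ∂σ (e 0) := by rw [F0, F1, F2]
    _ = ∫⁻ x, fracInt α (σ 0) (σ 1) (F 0) (F 1) x * F 2 x ∂σ 2 := by
        rw [lintegral_partialOp_mul σ e hF, iterInt_eq σ hΦ, ← iterInt_eq σ hΦ (finRotate 3).symm,
          ← lintegral_partialOp_mul σ _ hF, fracInt_eq_partialOp]
        rfl
    _ ≤ _ := ENNReal.lintegral_mul_le_Lp_mul_Lq (σ 2) hpq.symm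
        (by rw [fracInt_eq_partialOp]; exact (measurable_partialOp σ _ (hF 0) (hF 1)).aemeasurable)
        (hF 2).aemeasurable
    _ ≤ opNorm α p σ * ∏ i, (∫⁻ x, F i x ^ p i ∂σ i) ^ (1 / p i) := by
        rw [Fin.prod_univ_three, ← mul_assoc]
        exact mul_le_mul_left key _
    _ = _ := by rw [hprod]; ring

end adjoint

/-! ### Positive bilinear forms -/

section bilin

variable {X : Type*} [MeasurableSpace X] (μ ν : Measure X) (K : X → X → ℝ≥0∞)

/-- The bilinear form with kernel `K`. -/
def bilin (f g : X → ℝ≥0∞) : ℝ≥0∞ := ∫⁻ y, ∫⁻ z, f y * g z * K y z ∂ν ∂μ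

variable {μ ν K}

theorem bilin_mono {f f' g g' : X → ℝ≥0∞} (hf : ∀ y, f y ≤ f' y) (hg : ∀ z, g z ≤ g' z) :
    bilin μ ν K f g ≤ bilin μ ν K f' g' :=
  lintegral_mono fun y => lintegral_mono fun z =>
    mul_le_mul' (mul_le_mul' (hf y) (hg z)) le_rfl

theorem measurable_bilin_integrand (hK : Measurable (Function.uncurry K)) {f g : X → ℝ≥0∞}
    (hf : Measurable f) (hg : Measurable g) :
    Measurable fun q : X × X => f q.1 * g q.2 * K q.1 q.2 :=
  ((hf.comp measurable_fst).mul (hg.comp measurable_snd)).mul hK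

variable [SFinite ν]

theorem const_mul_bilin (hK : Measurable (Function.uncurry K)) {f g : X → ℝ≥0∞}
    (hf : Measurable f) (hg : Measurable g) (c : ℝ≥0∞) :
    c * bilin μ ν K f g = bilin μ ν K (fun y => c * f y) g := by
  have hm := measurable_bilin_integrand hK hf hg
  unfold bilin
  rw [← lintegral_const_mul _ (Measurable.lintegral_prod_right' hm)]
  refine lintegral_congr fun y => ?_
  have hmy : Measurable fun z => f y * g z * K y z := hm.comp (f := fun z => (y, z)) (by fun_prop)
  dsimp only
  rw [← lintegral_const_mul _ hmy]
  refine lintegral_congr fun z => ?_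
  ring

/-- Positivity of the kernel transfers a pointwise bound for a sum of tensor products to the form;
no bound for the factors separately is required. -/
theorem sum_bilin_le {ι : Type*} (S : Finset ι) (hK : Measurable (Function.uncurry K))
    {F G : ι → X → ℝ≥0∞} (hF : ∀ i ∈ S, Measurable (F i)) (hG : ∀ i ∈ S, Measurable (G i))
    {f g : X → ℝ≥0∞} (h : ∀ y z, ∑ i ∈ S, F i y * G i z ≤ f y * g z) :
    ∑ i ∈ S, bilin μ ν K (F i) (G i) ≤ bilin μ ν K f g := by
  unfold bilin
  have hm := fun i hi => measurable_bilin_integrand hK (hF i hi) (hG i hi)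
  rw [← lintegral_finsetSum _ fun i hi => Measurable.lintegral_prod_right' (hm i hi)]
  refine lintegral_mono fun y => ?_
  have hmy : ∀ i ∈ S, Measurable fun z => F i y * G i z * K y z := fun i hi =>
    (hm i hi).comp (f := fun z => (y, z)) (by fun_prop)
  dsimp only
  rw [← lintegral_finsetSum _ hmy]
  refine lintegral_mono fun z => ?_
  rw [← Finset.sum_mul]
  exact mul_le_mul' (h y z) le_rfl

/-- The vector-valued extension of a positive bilinear form to `ℓ^u × ℓ^v → ℓ^q`. -/
theorem sum_bilin_rpow_le {ι : Type*} (S : Finset ι) (hK : Measurable (Function.uncurry K))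
    {F G : ι → X → ℝ≥0∞} (hF : ∀ i ∈ S, Measurable (F i)) (hG : ∀ i ∈ S, Measurable (G i))
    {q u v : ℝ} (hq : 1 < q) (hu : 0 < u) (hv : 0 < v) (h : 1 / u + 1 / v = 1 / q) :
    ∑ i ∈ S, bilin μ ν K (F i) (G i) ^ q ≤
      bilin μ ν K (fun y => (∑ i ∈ S, F i y ^ u) ^ (1 / u))
        (fun z => (∑ i ∈ S, G i z ^ v) ^ (1 / v)) ^ q := by
  classical
  have hq0 : 0 < q := by linarith
  have hpq := Real.HolderConjugate.conjExponent hq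
  have hp0 := hpq.symm.pos
  set p := q.conjExponent
  set τ : ι → ℝ≥0∞ := fun i => bilin μ ν K (F i) (G i)
  have hle : ∀ {w : ℝ}, 0 < w → ∀ {H : ι → X → ℝ≥0∞} {i}, i ∈ S → ∀ y,
      H i y ≤ (∑ i ∈ S, H i y ^ w) ^ (1 / w) := by
    intro w hw H i hi y
    rw [one_div, ENNReal.le_rpow_inv_iff hw]
    exact Finset.single_le_sum (f := fun i => H i y ^ w) (fun _ _ => zero_le) hi
  -- An infinite value already forces the right side to be infinite. Otherwise the ℓ^q norm is
  -- finite and can be absorbed after linearizing with the weights τ_i^{q-1}, via Hölder with 1/p +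
  -- 1/u + 1/v = 1.
  by_cases htop : ∃ i ∈ S, τ i = ∞
  · obtain ⟨i, hi, hti⟩ := htop
    have := bilin_mono (μ := μ) (ν := ν) (K := K) (hle hu (H := F) hi) (hle hv (H := G) hi)
    rw [show bilin μ ν K (F i) (G i) = ∞ from hti, top_le_iff] at this
    rw [this, ENNReal.top_rpow_of_pos hq0]
    exact le_top
  push Not at htop
  have hfin : ∑ i ∈ S, τ i ^ q ≠ ∞ :=
    ENNReal.sum_ne_top.2 fun i hi => ENNReal.rpow_ne_top_of_nonneg hq0.le (htop i hi)
  have hfm : Measurable fun y => (∑ i ∈ S, F i y ^ u) ^ (1 / u) :=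
    (Finset.measurable_sum _ fun i hi => (hF i hi).pow_const _).pow_const _
  have hgm : Measurable fun z => (∑ i ∈ S, G i z ^ v) ^ (1 / v) :=
    (Finset.measurable_sum _ fun i hi => (hG i hi).pow_const _).pow_const _
  have hmain : (∑ i ∈ S, τ i ^ q) ^ (1 / q) ≤
      bilin μ ν K (fun y => (∑ i ∈ S, F i y ^ u) ^ (1 / u))
        (fun z => (∑ i ∈ S, G i z ^ v) ^ (1 / v)) := by
    refine rpow_le_of_le_mul_rpow (p := p) hq0 (by simpa using hpq.symm.inv_add_inv_eq_one)
      hfin ?_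
    rw [mul_comm, const_mul_bilin hK hfm hgm]
    calc ∑ i ∈ S, τ i ^ q = ∑ i ∈ S, bilin μ ν K (fun y => τ i ^ (q - 1) * F i y) (G i) := by
          refine Finset.sum_congr rfl fun i hi => ?_
          rw [← const_mul_bilin hK (hF i hi) (hG i hi)]
          conv_lhs => rw [show q = (q - 1) + 1 by ring]
          rw [ENNReal.rpow_add_of_nonneg _ _ (by linarith) zero_le_one, ENNReal.rpow_one]
      _ ≤ _ := by
          refine sum_bilin_le S hK (fun i hi => (hF i hi).const_mul _) hG fun y z => ?_
          have hH := sum_prod_rpow_le S (Finset.univ : Finset (Fin 3))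
            ![fun i => τ i ^ q, fun i => F i y ^ u, fun i => G i z ^ v]
            (w := ![1 / p, 1 / u, 1 / v])
            (by intro l _; fin_cases l <;> simp [hp0.le, hu.le, hv.le])
            (by
              have := hpq.inv_add_inv_eq_one
              simp only [Fin.sum_univ_three, Matrix.cons_val_zero, Matrix.cons_val_one,
                Matrix.cons_val]
              simp only [one_div] at *
              linarith)
          simp only [Fin.prod_univ_three, Matrix.cons_val_zero, Matrix.cons_val_one,
            Matrix.cons_val] at hH
          refine le_trans (le_of_eq (Finset.sum_congr rfl fun i _ => ?_)) hH
          rw [← ENNReal.rpow_mul, ← ENNReal.rpow_mul, ← ENNReal.rpow_mul,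
            mul_one_div_cancel hu.ne', mul_one_div_cancel hv.ne', ENNReal.rpow_one,
            ENNReal.rpow_one]
          congr 3
          have := hpq.sub_one_mul_conj
          field_simp
          linarith
  have := ENNReal.rpow_le_rpow hmain hq0.le
  rwa [← ENNReal.rpow_mul, one_div_mul_cancel hq0.ne', ENNReal.rpow_one] at this

end bilin

/-! ### Finite Wolff maximal functions -/

section finite

variable {X : Type*} [MeasurableSpace X] {μi μj μk : Measure X} {K : X → X → X → ℝ≥0∞}
  {G : Finset (Set X)} {a : Set X → ℝ≥0∞} {q pj pk s : ℝ}

theorem lintegral_maxFun_rpow_le_sum {𝓕 : Finset (Set X)} {b : Set X → ℝ≥0∞}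
    (hG : IsLaminar (G : Set (Set X)))
    (hm : ∀ Q ∈ G, MeasurableSet Q) (h : IsStopping b G 𝓕) {u : ℝ} (hu : 0 < u) :
    ∫⁻ x, maxFun G b x ^ u ∂μj ≤ 2 ^ u * ∑ F ∈ 𝓕, b F ^ u * μj F := by
  have hm' : ∀ Q ∈ 𝓕, MeasurableSet Q := fun Q hQ => hm Q (h.subset hQ)
  calc ∫⁻ x, maxFun G b x ^ u ∂μj
      ≤ ∫⁻ x, 2 ^ u * ∑ F ∈ 𝓕, F.indicator (fun _ => b F ^ u) x ∂μj := by
        refine lintegral_mono fun x => ?_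
        refine (ENNReal.rpow_le_rpow (h.maxFun_le hG x) hu.le).trans ?_
        rw [ENNReal.mul_rpow_of_nonneg _ _ hu.le]
        exact mul_le_mul' le_rfl (maxFun_rpow_le_sum hu x)
    _ = _ := by
        rw [lintegral_const_mul, lintegral_finsetSum]
        · congr 1
          refine Finset.sum_congr rfl fun F hF => ?_
          rw [lintegral_indicator (hm' F hF), setLIntegral_const]
        · exact fun F hF => measurable_const.indicator (hm' F hF)
        · exact Finset.measurable_sum _ fun F hF => measurable_const.indicator (hm' F hF)

/-- Finiteness of the quantity to be absorbed; this is where finiteness of the family is used. -/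
theorem lintegral_maxFun_ne_top {μ : Measure X} (hm : ∀ Q ∈ G, MeasurableSet Q)
    (hμ : ∀ Q ∈ G, μ Q ≠ ∞) (ha : ∀ Q ∈ G, a Q ≠ ∞) {u : ℝ} (hu : 0 < u) :
    ∫⁻ x, maxFun G a x ^ u ∂μ ≠ ∞ := by
  have h1 : ∫⁻ x, maxFun G a x ^ u ∂μ ≤ ∑ F ∈ G, a F ^ u * μ F := by
    refine (lintegral_mono fun x => maxFun_rpow_le_sum hu x).trans (le_of_eq ?_)
    rw [lintegral_finsetSum _ fun F hF => measurable_const.indicator (hm F hF)]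
    refine Finset.sum_congr rfl fun F hF => ?_
    rw [lintegral_indicator (hm F hF), setLIntegral_const]
  refine ne_top_of_le_ne_top (ENNReal.sum_ne_top.2 fun F hF => ?_) h1
  exact ENNReal.mul_ne_top (ENNReal.rpow_ne_top_of_nonneg hu.le (ha F hF)) (hμ F hF)

variable [SFinite μj] [SFinite μk]

/-- The constant in the lower bound for the operator by the Wolff maximal function. -/
def lowerConst (q pj s : ℝ) : ℝ≥0∞ := 2 ^ (s / q) * geomConst (s / q / pj) ^ q

/-- Put u = s/q and v = u/pj, so u = qv + 1. After stopping, the integral is comparable to ∑ a_F^u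
μj(F), and each term is at most the q-th power integral of a_F^v K(1_F, 1_F). Since q ≥ 1 the sum
goes inside the power, and ∑ a_F^v 1_F ⊗ 1_F ≲ M^v ⊗ 1_Q with M the maximal function of `a`. -/
theorem lintegral_maxFun_le (hK : Measurable fun w : X × X × X => K w.1 w.2.1 w.2.2)
    (hq : 1 < q) (hpj : 1 < pj) (hs : 0 < s) (hsq : 1 / s = 1 / q - 1 / pj)
    (hG : IsLaminar (G : Set (Set X))) (hm : ∀ Q ∈ G, MeasurableSet Q)
    {Q : Set X} (hQ : ∀ F ∈ G, F ⊆ Q) (hQm : MeasurableSet Q)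
    (ha : ∀ F ∈ G, a F * μj F ≤
      ∫⁻ x, bilin μj μk (K x) (F.indicator 1) (F.indicator 1) ^ q ∂μi) :
    ∫⁻ y, maxFun G a y ^ (s / q) ∂μj ≤ lowerConst q pj s *
      ∫⁻ x, bilin μj μk (K x) (fun y => maxFun G a y ^ (s / q / pj)) (Q.indicator 1) ^ q ∂μi := by
  obtain ⟨𝓕, h𝓕⟩ := exists_isStopping a G
  have hq0 : 0 < q := by linarith
  have hpj0 : 0 < pj := by linarith
  have hu : 0 < s / q := by positivity
  have hv : 0 < s / q / pj := by positivity
  have huv : s / q = q * (s / q / pj) + 1 := by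
    have h1 : s * (1 / s) = s * (1 / q - 1 / pj) := by rw [hsq]
    rw [mul_one_div_cancel hs.ne'] at h1
    have h2 : q * (s / q / pj) = s * (1 / pj) := by field_simp
    have h3 : s / q = s * (1 / q) := by ring
    rw [h2, h3]
    linarith
  set u := s / q
  set v := s / q / pj
  have hm' : ∀ Q ∈ 𝓕, MeasurableSet Q := fun Q hQ => hm Q (h𝓕.subset hQ)
  have hKx : ∀ x, Measurable (Function.uncurry (K x)) := fun x =>
    hK.comp (f := fun w : X × X => (x, w.1, w.2)) (by fun_prop)
  have hind : ∀ {A : Set X}, MeasurableSet A → Measurable (A.indicator (1 : X → ℝ≥0∞)) :=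
    fun hA => measurable_one.indicator hA
  have hMm : Measurable fun y => maxFun G a y ^ v :=
    (measurable_maxFun G.countable_toSet fun Q hQ => hm Q hQ).pow_const _
  have hbm : ∀ {f g : X → ℝ≥0∞}, Measurable f → Measurable g →
      Measurable fun x => bilin μj μk (K x) f g := by
    intro f g hf hg
    unfold bilin
    refine Measurable.lintegral_prod_right' (f := fun w : X × X =>
      ∫⁻ z, f w.2 * g z * K w.1 w.2 z ∂μk) ?_
    refine Measurable.lintegral_prod_right' (f := fun w : (X × X) × X =>
      f w.1.2 * g w.2 * K w.1.1 w.1.2 w.2) ?_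
    refine ((hf.comp (measurable_snd.comp measurable_fst)).mul (hg.comp measurable_snd)).mul ?_
    exact hK.comp (f := fun w : (X × X) × X => (w.1.1, w.1.2, w.2)) (by fun_prop)
  calc ∫⁻ y, maxFun G a y ^ u ∂μj
      ≤ 2 ^ u * ∑ F ∈ 𝓕, a F ^ u * μj F := lintegral_maxFun_rpow_le_sum hG hm h𝓕 hu
    _ ≤ 2 ^ u * ∑ F ∈ 𝓕, ∫⁻ x, (a F ^ v *
          bilin μj μk (K x) (F.indicator 1) (F.indicator 1)) ^ q ∂μi := by
        refine mul_le_mul' le_rfl (Finset.sum_le_sum fun F hF => ?_)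
        simp_rw [ENNReal.mul_rpow_of_nonneg _ _ hq0.le]
        rw [lintegral_const_mul _ ((hbm (hind (hm' F hF)) (hind (hm' F hF))).pow_const _)]
        conv_lhs => rw [huv]
        rw [ENNReal.rpow_add_of_nonneg _ _ (by positivity) zero_le_one, ENNReal.rpow_one,
          mul_assoc, mul_comm q v, ENNReal.rpow_mul]
        exact mul_le_mul' le_rfl (ha F (h𝓕.subset hF))
    _ = 2 ^ u * ∫⁻ x, ∑ F ∈ 𝓕, (a F ^ v *
          bilin μj μk (K x) (F.indicator 1) (F.indicator 1)) ^ q ∂μi := by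
        rw [lintegral_finsetSum]
        exact fun F hF => ((hbm (hind (hm' F hF)) (hind (hm' F hF))).const_mul _).pow_const _
    _ ≤ 2 ^ u * ∫⁻ x, (geomConst v *
          bilin μj μk (K x) (fun y => maxFun G a y ^ v) (Q.indicator 1)) ^ q ∂μi := by
        refine mul_le_mul' le_rfl (lintegral_mono fun x => ?_)
        refine (sum_rpow_le_rpow_sum _ _ hq.le).trans (ENNReal.rpow_le_rpow ?_ hq0.le)
        rw [const_mul_bilin (hKx x) hMm (hind hQm)]
        refine (Finset.sum_congr rfl fun F hF => const_mul_bilin (hKx x) (hind (hm' F hF))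
          (hind (hm' F hF)) _).trans_le ?_
        refine sum_bilin_le 𝓕 (hKx x) (fun F hF => (hind (hm' F hF)).const_mul _)
          (fun F hF => hind (hm' F hF)) fun y z => ?_
        calc ∑ F ∈ 𝓕, a F ^ v * F.indicator 1 y * F.indicator 1 z
            ≤ ∑ F ∈ 𝓕, F.indicator (fun _ => a F ^ v) y * Q.indicator 1 z := by
              refine Finset.sum_le_sum fun F hF => mul_le_mul' (le_of_eq ?_) ?_
              · by_cases hy : y ∈ F <;> simp [hy]
              · exact Set.indicator_le_indicator_of_subset (hQ F (h𝓕.subset hF))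
                  (fun _ => zero_le) z
          _ ≤ _ := by
              rw [← Finset.sum_mul]
              refine mul_le_mul' ((h𝓕.sum_rpow_le hG hv y).trans ?_) le_rfl
              gcongr
              exact maxFun_mono (fun _ hA => h𝓕.subset hA) (fun _ _ => le_rfl) y
    _ = _ := by
        simp_rw [ENNReal.mul_rpow_of_nonneg _ _ hq0.le]
        rw [lintegral_const_mul _ ((hbm hMm (hind hQm)).pow_const _), lowerConst, mul_assoc]

/-- The finite form of the bound for the local Wolff maximal function. -/
theorem local_wolff_le (hK : Measurable fun w : X × X × X => K w.1 w.2.1 w.2.2)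
    (hq : 1 < q) (hpj : 1 < pj) (hpk : 1 < pk) (hs : 0 < s) (hsq : 1 / s = 1 / q - 1 / pj)
    (hG : IsLaminar (G : Set (Set X))) (hm : ∀ Q ∈ G, MeasurableSet Q)
    (hjt : ∀ Q ∈ G, μj Q ≠ ∞) (hat : ∀ Q ∈ G, a Q ≠ ∞)
    {Q : Set X} (hQ : ∀ F ∈ G, F ⊆ Q) (hQm : MeasurableSet Q) (hkQ : μk Q ≠ ∞)
    (ha : ∀ F ∈ G, a F * μj F ≤
      ∫⁻ x, bilin μj μk (K x) (F.indicator 1) (F.indicator 1) ^ q ∂μi) {N : ℝ≥0∞}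
    (hN : ∀ f g : X → ℝ≥0∞, Measurable f → Measurable g → ∫⁻ x, f x ^ pj ∂μj ≠ ∞ →
      ∫⁻ x, g x ^ pk ∂μk ≠ ∞ → (∫⁻ x, bilin μj μk (K x) f g ^ q ∂μi) ^ (1 / q) ≤
        N * ((∫⁻ x, f x ^ pj ∂μj) ^ (1 / pj) * (∫⁻ x, g x ^ pk ∂μk) ^ (1 / pk))) :
    (∫⁻ y, maxFun G a y ^ (s / q) ∂μj) ^ (1 / s) ≤
      lowerConst q pj s ^ (1 / q) * N * μk Q ^ (1 / pk) := by
  have hq0 : 0 < q := by linarith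
  have hpj0 : 0 < pj := by linarith
  have hpk0 : 0 < pk := by linarith
  have h1 := lintegral_maxFun_le hK hq hpj hs hsq hG hm hQ hQm ha
  have hfin := lintegral_maxFun_ne_top hm hjt hat (show 0 < s / q by positivity)
  have hpow : ∀ y, (maxFun G a y ^ (s / q / pj)) ^ pj = maxFun G a y ^ (s / q) := fun y => by
    rw [← ENNReal.rpow_mul, div_mul_cancel₀ _ hpj0.ne']
  have hind : ∫⁻ z, (Q.indicator 1 z : ℝ≥0∞) ^ pk ∂μk = μk Q := by
    rw [← lintegral_indicator_one hQm]
    refine lintegral_congr fun z => ?_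
    by_cases hz : z ∈ Q <;> simp [hz, hpk0]
  have h2 := hN (fun y => maxFun G a y ^ (s / q / pj)) (Q.indicator 1)
    ((measurable_maxFun G.countable_toSet fun Q hQ => hm Q hQ).pow_const _)
    (measurable_one.indicator hQm) (by simpa only [hpow] using hfin) (by rwa [hind])
  simp_rw [hpow, hind] at h2
  set I := ∫⁻ y, maxFun G a y ^ (s / q) ∂μj with hI
  -- The test function has pj-th power equal to the integrand of I, so the bound reads I ≤ C
  -- I^{q/pj}; the factor I^{q/pj} is absorbed because q/pj + q/s = 1.
  have h3 : I ^ (1 / (s / q)) ≤ lowerConst q pj s * (N * μk Q ^ (1 / pk)) ^ q := by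
    refine rpow_le_of_le_mul_rpow (p := pj / q) (by positivity) ?_ hfin ?_
    · rw [one_div_div, one_div_div, div_eq_mul_one_div q s, hsq]
      field_simp
      ring
    · refine h1.trans ?_
      rw [mul_assoc]
      refine mul_le_mul' le_rfl ?_
      rw [one_div, ENNReal.rpow_inv_le_iff hq0] at h2
      refine h2.trans (le_of_eq ?_)
      rw [← mul_assoc, mul_right_comm, ENNReal.mul_rpow_of_nonneg _ _ hq0.le, ← ENNReal.rpow_mul]
      congr 2
      field_simp
  have h4 := ENNReal.rpow_le_rpow h3 (show 0 ≤ 1 / q by positivity)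
  rw [← ENNReal.rpow_mul, ENNReal.mul_rpow_of_nonneg _ _ (by positivity), ← ENNReal.rpow_mul,
    mul_one_div_cancel hq0.ne', ENNReal.rpow_one, ← mul_assoc] at h4
  refine le_trans (le_of_eq ?_) h4
  congr 1
  field_simp

end finite

/-- The constant in the finite form of the bound for the global Wolff maximal function. -/
def globalConst (q pj s r : ℝ) : ℝ≥0∞ :=
  (2 ^ (r / s)) ^ (1 / s) * lowerConst q pj s ^ (1 / q) * geomConst (r / s - 1) ^ (1 / s)

/-! ### The global Wolff maximal function over a finite family -/

section finite

variable {X : Type*} [MeasurableSpace X] {μi μj μk : Measure X} {K : X → X → X → ℝ≥0∞}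
  {a : Set X → ℝ≥0∞} {q pj pk s r : ℝ}

/-- The averages over `Q`, with respect to `μk`, of the local Wolff maximal functions. -/
def wolffAverage (μj μk : Measure X) (a : Set X → ℝ≥0∞) (u : ℝ) (G : Set (Set X)) (Q : Set X) :
    ℝ≥0∞ :=
  (∫⁻ y, maxFun {Q' ∈ G | Q' ⊆ Q} a y ^ u ∂μj) / μk Q

variable [SFinite μj] [SFinite μk] {G : Finset (Set X)}

/-- The finite form of the bound for the global Wolff maximal function. -/
theorem global_wolff_le (hK : Measurable fun w : X × X × X => K w.1 w.2.1 w.2.2)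
    (hq : 1 < q) (hpj : 1 < pj) (hpk : 1 < pk) (hs : 0 < s) (hsq : 1 / s = 1 / q - 1 / pj)
    (hr : 0 < r) (hrs : 1 / r = 1 / s - 1 / pk)
    (hG : IsLaminar (G : Set (Set X))) (hm : ∀ Q ∈ G, MeasurableSet Q)
    (hjt : ∀ Q ∈ G, μj Q ≠ ∞) (hkt : ∀ Q ∈ G, μk Q ≠ ∞) (hat : ∀ Q ∈ G, a Q ≠ ∞)
    (hka : ∀ Q ∈ G, μk Q = 0 → a Q = 0)
    (ha : ∀ F ∈ G, a F * μj F ≤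
      ∫⁻ x, bilin μj μk (K x) (F.indicator 1) (F.indicator 1) ^ q ∂μi) {N : ℝ≥0∞}
    (hN : ∀ f g : X → ℝ≥0∞, Measurable f → Measurable g → ∫⁻ x, f x ^ pj ∂μj ≠ ∞ →
      ∫⁻ x, g x ^ pk ∂μk ≠ ∞ → (∫⁻ x, bilin μj μk (K x) f g ^ q ∂μi) ^ (1 / q) ≤
        N * ((∫⁻ x, f x ^ pj ∂μj) ^ (1 / pj) * (∫⁻ x, g x ^ pk ∂μk) ^ (1 / pk))) :
    (∫⁻ z, maxFun G (wolffAverage μj μk a (s / q) G) z ^ (r / s) ∂μk) ^ (1 / r) ≤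
      globalConst q pj s r * N := by
  classical
  have hq0 : 0 < q := by linarith
  have hpj0 : 0 < pj := by linarith
  have hpk0 : 0 < pk := by linarith
  have hu : 0 < s / q := by positivity
  have hρ0 : 0 < r / s := by positivity
  have hρ1 : r / s - 1 = r / pk := by
    have h1 : r * (1 / r) = r * (1 / s - 1 / pk) := by rw [hrs]
    rw [mul_one_div_cancel hr.ne'] at h1
    rw [div_eq_mul_one_div r s, div_eq_mul_one_div r pk]
    linarith
  have hρpos : 0 < r / s - 1 := by rw [hρ1]; positivity
  set b := wolffAverage μj μk a (s / q) G with hb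
  set ρ := r / s with hρ
  let GQ : Set X → Finset (Set X) := fun Q => G.filter (· ⊆ Q)
  have hGQ : ∀ Q, {Q' ∈ (G : Set (Set X)) | Q' ⊆ Q} = (GQ Q : Set (Set X)) := fun Q => by
    simp [GQ]
  have hGsub : ∀ Q, GQ Q ⊆ G := fun Q => Finset.filter_subset _ _
  let w : Set X → X → ℝ≥0∞ := fun Q => maxFun (GQ Q) a
  let B : Set X → ℝ≥0∞ := fun Q => ∫⁻ y, w Q y ^ (s / q) ∂μj
  have hbB : ∀ Q, b Q = B Q / μk Q := fun Q => by
    simp only [hb, wolffAverage, hGQ, B, w]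
  have hwm : ∀ Q, Measurable (w Q) := fun Q =>
    measurable_maxFun (Finset.countable_toSet _) fun A hA => hm A (hGsub Q hA)
  have hBt : ∀ Q, B Q ≠ ∞ := fun Q => lintegral_maxFun_ne_top (fun A hA => hm A (hGsub Q hA))
    (fun A hA => hjt A (hGsub Q hA)) (fun A hA => hat A (hGsub Q hA)) hu
  have hB0 : ∀ Q, μk Q = 0 → B Q = 0 := fun Q h0 => by
    have : ∀ y, w Q y = 0 := fun y => le_antisymm (maxFun_le fun A hA _ => by
      have hA' := Finset.mem_filter.1 hA
      exact (hka A hA'.1 (measure_mono_null hA'.2 h0)).le) zero_le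
    simp [B, this, hu]
  have hbt : ∀ Q ∈ G, b Q ≠ ∞ := fun Q hQ => by
    rw [hbB]
    rcases eq_or_ne (μk Q) 0 with h0 | h0
    · simp [hB0 Q h0]
    · exact ENNReal.div_ne_top (hBt Q) h0
  have hbμ : ∀ Q ∈ G, b Q * μk Q = B Q := fun Q hQ => by
    rw [hbB]
    rcases eq_or_ne (μk Q) 0 with h0 | h0
    · simp [hB0 Q h0]
    · exact ENNReal.div_mul_cancel h0 (hkt Q hQ)
  obtain ⟨𝓕, h𝓕⟩ := exists_isStopping b G
  have hm' : ∀ Q ∈ 𝓕, MeasurableSet Q := fun Q hQ => hm Q (h𝓕.subset hQ)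
  set Y := ∫⁻ z, maxFun G b z ^ ρ ∂μk with hY
  set X₀ := ∑ F ∈ 𝓕, b F ^ (ρ - 1) * B F with hX
  -- One power of b_F combines with μk(F) to give the local integral B_F, so X₀ is a weighted sum of
  -- quantities to which the local estimate applies.
  have hYX : Y ≤ 2 ^ ρ * X₀ := by
    refine (lintegral_maxFun_rpow_le_sum hG hm h𝓕 hρ0).trans (le_of_eq ?_)
    congr 1
    refine Finset.sum_congr rfl fun F hF => ?_
    rw [← hbμ F (h𝓕.subset hF), ← mul_assoc]
    congr 1
    conv_lhs => rw [show ρ = (ρ - 1) + 1 by ring]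
    rw [ENNReal.rpow_add_of_nonneg _ _ hρpos.le zero_le_one, ENNReal.rpow_one]
  have hYt : Y ≠ ∞ := lintegral_maxFun_ne_top hm hkt hbt hρ0
  have hXt : X₀ ≠ ∞ := ENNReal.sum_ne_top.2 fun F hF => ENNReal.mul_ne_top
    (ENNReal.rpow_ne_top_of_nonneg hρpos.le (hbt F (h𝓕.subset hF))) (hBt F)
  -- Because q/pj + q/s = 1, the weight b_F^{ρ-1} outside the q-th power splits between the two
  -- arguments. The exponents are chosen so that ∑ Φ^pj integrates exactly to X₀ and ∑ Ψ^s is a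
  -- geometric sum in b^{ρ-1}.
  set Φ : Set X → X → ℝ≥0∞ := fun F y => b F ^ ((ρ - 1) / pj) * w F y ^ (s / q / pj) with hΦ
  set Ψ : Set X → X → ℝ≥0∞ := fun F z => b F ^ ((ρ - 1) / s) * F.indicator 1 z with hΨ
  have hΦm : ∀ F, Measurable (Φ F) := fun F => ((hwm F).pow_const _).const_mul _
  have hΨm : ∀ F ∈ 𝓕, Measurable (Ψ F) := fun F hF =>
    (measurable_one.indicator (hm' F hF)).const_mul _
  have hKx : ∀ x, Measurable (Function.uncurry (K x)) := fun x =>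
    hK.comp (f := fun w : X × X => (x, w.1, w.2)) (by fun_prop)
  have hbm : ∀ {f g : X → ℝ≥0∞}, Measurable f → Measurable g →
      Measurable fun x => bilin μj μk (K x) f g := by
    intro f g hf hg
    unfold bilin
    refine Measurable.lintegral_prod_right' (f := fun w : X × X =>
      ∫⁻ z, f w.2 * g z * K w.1 w.2 z ∂μk) ?_
    refine Measurable.lintegral_prod_right' (f := fun w : (X × X) × X =>
      f w.1.2 * g w.2 * K w.1.1 w.1.2 w.2) ?_
    refine ((hf.comp (measurable_snd.comp measurable_fst)).mul (hg.comp measurable_snd)).mul ?_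
    exact hK.comp (f := fun w : (X × X) × X => (w.1.1, w.1.2, w.2)) (by fun_prop)
  have hexp : q * (1 / pj) + q * (1 / s) = 1 := by
    rw [hsq]; field_simp; ring
  have hX1 : X₀ ≤ lowerConst q pj s * ∫⁻ x, bilin μj μk (K x)
      (fun y => (∑ F ∈ 𝓕, Φ F y ^ pj) ^ (1 / pj))
      (fun z => (∑ F ∈ 𝓕, Ψ F z ^ s) ^ (1 / s)) ^ q ∂μi := by
    calc X₀ ≤ ∑ F ∈ 𝓕, lowerConst q pj s *
          ∫⁻ x, bilin μj μk (K x) (Φ F) (Ψ F) ^ q ∂μi := by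
          refine Finset.sum_le_sum fun F hF => ?_
          have hFG := h𝓕.subset hF
          have h1 := lintegral_maxFun_le (G := GQ F) hK hq hpj hs hsq
            (fun A hA C hC => hG A (hGsub F hA) C (hGsub F hC)) (fun A hA => hm A (hGsub F hA))
            (fun A hA => (Finset.mem_filter.1 hA).2) (hm F hFG) (fun A hA => ha A (hGsub F hA))
          refine (mul_le_mul' le_rfl h1).trans (le_of_eq ?_)
          rw [mul_left_comm]
          congr 1
          have hm1 : Measurable fun y => w F y ^ (s / q / pj) := (hwm F).pow_const _
          have hm2 : Measurable (F.indicator (1 : X → ℝ≥0∞)) := measurable_one.indicator (hm F hFG)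
          rw [← lintegral_const_mul _ ((hbm hm1 hm2).pow_const _)]
          refine lintegral_congr fun x => ?_
          have e2 : bilin μj μk (K x) (Φ F) (Ψ F) = b F ^ ((ρ - 1) / s) * (b F ^ ((ρ - 1) / pj) *
              bilin μj μk (K x) (fun y => w F y ^ (s / q / pj)) (F.indicator 1)) := by
            rw [const_mul_bilin (hKx x) hm1 hm2,
              const_mul_bilin (hKx x) (hm1.const_mul _) hm2]
            unfold bilin
            refine lintegral_congr fun y => lintegral_congr fun z => ?_
            simp only [hΦ, hΨ]
            ring
          rw [e2, ← mul_assoc, ENNReal.mul_rpow_of_nonneg _ _ hq0.le,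
            ← ENNReal.rpow_add_of_nonneg _ _ (by positivity) (by positivity), ← ENNReal.rpow_mul]
          congr 2
          calc ρ - 1 = (ρ - 1) * (q * (1 / pj) + q * (1 / s)) := by rw [hexp, mul_one]
            _ = _ := by ring
      _ = lowerConst q pj s * ∫⁻ x, ∑ F ∈ 𝓕, bilin μj μk (K x) (Φ F) (Ψ F) ^ q ∂μi := by
          rw [← Finset.mul_sum, lintegral_finsetSum]
          exact fun F hF => (hbm (hΦm F) (hΨm F hF)).pow_const _
      _ ≤ _ := by
          refine mul_le_mul' le_rfl (lintegral_mono fun x => ?_)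
          exact sum_bilin_rpow_le 𝓕 (hKx x) (fun F _ => hΦm F) hΨm hq hpj0 hs (by rw [hsq]; ring)
  have hΦn : ∫⁻ y, ((∑ F ∈ 𝓕, Φ F y ^ pj) ^ (1 / pj)) ^ pj ∂μj = X₀ := by
    have : ∀ y, ((∑ F ∈ 𝓕, Φ F y ^ pj) ^ (1 / pj)) ^ pj =
        ∑ F ∈ 𝓕, b F ^ (ρ - 1) * w F y ^ (s / q) := fun y => by
      rw [← ENNReal.rpow_mul, one_div_mul_cancel hpj0.ne', ENNReal.rpow_one]
      refine Finset.sum_congr rfl fun F _ => ?_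
      rw [hΦ, ENNReal.mul_rpow_of_nonneg _ _ hpj0.le, ← ENNReal.rpow_mul, ← ENNReal.rpow_mul,
        div_mul_cancel₀ _ hpj0.ne', div_mul_cancel₀ _ hpj0.ne']
    simp_rw [this]
    rw [lintegral_finsetSum _ fun F _ => ((hwm F).pow_const _).const_mul _]
    exact Finset.sum_congr rfl fun F _ => lintegral_const_mul _ ((hwm F).pow_const _)
  -- The stopping family for `b` bounds ∑ b_F^{ρ-1} 1_F by a power of its maximal function; the
  -- total exponent (ρ - 1) pk / s equals ρ, which brings back Y.
  have hΨn : ∫⁻ z, ((∑ F ∈ 𝓕, Ψ F z ^ s) ^ (1 / s)) ^ pk ∂μk ≤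
      geomConst (ρ - 1) ^ (pk / s) * Y := by
    rw [hY, ← lintegral_const_mul _ ((measurable_maxFun G.countable_toSet
      fun Q hQ => hm Q hQ).pow_const _)]
    refine lintegral_mono fun z => ?_
    rw [← ENNReal.rpow_mul]
    have h1 : ∑ F ∈ 𝓕, Ψ F z ^ s ≤ geomConst (ρ - 1) * maxFun G b z ^ (ρ - 1) := by
      refine (Finset.sum_congr rfl fun F _ => ?_).trans_le ((h𝓕.sum_rpow_le hG hρpos z).trans ?_)
      · rw [hΨ, ENNReal.mul_rpow_of_nonneg _ _ hs.le, ← ENNReal.rpow_mul,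
          div_mul_cancel₀ _ hs.ne']
        by_cases hz : z ∈ F <;> simp [hz, hs]
      · gcongr
        exact maxFun_mono (fun _ hA => h𝓕.subset hA) (fun _ _ => le_rfl) z
    refine (ENNReal.rpow_le_rpow h1 (by positivity)).trans (le_of_eq ?_)
    rw [ENNReal.mul_rpow_of_nonneg _ _ (by positivity), ← ENNReal.rpow_mul,
      one_div_mul_eq_div]
    congr 2
    rw [hρ1, hρ]
    field_simp
  have hgt : geomConst (ρ - 1) ^ (pk / s) ≠ ∞ :=
    ENNReal.rpow_ne_top_of_nonneg (by positivity) (geomConst_ne_top hρpos)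
  have h2 := hN (fun y => (∑ F ∈ 𝓕, Φ F y ^ pj) ^ (1 / pj))
    (fun z => (∑ F ∈ 𝓕, Ψ F z ^ s) ^ (1 / s))
    ((Finset.measurable_sum _ fun F _ => (hΦm F).pow_const _).pow_const _)
    ((Finset.measurable_sum _ fun F hF => (hΨm F hF).pow_const _).pow_const _)
    (by rwa [hΦn]) (ne_top_of_le_ne_top (ENNReal.mul_ne_top hgt hYt) hΨn)
  rw [hΦn] at h2
  have h2' := h2.trans (mul_le_mul' le_rfl (mul_le_mul' le_rfl
    (ENNReal.rpow_le_rpow hΨn (show 0 ≤ 1 / pk by positivity))))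
  set D := N * (geomConst (ρ - 1) ^ (pk / s) * Y) ^ (1 / pk) with hD
  -- First absorption, in X₀; what remains on the right involves Y alone, and the bound of Y by X₀
  -- then allows a second absorption, in Y.
  have h3 : X₀ ^ (1 / (s / q)) ≤ lowerConst q pj s * D ^ q := by
    refine rpow_le_of_le_mul_rpow (p := pj / q) (by positivity) ?_ hXt ?_
    · rw [one_div_div, one_div_div]
      linarith [hexp, mul_one_div q pj, mul_one_div q s]
    · refine hX1.trans ?_
      rw [mul_assoc]
      refine mul_le_mul' le_rfl ?_
      rw [one_div q, ENNReal.rpow_inv_le_iff hq0] at h2'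
      refine h2'.trans (le_of_eq ?_)
      rw [mul_left_comm, ENNReal.mul_rpow_of_nonneg _ _ hq0.le, ← ENNReal.rpow_mul,
        one_div_mul_eq_div, one_div_div, mul_comm, hD]
  have h4 : X₀ ^ (1 / s) ≤ lowerConst q pj s ^ (1 / q) * D := by
    have h5 := ENNReal.rpow_le_rpow h3 (show 0 ≤ 1 / q by positivity)
    rw [← ENNReal.rpow_mul, ENNReal.mul_rpow_of_nonneg _ _ (by positivity), ← ENNReal.rpow_mul,
      mul_one_div_cancel hq0.ne', ENNReal.rpow_one] at h5
    refine le_trans (le_of_eq ?_) h5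
    congr 1
    field_simp
  have hD' : D = geomConst (ρ - 1) ^ (1 / s) * N * Y ^ (1 / pk) := by
    rw [hD, ENNReal.mul_rpow_of_nonneg _ _ (by positivity), ← ENNReal.rpow_mul,
      show pk / s * (1 / pk) = 1 / s by field_simp]
    ring
  have h6 : Y ^ (1 / s) ≤ globalConst q pj s r * N * Y ^ (1 / pk) := by
    calc Y ^ (1 / s) ≤ (2 ^ ρ * X₀) ^ (1 / s) := ENNReal.rpow_le_rpow hYX (by positivity)
      _ = (2 ^ ρ) ^ (1 / s) * X₀ ^ (1 / s) := ENNReal.mul_rpow_of_nonneg _ _ (by positivity)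
      _ ≤ (2 ^ ρ) ^ (1 / s) * (lowerConst q pj s ^ (1 / q) * D) := mul_le_mul' le_rfl h4
      _ = _ := by rw [hD', globalConst]; ring
  have h7 := rpow_le_of_le_mul_rpow (p := pk / s) (q := r / s) (x := Y ^ (1 / s))
    (C := globalConst q pj s r * N) hρ0
    (by
      have h8 : s * (1 / r) = s * (1 / s - 1 / pk) := by rw [hrs]
      rw [mul_sub, mul_one_div_cancel hs.ne'] at h8
      rw [one_div_div, one_div_div]
      linarith [mul_one_div s r, mul_one_div s pk])
    (ENNReal.rpow_ne_top_of_nonneg (by positivity) hYt)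
    (h6.trans_eq (by
      rw [← ENNReal.rpow_mul, one_div_div, show 1 / s * (s / pk) = 1 / pk by field_simp]))
  rw [← ENNReal.rpow_mul, one_div_div, show 1 / s * (s / r) = 1 / r by field_simp] at h7
  exact h7

end finite

/-! ### Exhaustion by finite families -/

theorem exists_monotone_finset_iUnion {β : Type*} {𝓓 : Set β} (h𝓓 : 𝓓.Countable) :
    ∃ G : ℕ → Finset β, Monotone G ∧ (∀ n, (G n : Set β) ⊆ 𝓓) ∧ ∀ Q ∈ 𝓓, ∃ n, Q ∈ G n := by
  classical
  rcases 𝓓.eq_empty_or_nonempty with rfl | hne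
  · exact ⟨fun _ => ∅, fun _ _ _ => le_rfl, fun _ => by simp, fun Q hQ => hQ.elim⟩
  obtain ⟨f, rfl⟩ := h𝓓.exists_eq_range hne
  refine ⟨fun n => (Finset.range n).image f, fun m n hmn => ?_, fun n => ?_, ?_⟩
  · exact Finset.image_subset_image (Finset.range_mono hmn)
  · rw [Finset.coe_image]
    exact Set.image_subset_range _ _
  · rintro _ ⟨n, rfl⟩
    exact ⟨n + 1, Finset.mem_image_of_mem f (by simp)⟩

/-- The coefficients may vary with n as well: the averages in the global maximal function themselves
involve the exhausting family. -/
theorem maxFun_le_iSup {X : Type*} {𝓓 : Set (Set X)} {G : ℕ → Set (Set X)} (hG : Monotone G)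
    (h𝓓 : ∀ Q ∈ 𝓓, ∃ n, Q ∈ G n) {b : ℕ → Set X → ℝ≥0∞} (hb : Monotone b) {a : Set X → ℝ≥0∞}
    (ha : ∀ Q ∈ 𝓓, a Q ≤ ⨆ n, b n Q) (x : X) : maxFun 𝓓 a x ≤ ⨆ n, maxFun (G n) (b n) x := by
  refine maxFun_le fun Q hQ hx => (ha Q hQ).trans (iSup_le fun n => ?_)
  obtain ⟨m, hm⟩ := h𝓓 Q hQ
  refine le_iSup_of_le (max n m) ((hb (le_max_left n m) Q).trans ?_)
  exact le_maxFun (hG (le_max_right n m) hm) hx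

section exhaustion

variable {X : Type*} [MeasurableSpace X]

theorem lintegral_rpow_le_iSup {μ : Measure X} {v : ℕ → X → ℝ≥0∞} (hv : ∀ n, Measurable (v n))
    (hmono : Monotone v) {w : X → ℝ≥0∞} (hw : ∀ x, w x ≤ ⨆ n, v n x) {u : ℝ} (hu : 0 < u) :
    ∫⁻ x, w x ^ u ∂μ ≤ ⨆ n, ∫⁻ x, v n x ^ u ∂μ := by
  rw [← lintegral_iSup (fun n => (hv n).pow_const u)
    (fun m n hmn x => ENNReal.rpow_le_rpow (hmono hmn x) hu.le)]
  refine lintegral_mono fun x => ?_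
  refine (ENNReal.rpow_le_rpow (hw x) hu.le).trans ?_
  exact ((ENNReal.orderIsoRpow u hu).map_iSup _).le

variable {μi μj μk : Measure X} {K : X → X → X → ℝ≥0∞}
  {a : Set X → ℝ≥0∞} {q pj pk s r : ℝ} [SFinite μj] [SFinite μk] {𝓓 : Set (Set X)}

theorem local_wolff_le_of_countable (h𝓓 : 𝓓.Countable)
    (hK : Measurable fun w : X × X × X => K w.1 w.2.1 w.2.2)
    (hq : 1 < q) (hpj : 1 < pj) (hpk : 1 < pk) (hs : 0 < s) (hsq : 1 / s = 1 / q - 1 / pj)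
    (hG : IsLaminar 𝓓) (hm : ∀ Q ∈ 𝓓, MeasurableSet Q)
    (hjt : ∀ Q ∈ 𝓓, μj Q ≠ ∞) (hat : ∀ Q ∈ 𝓓, a Q ≠ ∞)
    {Q : Set X} (hQm : MeasurableSet Q) (hkQ : μk Q ≠ ∞)
    (ha : ∀ F ∈ 𝓓, a F * μj F ≤
      ∫⁻ x, bilin μj μk (K x) (F.indicator 1) (F.indicator 1) ^ q ∂μi) {N : ℝ≥0∞}
    (hN : ∀ f g : X → ℝ≥0∞, Measurable f → Measurable g → ∫⁻ x, f x ^ pj ∂μj ≠ ∞ →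
      ∫⁻ x, g x ^ pk ∂μk ≠ ∞ → (∫⁻ x, bilin μj μk (K x) f g ^ q ∂μi) ^ (1 / q) ≤
        N * ((∫⁻ x, f x ^ pj ∂μj) ^ (1 / pj) * (∫⁻ x, g x ^ pk ∂μk) ^ (1 / pk))) :
    (∫⁻ y, maxFun {Q' ∈ 𝓓 | Q' ⊆ Q} a y ^ (s / q) ∂μj) ^ (1 / s) ≤
      lowerConst q pj s ^ (1 / q) * N * μk Q ^ (1 / pk) := by
  obtain ⟨G, hGm, hGs, hGu⟩ := exists_monotone_finset_iUnion
    (h𝓓.mono (Set.sep_subset 𝓓 fun Q' => Q' ⊆ Q))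
  have hsub : ∀ n, ∀ F ∈ G n, F ∈ 𝓓 := fun n F hF => (hGs n hF).1
  rw [one_div s, ENNReal.rpow_inv_le_iff hs]
  refine (lintegral_rpow_le_iSup (v := fun n => maxFun (G n) a)
    (fun n => measurable_maxFun (G n).countable_toSet fun F hF => hm F (hsub n F hF))
    (fun m n hmn x => maxFun_mono (Finset.coe_subset.2 (hGm hmn)) (fun _ _ => le_rfl) x)
    (maxFun_le_iSup (G := fun n => (G n : Set (Set X)))
      (fun m n hmn => Finset.coe_subset.2 (hGm hmn)) hGu (b := fun _ => a)
      (fun _ _ _ => le_rfl) fun Q _ => le_iSup (fun _ : ℕ => a Q) 0)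
    (div_pos hs (by linarith))).trans (iSup_le fun n => ?_)
  rw [← ENNReal.rpow_inv_le_iff hs, ← one_div]
  exact local_wolff_le hK hq hpj hpk hs hsq
    (fun A hA B hB => hG A (hsub n A hA) B (hsub n B hB)) (fun F hF => hm F (hsub n F hF))
    (fun F hF => hjt F (hsub n F hF)) (fun F hF => hat F (hsub n F hF))
    (fun F hF => (hGs n hF).2) hQm hkQ (fun F hF => ha F (hsub n F hF)) hN

theorem global_wolff_le_of_countable (h𝓓 : 𝓓.Countable)
    (hK : Measurable fun w : X × X × X => K w.1 w.2.1 w.2.2)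
    (hq : 1 < q) (hpj : 1 < pj) (hpk : 1 < pk) (hs : 0 < s) (hsq : 1 / s = 1 / q - 1 / pj)
    (hr : 0 < r) (hrs : 1 / r = 1 / s - 1 / pk)
    (hG : IsLaminar 𝓓) (hm : ∀ Q ∈ 𝓓, MeasurableSet Q)
    (hjt : ∀ Q ∈ 𝓓, μj Q ≠ ∞) (hkt : ∀ Q ∈ 𝓓, μk Q ≠ ∞) (hat : ∀ Q ∈ 𝓓, a Q ≠ ∞)
    (hka : ∀ Q ∈ 𝓓, μk Q = 0 → a Q = 0)
    (ha : ∀ F ∈ 𝓓, a F * μj F ≤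
      ∫⁻ x, bilin μj μk (K x) (F.indicator 1) (F.indicator 1) ^ q ∂μi) {N : ℝ≥0∞}
    (hN : ∀ f g : X → ℝ≥0∞, Measurable f → Measurable g → ∫⁻ x, f x ^ pj ∂μj ≠ ∞ →
      ∫⁻ x, g x ^ pk ∂μk ≠ ∞ → (∫⁻ x, bilin μj μk (K x) f g ^ q ∂μi) ^ (1 / q) ≤
        N * ((∫⁻ x, f x ^ pj ∂μj) ^ (1 / pj) * (∫⁻ x, g x ^ pk ∂μk) ^ (1 / pk))) :
    (∫⁻ z, maxFun 𝓓 (wolffAverage μj μk a (s / q) 𝓓) z ^ (r / s) ∂μk) ^ (1 / r) ≤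
      globalConst q pj s r * N := by
  obtain ⟨G, hGm, hsub, hGu⟩ := exists_monotone_finset_iUnion h𝓓
  have hu : 0 < s / q := div_pos hs (by linarith)
  have hGm' : Monotone fun n => (G n : Set (Set X)) := fun m n hmn => Finset.coe_subset.2 (hGm hmn)
  have hin : ∀ Q, Monotone fun n => {Q' ∈ (G n : Set (Set X)) | Q' ⊆ Q} := fun Q m n hmn Q' hQ' =>
    ⟨hGm' hmn hQ'.1, hQ'.2⟩
  have havg : Monotone fun n => wolffAverage μj μk a (s / q) (G n) := fun m n hmn Q => by
    refine ENNReal.div_le_div_right (lintegral_mono fun x => ENNReal.rpow_le_rpow ?_ hu.le) _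
    exact maxFun_mono (hin Q hmn) (fun _ _ => le_rfl) x
  have hlim : ∀ Q, wolffAverage μj μk a (s / q) 𝓓 Q ≤
      ⨆ n, wolffAverage μj μk a (s / q) (G n) Q := fun Q => by
    simp only [wolffAverage]
    rw [← ENNReal.iSup_div]
    refine ENNReal.div_le_div_right (lintegral_rpow_le_iSup
      (fun n => measurable_maxFun ((G n).countable_toSet.mono (Set.sep_subset _ _))
        fun F hF => hm F (hsub n hF.1))
      (fun m n hmn x => maxFun_mono (hin Q hmn) (fun _ _ => le_rfl) x)
      (maxFun_le_iSup (hin Q) (fun Q' hQ' => (hGu Q' hQ'.1).imp fun n h => ⟨h, hQ'.2⟩)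
        (b := fun _ => a) (fun _ _ _ => le_rfl) fun Q _ => le_iSup (fun _ : ℕ => a Q) 0) hu) _
  rw [one_div r, ENNReal.rpow_inv_le_iff hr]
  refine (lintegral_rpow_le_iSup
    (v := fun n => maxFun (G n) (wolffAverage μj μk a (s / q) (G n)))
    (fun n => measurable_maxFun (G n).countable_toSet fun F hF => hm F (hsub n hF))
    (fun m n hmn x => maxFun_mono (hGm' hmn) (fun Q _ => havg hmn Q) x)
    (maxFun_le_iSup hGm' hGu havg fun Q _ => hlim Q)
    (div_pos hr hs)).trans (iSup_le fun n => ?_)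
  rw [← ENNReal.rpow_inv_le_iff hr, ← one_div]
  exact global_wolff_le hK hq hpj hpk hs hsq hr hrs
    (fun A hA B hB => hG A (hsub n hA) B (hsub n hB)) (fun F hF => hm F (hsub n hF))
    (fun F hF => hjt F (hsub n hF)) (fun F hF => hkt F (hsub n hF))
    (fun F hF => hat F (hsub n hF)) (fun F hF => hka F (hsub n hF))
    (fun F hF => ha F (hsub n hF)) hN

end exhaustion

/-! ### The Wolff constants are bounded by the norm -/

theorem lowerConst_ne_top {q pj s : ℝ} (hq : 0 < q) (hpj : 0 < pj) (hs : 0 < s) :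
    lowerConst q pj s ≠ ∞ :=
  ENNReal.mul_ne_top (ENNReal.rpow_ne_top_of_nonneg (by positivity) (by simp))
    (ENNReal.rpow_ne_top_of_nonneg hq.le (geomConst_ne_top (by positivity)))

theorem globalConst_ne_top {q pj pk s r : ℝ} (hq : 0 < q) (hpj : 0 < pj) (hpk : 0 < pk)
    (hs : 0 < s) (hr : 0 < r) (hrs : 1 / r = 1 / s - 1 / pk) : globalConst q pj s r ≠ ∞ := by
  have h : 0 < r / s - 1 := by
    have h1 : r * (1 / r) = r * (1 / s - 1 / pk) := by rw [hrs]
    rw [mul_one_div_cancel hr.ne'] at h1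
    have h2 : 0 < r / pk := by positivity
    rw [div_eq_mul_one_div] at h2 ⊢
    linarith
  refine ENNReal.mul_ne_top (ENNReal.mul_ne_top ?_ ?_) ?_
  · exact ENNReal.rpow_ne_top_of_nonneg (by positivity)
      (ENNReal.rpow_ne_top_of_nonneg (by positivity) (by simp))
  · exact ENNReal.rpow_ne_top_of_nonneg (by positivity) (lowerConst_ne_top hq hpj hs)
  · exact ENNReal.rpow_ne_top_of_nonneg (by positivity) (geomConst_ne_top h)

section wolffBound

variable {n : ℕ} {α : ℝ} {p : Fin 3 → ℝ} (loc : Loc) {σ : Fin 3 → Measure (Rn n)}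
  (e : Equiv.Perm (Fin 3))

theorem testNorm_rpow_le (hp : ∀ i, 1 < p i) (Q : Set (Rn n)) :
    testNorm loc α p σ e Q ^ (p (e 0)).conjExponent ≤
      ∫⁻ x, partialOp α σ e (Q.indicator 1) (Q.indicator 1) x ^ (p (e 0)).conjExponent
        ∂σ (e 0) := by
  have hq := (Real.HolderConjugate.conjExponent (hp (e 0))).symm.pos
  rw [testNorm_eq hp, ← ENNReal.rpow_mul, one_div_mul_cancel hq.ne', ENNReal.rpow_one]
  exact lintegral_mono fun x => ENNReal.rpow_le_rpow (localized_le_input loc σ e Q x) hq.le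

theorem testNorm_le [∀ i, SigmaFinite (σ i)] (hp : ∀ i, 1 < p i) (hN : opNorm α p σ ≠ ∞)
    {Q : Set (Rn n)} (hQ : MeasurableSet Q) (hfin : ∀ i, σ i Q ≠ ∞) :
    testNorm loc α p σ e Q ≤
      opNorm α p σ * (σ (e 1) Q ^ (1 / p (e 1)) * σ (e 2) Q ^ (1 / p (e 2))) := by
  have hq := (Real.HolderConjugate.conjExponent (hp (e 0))).symm.pos
  have hind : ∀ i, ∫⁻ x, (Q.indicator (1 : Rn n → ℝ≥0∞) x) ^ p i ∂σ i = σ i Q := fun i => by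
    have h0 : 0 < p i := by linarith [hp i]
    rw [← lintegral_indicator_one hQ]
    refine lintegral_congr fun x => ?_
    by_cases hx : x ∈ Q <;> simp [hx, h0]
  have h := lintegral_partialOp_rpow_le (σ := σ) (α := α) hp hN e (f := Q.indicator 1)
    (g := Q.indicator 1) (measurable_one.indicator hQ) (measurable_one.indicator hQ)
    (by rw [hind]; exact hfin _) (by rw [hind]; exact hfin _)
  rw [hind, hind] at h
  refine le_trans ?_ h
  rw [one_div, ENNReal.le_rpow_inv_iff hq]
  exact testNorm_rpow_le loc e hp Q

/-- The three cases of the definition of 𝔚 correspond to indicators as test functions, the local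
estimate and the global estimate. The constant depends on neither the measures nor the localization
nor the family 𝓓. -/
theorem wolff_le_opNorm (hp : ∀ i, 1 < p i) : ∃ C : ℝ≥0∞, C ≠ ∞ ∧
    ∀ (loc : Loc) (σ : Fin 3 → Measure (Rn n)) [∀ i, SigmaFinite (σ i)] (𝓓 : Set (Set (Rn n))),
      𝓓.Countable → IsLaminar 𝓓 → (∀ Q ∈ 𝓓, MeasurableSet Q) → (∀ i, ∀ Q ∈ 𝓓, σ i Q ≠ ∞) →
        wolff loc α p σ 𝓓 e ≤ C * opNorm α p σ := by
  suffices H : ∃ C : ℝ≥0∞, C ≠ ∞ ∧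
      ∀ (loc : Loc) (σ : Fin 3 → Measure (Rn n)) [∀ i, SigmaFinite (σ i)] (𝓓 : Set (Set (Rn n))),
        𝓓.Countable → IsLaminar 𝓓 → (∀ Q ∈ 𝓓, MeasurableSet Q) → (∀ i, ∀ Q ∈ 𝓓, σ i Q ≠ ∞) →
          opNorm α p σ ≠ ∞ → wolff loc α p σ 𝓓 e ≤ C * opNorm α p σ by
    obtain ⟨C, hC, H⟩ := H
    -- The added 1 makes the constant nonzero, so that its product with an infinite norm is
    -- infinite.
    refine ⟨C + 1, by simp [hC], fun loc σ _ 𝓓 h1 h2 h3 h4 => ?_⟩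
    by_cases hN : opNorm α p σ = ∞
    · simp [hN]
    · exact (H loc σ 𝓓 h1 h2 h3 h4 hN).trans (mul_le_mul_left le_self_add _)
  set q := (p (e 0)).conjExponent with hqdef
  have hq1 : 1 < q := (Real.HolderConjugate.conjExponent (hp (e 0))).symm.lt
  have hq0 : 0 < q := by linarith
  have hp0 : ∀ i, 0 < p i := fun i => by linarith [hp i]
  by_cases h1 : 1 ≤ 1 / p (e 0) + 1 / p (e 1)
  · refine ⟨1, by simp, fun loc σ _ 𝓓 _ _ hm hfin hN => ?_⟩
    rw [wolff, if_pos h1, one_mul]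
    exact iSup₂_le fun Q hQ => ENNReal.div_le_of_le_mul
      (testNorm_le loc e hp hN (hm Q hQ) fun i => hfin i Q hQ)
  obtain ⟨s, hs1, hs, hsq⟩ := exists_rk_eq p e hp (not_le.1 h1)
  have hs0 : 0 < s := by linarith
  have htest : ∀ (loc : Loc) (σ : Fin 3 → Measure (Rn n)) [∀ i, SigmaFinite (σ i)]
      (Q : Set (Rn n)), MeasurableSet Q → (∀ i, σ i Q ≠ ∞) → opNorm α p σ ≠ ∞ →
        wolffCoeff loc α p σ e Q ≠ ∞ := by
    intro loc σ _ Q hQ hfin hN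
    by_cases h0 : σ (e 1) Q = 0
    · rw [wolffCoeff, testNorm_eq_zero_left loc σ e hp h0, ENNReal.zero_rpow_of_pos hq0,
        ENNReal.zero_div]
      exact ENNReal.zero_ne_top
    refine ENNReal.div_ne_top (ENNReal.rpow_ne_top_of_nonneg hq0.le ?_) h0
    refine ne_top_of_le_ne_top ?_ (testNorm_le loc e hp hN hQ hfin)
    refine ENNReal.mul_ne_top hN (ENNReal.mul_ne_top ?_ ?_) <;>
    exact ENNReal.rpow_ne_top_of_nonneg (one_div_nonneg.2 (hp0 _).le) (hfin _)
  have hcoeff : ∀ (loc : Loc) (σ : Fin 3 → Measure (Rn n)) (F : Set (Rn n)),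
      wolffCoeff loc α p σ e F * σ (e 1) F ≤
        ∫⁻ x, partialOp α σ e (F.indicator 1) (F.indicator 1) x ^ q ∂σ (e 0) :=
    fun loc σ F => (by rw [mul_comm]; exact ENNReal.mul_div_le : _ ≤ _).trans
      (testNorm_rpow_le loc e hp F)
  by_cases h2 : 1 ≤ 1 / p (e 0) + 1 / p (e 1) + 1 / p (e 2)
  · refine ⟨lowerConst q (p (e 1)) s ^ (1 / q), ENNReal.rpow_ne_top_of_nonneg (by positivity)
      (lowerConst_ne_top hq0 (hp0 _) hs0), fun loc σ _ 𝓓 h𝓓 hG hm hfin hN => ?_⟩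
    rw [wolff, if_neg h1, if_pos h2]
    refine iSup₂_le fun Q hQ => ENNReal.div_le_of_le_mul ?_
    rw [wolffLocalNorm_eq loc σ e hs0 hs]
    exact local_wolff_le_of_countable h𝓓 (measurable_permuted_kernel e) hq1 (hp (e 1)) (hp (e 2))
      hs0 hsq hG hm (hfin _) (fun Q hQ => htest loc σ Q (hm Q hQ) (fun i => hfin i Q hQ) hN)
      (hm Q hQ) (hfin _ Q hQ) (fun F _ => hcoeff loc σ F)
      (fun f g hf hg hf' hg' => lintegral_partialOp_rpow_le (σ := σ) hp hN e hf hg hf' hg')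
  obtain ⟨r, hr1, hr, hrs⟩ := exists_rTot_eq p e hp hsq (not_le.1 h2)
  have hr0 : 0 < r := by linarith
  refine ⟨globalConst q (p (e 1)) s r, globalConst_ne_top hq0 (hp0 _) (hp0 _) hs0 hr0 hrs,
    fun loc σ _ 𝓓 h𝓓 hG hm hfin hN => ?_⟩
  have hpow : ∀ x, (wolffGlobal loc α p σ 𝓓 e x ^ (1 / (rk p e).toReal)) ^ r =
      maxFun 𝓓 (wolffAverage (σ (e 1)) (σ (e 2)) (wolffCoeff loc α p σ e) (s / q) 𝓓) x ^
        (r / s) := by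
    intro x
    rw [wolffGlobal, hs, ENNReal.toReal_ofReal hs0.le, ← ENNReal.rpow_mul, one_div_mul_eq_div]
    simp_rw [wolffLocalNorm_eq loc σ e hs0 hs, ← ENNReal.rpow_mul, one_div_mul_cancel hs0.ne',
      ENNReal.rpow_one]
    rfl
  rw [wolff, if_neg h1, if_neg h2, hr, eLpNorm_ofReal_eq _ hr0]
  simp_rw [hpow]
  exact global_wolff_le_of_countable h𝓓 (measurable_permuted_kernel e) hq1 (hp (e 1)) (hp (e 2))
    hs0 hsq hr0 hrs hG hm (hfin _) (hfin _)
    (fun Q hQ => htest loc σ Q (hm Q hQ) (fun i => hfin i Q hQ) hN)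
    (fun Q hQ h0 => by
      rw [wolffCoeff, testNorm_eq_zero_right loc σ e hp h0, ENNReal.zero_rpow_of_pos hq0,
        ENNReal.zero_div])
    (fun F _ => hcoeff loc σ F)
    (fun f g hf hg hf' hg' => lintegral_partialOp_rpow_le (σ := σ) hp hN e hf hg hf' hg')

end wolffBound

end BilinearFractional

end

/-! ### Closing the cycle of inequalities -/

open BilinearFractional in
theorem theorem6p1 (n : ℕ) (α : ℝ) (hα₀ : 0 < α) (hα₁ : α < 2 * (n : ℝ))
    (p : Fin 3 → ℝ) (hp : ∀ i, 1 < p i) :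
    ∃ C : ℝ≥0, ∀ (σ : Fin 3 → Measure (BilinearFractional.Rn n)),
      (∀ i, IsLocallyFiniteMeasure (σ i)) →
      ∀ loc : BilinearFractional.Loc,
        BilinearFractional.Comparable C (BilinearFractional.opNorm α p σ)
          (∑ t ∈ BilinearFractional.shifts n, ∑ e : Equiv.Perm (Fin 3),
            BilinearFractional.wolff loc α p σ (BilinearFractional.grid t) e) ∧
        BilinearFractional.Comparable C (BilinearFractional.opNorm α p σ)
          (∑ t ∈ BilinearFractional.shifts n, ∑ e : Equiv.Perm (Fin 3),
            BilinearFractional.seqTesting loc α p σ (BilinearFractional.grid t) e) ∧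
        BilinearFractional.Comparable C
          (∑ t ∈ BilinearFractional.shifts n, ∑ e : Equiv.Perm (Fin 3),
            BilinearFractional.wolff loc α p σ (BilinearFractional.grid t) e)
          (∑ t ∈ BilinearFractional.shifts n, ∑ e : Equiv.Perm (Fin 3),
            BilinearFractional.seqTesting loc α p σ (BilinearFractional.grid t) e) := by
  have hn : 0 < n := by
    by_contra h
    obtain rfl : n = 0 := by omega
    norm_num at hα₁
    linarith
  choose D hD hDle using fun e => wolff_le_opNorm (n := n) (α := α) (p := p) e hp
  set A : ENNReal := upperConst n α p with hA
  set B : ENNReal := ∑ _t ∈ shifts n, ∑ e, D e with hB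
  have hAt : A ≠ ⊤ := upperConst_ne_top hα₁ hp
  have hBt : B ≠ ⊤ := ENNReal.sum_ne_top.2 fun _ _ => ENNReal.sum_ne_top.2 fun e _ => hD e
  -- A single finite constant dominating A, B and 4, and also the products 4A, 4B and AB that arise
  -- on going two steps round the cycle N ≤ A T, T ≤ 4 W, W ≤ B N.
  have hCt : (A + 1) * (B + 1) * 4 ≠ ⊤ :=
    ENNReal.mul_ne_top (ENNReal.mul_ne_top (by simp [hAt]) (by simp [hBt])) (by simp)
  have c1 : 1 ≤ A + 1 := le_add_self
  have c2 : 1 ≤ B + 1 := le_add_self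
  have c4 : (1 : ENNReal) ≤ 4 := by norm_num
  have hA1 : A ≤ (A + 1) * (B + 1) := le_mul_of_le_of_one_le le_self_add c2
  have hB1 : B ≤ (A + 1) * (B + 1) := le_mul_of_one_le_of_le c1 le_self_add
  have hA4 : A * 4 ≤ (A + 1) * (B + 1) * 4 := mul_le_mul_left hA1 _
  have hB4 : 4 * B ≤ (A + 1) * (B + 1) * 4 := by
    rw [mul_comm 4 B]; exact mul_le_mul_left hB1 _
  have hBA : B * A ≤ (A + 1) * (B + 1) * 4 := by
    rw [mul_comm B A]
    exact le_mul_of_le_of_one_le (mul_le_mul' le_self_add le_self_add) c4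
  refine ⟨((A + 1) * (B + 1) * 4).toNNReal, fun σ hσ loc => ?_⟩
  have hfin : ∀ t, ∀ i, ∀ Q ∈ grid t, σ i Q ≠ ⊤ := fun t i Q hQ =>
    measure_ne_top_of_mem_grid (σ i) hQ
  set N := opNorm α p σ
  set W := ∑ t ∈ shifts n, ∑ e, wolff loc α p σ (grid t) e
  set T := ∑ t ∈ shifts n, ∑ e, seqTesting loc α p σ (grid t) e
  have hNT : N ≤ A * T := opNorm_le_seqTesting hα₁ hn hp σ loc
  have hTW : T ≤ 4 * W := by
    simp only [T, W, Finset.mul_sum]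
    exact Finset.sum_le_sum fun t _ => Finset.sum_le_sum fun e _ =>
      seqTesting_le_wolff loc σ e hp (countable_grid t) (hfin t)
  have hWN : W ≤ B * N := by
    simp only [W, B, Finset.sum_mul]
    exact Finset.sum_le_sum fun t ht => Finset.sum_le_sum fun e _ =>
      hDle e loc σ (grid t) (countable_grid t) (isLaminar_grid ht)
        (fun Q hQ => measurableSet_of_mem_grid hQ) (hfin t)
  simp only [Comparable, ENNReal.coe_toNNReal hCt]
  have h4 : (4 : ENNReal) ≤ (A + 1) * (B + 1) * 4 :=
    le_mul_of_one_le_of_le (one_le_mul c1 c2) le_rfl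
  refine ⟨⟨?_, ?_⟩, ⟨?_, ?_⟩, ⟨?_, ?_⟩⟩
  · refine hNT.trans ((mul_le_mul_right hTW A).trans ?_)
    rw [← mul_assoc]
    exact mul_le_mul_left hA4 _
  · exact hWN.trans (mul_le_mul_left (le_mul_of_le_of_one_le hB1 c4) _)
  · exact hNT.trans (mul_le_mul_left (le_mul_of_le_of_one_le hA1 c4) _)
  · refine hTW.trans ((mul_le_mul_right hWN 4).trans ?_)
    rw [← mul_assoc]
    exact mul_le_mul_left hB4 _
  · refine hWN.trans ((mul_le_mul_right hNT B).trans ?_)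
    rw [← mul_assoc]
    exact mul_le_mul_left hBA _
  · exact hTW.trans (mul_le_mul_left h4 _)
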